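/- **Conventions.** Work over $\mathbb C$. Let $G=\mathrm{GL}_n(\mathbb C)$, let $B$ and $B_-$ be the subgroups of upper and lower triangular matrices, and let $e_w=wB\in G/B$, where the permutation matrix of $w\in S_n$ has its $1$'s at the positions $(w(j),j)$. The Schubert variety $X_w$ is the Zariski closure of $BwB/B$ in $G/B$, the opposite Schubert cell is $\Omega_u=B_-uB/B$, and the Kazhdan–Lusztig variety is $\mathcal N_{u,v}=X_v\cap\Omega_u$. Let $D(u)=\{(p,q): u(q)<p,\ u^{-1}(p)>q\}$, and for $z\in\mathbb C^{D(u)}$ let $M_u(z)$ be the matrix with entries $1$ at $(u(q),q)$, $z_{p,q}$ at $(p,q)\in D(u)$, and $0$ elsewhere. The isomorphism $z\mapsto M_u(z)B$ from $\mathbb C^{D(u)}$ to $\Omega_u$ makes $\mathcal N_{u,v}$ an affine variety, whose coordinate ring is $\mathbb C[z_{p,q}]$ modulo the ideal of polynomials vanishing on it; the origin $\mathbf 0$ is $z=0$, that is, $e_u$. A local ring is lci if it is the quotient of a regular local ring by an ideal generated by a regular sequence. Permutations are written in one-line notation. **Proposition.** For each interval $[u,v]$ listed below, $\mathbf 0$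 is a point of $\mathcal N_{u,v}$, and for every point $P$ of (the scheme) $\mathcal N_{u,v}$ the local ring at $P$ fails to be lci if and only if $P=\mathbf 0$. Moreover $\mathcal N_{u,v}$ is isomorphic to the closed subscheme of affine space given below, whose ideal has codimension $c$ and minimal number of generators $g$ as indicated; in every case $g>c$. * Family A, for $a,b>0$ with $a>1$ or $b>1$: $[(a{+}1)a\cdots1\,(a{+}b{+}2)\cdots(a{+}2),\ (a{+}b{+}2)(a{+}1)a\cdots2\,(a{+}b{+}1)\cdots(a{+}2)\,1]$. The model is the variety of $(a+1)\times(b+1)$ matrices of rank at most $1$, defined by the $2\times2$ minors; $c=ab$ and $g=\binom{a+1}2\binom{b+1}2$. * Family B, for $a,b\ge0$ with $a+b\ge1$: $[(a{+}1)\cdots1\,(a{+}3)(a{+}2)(a{+}b{+}4)\cdots(a{+}4),\ (a{+}3)(a{+}1)\cdots2\,(a{+}b{+}4)\,1\,(a{+}b{+}3)\cdots(a{+}4)(a{+}2)]$. The model is the variety of $(a+b+2)\times2$ matrices of rank at most $1$, defined by the $2\times2$ minors; $c=a+b+1$ and $g=\binom{a+b+2}2$. * $C=[21354,52341]$, $D=[132546,351624]$,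 $E=[421653,642531]$, $E^{\mathrm i}=[326154,635241]$, $F=[215436,526314]$, $F^{\mathrm i}=[215436,524613]$, $F^{\mathrm{rc}}=[143265,364152]$, $F^{\mathrm{irc}}=[143265,461352]$. The model is the variety of $3\times3$ "matrices" $\begin{pmatrix}a&b&\\c&d&e\\f&g&h\end{pmatrix}$ of rank $1$ with a corner cut out, defined in $\mathbb C^8$ by $ad-bc$, $ag-bf$, $cg-df$, $ch-ef$, $dh-eg$; the codimension is $3$ and the minimal number of generators is $5$. * $G=[215436,526413]$, $G^{\mathrm{rc}}=[143265,463152]$. The model is defined in $\mathbb C^9$, with coordinates $\begin{pmatrix}a&b&c\\d&e&f\\g&h&i\end{pmatrix}$, by $ae-bd$, $af-cd$, $bf-ce$, $ag+bh+ci$, $dg+eh+fi$ (the first two rows are dependent and both orthogonal to the third); the codimension is $3$ and the minimal number of generators is $5$. * $H=[2154376,5274163]$. The model is defined in $\mathbb C^{12}$, with coordinates $\begin{pmatrix}a&b&c\\d&e&f\\g&h&i\\j&k&l\end{pmatrix}$, by $ae-bd$, $af-cd$, $bf-ce$, $gk-hj$, $gl-ij$, $hl-ik$, $ag+bh+ci$,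 $dg+eh+fi$, $aj+bk+cl$, $dj+ek+fl$ (the first two rows are dependent, the last two rows are dependent, and the first two are orthogonal to the last two); the codimension is $5$ and the minimal number of generators is $10$. -/

import Mathlib

noncomputable section

namespace SchubertLCI

open Matrix MvPolynomial

/-! ### Local complete intersections -/

/-- A ring `R` is a local complete intersection (lci) local ring if it is the quotient of a regular
local ring by an ideal generated by a regular sequence. -/
def IsLCILocalRing (R : Type) [CommRing R] : Prop :=
  ∃ (S : Type) (_ : CommRing S) (_ : IsRegularLocalRing S) (rs : List S),
    RingTheory.Sequence.IsRegular S rs ∧ Nonempty (R ≃+* S ⧸ Ideal.ofList rs)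

/-! ### Flag varieties, Schubert varieties and Kazhdan-Lusztig varieties over `ℂ` -/

/-- The subgroup `B` of invertible upper triangular matrices. -/
def upperBorel (n : ℕ) : Subgroup (GL (Fin n) ℂ) where
  carrier := {g | BlockTriangular (g : Matrix (Fin n) (Fin n) ℂ) id}
  mul_mem' {g h} hg hh := by
    simpa using BlockTriangular.mul (M := (g : Matrix (Fin n) (Fin n) ℂ)) hg hh
  one_mem' := by simpa using blockTriangular_one
  inv_mem' {g} hg := by
    have hg' : BlockTriangular (g : Matrix (Fin n) (Fin n) ℂ) id := hg
    have : Invertible (g : Matrix (Fin n) (Fin n) ℂ) := g.invertible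
    simpa using blockTriangular_inv_of_blockTriangular hg'

/-- The subgroup `B₋` of invertible lower triangular matrices. -/
def lowerBorel (n : ℕ) : Subgroup (GL (Fin n) ℂ) where
  carrier := {g | BlockTriangular (g : Matrix (Fin n) (Fin n) ℂ) OrderDual.toDual}
  mul_mem' {g h} hg hh := by
    simpa using BlockTriangular.mul (M := (g : Matrix (Fin n) (Fin n) ℂ)) hg hh
  one_mem' := by simpa using blockTriangular_one
  inv_mem' {g} hg := by
    have hg' : BlockTriangular (g : Matrix (Fin n) (Fin n) ℂ) OrderDual.toDual := hg
    have : Invertible (g : Matrix (Fin n) (Fin n) ℂ) := g.invertible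
    simpa using blockTriangular_inv_of_blockTriangular hg'

/-- The flag variety `G / B` (as a set of cosets), where `G = GL n ℂ`. -/
abbrev FlagVariety (n : ℕ) : Type := GL (Fin n) ℂ ⧸ upperBorel n

/-- The closed sets of the Zariski topology of `G / B`, which is the quotient topology: the
preimage in `G` has to be the common zero set in `G` of some polynomials in the matrix entries. -/
def IsZariskiClosed {n : ℕ} (Z : Set (FlagVariety n)) : Prop :=
  ∃ T : Set (MvPolynomial (Fin n × Fin n) ℂ), ∀ g : GL (Fin n) ℂ,
    (QuotientGroup.mk g : FlagVariety n) ∈ Z ↔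
      ∀ f ∈ T, eval (fun p => (g : Matrix (Fin n) (Fin n) ℂ) p.1 p.2) f = 0

/-- The Zariski closure of a subset of `G / B`. -/
def zariskiClosure {n : ℕ} (Y : Set (FlagVariety n)) : Set (FlagVariety n) :=
  ⋂₀ {Z | IsZariskiClosed Z ∧ Y ⊆ Z}

/-- The diagram `D(w)`: the boxes `(p, q)` with `w(q) < p` and `w⁻¹(p) > q`. -/
def diagram {n : ℕ} (w : Equiv.Perm (Fin n)) : Set (Fin n × Fin n) :=
  {b | w b.2 < b.1 ∧ b.2 < w.symm b.1}

instance {n : ℕ} (w : Equiv.Perm (Fin n)) : DecidablePred (· ∈ diagram w) :=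
  fun b => inferInstanceAs (Decidable (w b.2 < b.1 ∧ b.2 < w.symm b.1))

instance {n : ℕ} (w : Equiv.Perm (Fin n)) : Fintype (diagram w) :=
  Subtype.fintype (· ∈ diagram w)

/-- The matrix `M_w(z)`: it has `1` at the positions `(w(q), q)`, the coordinate `z b` at each box
`b` of the diagram of `w`, and `0` elsewhere. -/
def cellMatrix {n : ℕ} (w : Equiv.Perm (Fin n)) (z : diagram w → ℂ) : Matrix (Fin n) (Fin n) ℂ :=
  Matrix.of fun p q =>
    if p = w q then 1 else if h : (p, q) ∈ diagram w then z ⟨(p, q), h⟩ else 0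

theorem det_cellMatrix_ne_zero {n : ℕ} (w : Equiv.Perm (Fin n)) (z : diagram w → ℂ) :
    (cellMatrix w z).det ≠ 0 := by
  have h1 : ((cellMatrix w z).submatrix id w.symm).det = 1 := by
    rw [det_of_isLowerTriangular]
    · simp [cellMatrix]
    · intro i j hij
      have hij' : i < j := hij
      have : ¬ (j < i) := not_lt.2 hij'.le
      simp [cellMatrix, diagram, this, hij'.ne]
  have h2 := det_permute' w.symm (cellMatrix w z)
  rw [h1] at h2
  intro h
  rw [h, mul_zero] at h2
  exact one_ne_zero h2

/-- `M_w(z)` as an element of `G`. -/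
def cellPoint {n : ℕ} (w : Equiv.Perm (Fin n)) (z : diagram w → ℂ) : GL (Fin n) ℂ :=
  GeneralLinearGroup.mkOfDetNeZero (cellMatrix w z) (det_cellMatrix_ne_zero w z)

/-- The permutation matrix of `w`, with `1` at the positions `(w(q), q)`, as an element of `G`. -/
def permMatrixGL {n : ℕ} (w : Equiv.Perm (Fin n)) : GL (Fin n) ℂ :=
  GeneralLinearGroup.mkOfDetNeZero (Matrix.of fun p q => if p = w q then (1 : ℂ) else 0) (by
    have h := det_cellMatrix_ne_zero w 0
    have e : cellMatrix w 0 = Matrix.of fun p q => if p = w q then (1 : ℂ) else 0 := by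
      ext p q
      simp [cellMatrix]
    rwa [e] at h)

/-- The Schubert point `e_w = wB`. -/
def schubertPoint {n : ℕ} (w : Equiv.Perm (Fin n)) : FlagVariety n :=
  QuotientGroup.mk (permMatrixGL w)

/-- The Schubert cell `BwB/B`. -/
def schubertCell {n : ℕ} (w : Equiv.Perm (Fin n)) : Set (FlagVariety n) :=
  MulAction.orbit (upperBorel n) (schubertPoint w)

/-- The Schubert variety `X_w`, the closure of the Schubert cell. -/
def schubertVariety {n : ℕ} (w : Equiv.Perm (Fin n)) : Set (FlagVariety n) :=
  zariskiClosure (schubertCell w)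

/-- The opposite Schubert cell `Ω_w = B₋wB/B`. -/
def oppositeCell {n : ℕ} (w : Equiv.Perm (Fin n)) : Set (FlagVariety n) :=
  MulAction.orbit (lowerBorel n) (schubertPoint w)

/-- The Kazhdan-Lusztig variety `N_{u,v} = X_v ∩ Ω_u`, as a subset of `G / B`. -/
def klVariety {n : ℕ} (u v : Equiv.Perm (Fin n)) : Set (FlagVariety n) :=
  schubertVariety v ∩ oppositeCell u

/-- The ideal of `N_{u,v}` in the coordinate ring `ℂ[z_b : b ∈ D(u)]` of the opposite cell `Ω_u`,
which is identified with an affine space by the isomorphism `z ↦ M_u(z)B`. -/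
def klIdeal {n : ℕ} (u v : Equiv.Perm (Fin n)) : Ideal (MvPolynomial (diagram u) ℂ) :=
  vanishingIdeal ℂ
    {z : diagram u → ℂ | (QuotientGroup.mk (cellPoint u z) : FlagVariety n) ∈ klVariety u v}

/-- The coordinate ring of the affine variety `N_{u,v}`. -/
abbrev KLRing {n : ℕ} (u v : Equiv.Perm (Fin n)) : Type :=
  MvPolynomial (diagram u) ℂ ⧸ klIdeal u v

/-- The ideal of the origin `z = 0` (that is, of the Schubert point `e_u`) in the coordinate
ring of `N_{u,v}`. -/
def originIdeal {n : ℕ} (u v : Equiv.Perm (Fin n)) : Ideal (KLRing u v) :=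
  Ideal.span (Set.range fun b : diagram u => Ideal.Quotient.mk (klIdeal u v) (X b))

/-! ### The intervals -/

/-- The permutation with a given one-line notation, a list that rearranges `1, …, n`. (The
underlying set of `Fin n` is `0, …, n - 1`, so that all values are shifted by one.) -/
def ofOneLine (n : ℕ) (l : List ℕ) (hl : l.Perm (List.range' 1 n)) : Equiv.Perm (Fin n) where
  toFun i := ⟨l[(i : ℕ)]'(by simp [hl.length_eq]) - 1, by
    have h : l[(i : ℕ)]'(by simp [hl.length_eq]) ∈ List.range' 1 n :=
      hl.mem_iff.1 (List.getElem_mem _)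
    rw [List.mem_range'_1] at h
    omega⟩
  invFun j := ⟨l.idxOf ((j : ℕ) + 1), by
    have h : (j : ℕ) + 1 ∈ l := hl.mem_iff.2 (by rw [List.mem_range'_1]; omega)
    simpa [hl.length_eq] using List.idxOf_lt_length_of_mem h⟩
  left_inv i := by
    have h : l[(i : ℕ)]'(by simp [hl.length_eq]) ∈ List.range' 1 n :=
      hl.mem_iff.1 (List.getElem_mem _)
    rw [List.mem_range'_1] at h
    have hn : l.Nodup := hl.nodup_iff.2 List.nodup_range'
    ext
    simp only
    rw [Nat.sub_add_cancel h.1, hn.idxOf_getElem]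
  right_inv j := by
    ext
    simp

/-- A pair `[u, v]` of permutations of the same size. -/
structure PermInterval where
  /-- the size -/
  n : ℕ
  /-- the lower end `u` -/
  lo : Equiv.Perm (Fin n)
  /-- the upper end `v` -/
  hi : Equiv.Perm (Fin n)

/-- The descending list `x, x - 1, …, y`, which is empty if `x < y`. -/
def desc (x y : ℕ) : List ℕ := (List.range' y (x + 1 - y)).reverse

theorem mem_desc {x y k : ℕ} : k ∈ desc x y ↔ y ≤ k ∧ k ≤ x := by
  simp only [desc, List.mem_reverse, List.mem_range'_1]
  omega

theorem nodup_desc (x y : ℕ) : (desc x y).Nodup := by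
  simp [desc, List.nodup_range']

/-- Family A: `[(a+1)⋯1 (a+b+2)⋯(a+2), (a+b+2) (a+1)⋯2 (a+b+1)⋯(a+2) 1]`. -/
def familyA (a b : ℕ) : PermInterval where
  n := a + b + 2
  lo := ofOneLine (a + b + 2) (desc (a + 1) 1 ++ desc (a + b + 2) (a + 2)) (by
    rw [List.perm_ext_iff_of_nodup _ List.nodup_range']
    · intro k; simp only [List.mem_append, mem_desc, List.mem_range'_1]; omega
    · simp only [List.nodup_append', nodup_desc, List.disjoint_left, mem_desc, true_and]
      intros; omega)
  hi := ofOneLine (a + b + 2)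
    ([a + b + 2] ++ desc (a + 1) 2 ++ desc (a + b + 1) (a + 2) ++ [1]) (by
    rw [List.perm_ext_iff_of_nodup _ List.nodup_range']
    · intro k; simp only [List.mem_append, mem_desc, List.mem_range'_1, List.mem_singleton]; omega
    · simp only [List.nodup_append', nodup_desc, List.disjoint_left, mem_desc, true_and,
        List.nodup_singleton, List.mem_append, List.mem_singleton]
      and_intros <;> intros <;> omega)

/-- Family B: `[(a+1)⋯1 (a+3) (a+2) (a+b+4)⋯(a+4),
(a+3) (a+1)⋯2 (a+b+4) 1 (a+b+3)⋯(a+4) (a+2)]`. -/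
def familyB (a b : ℕ) : PermInterval where
  n := a + b + 4
  lo := ofOneLine (a + b + 4)
    (desc (a + 1) 1 ++ [a + 3] ++ [a + 2] ++ desc (a + b + 4) (a + 4)) (by
    rw [List.perm_ext_iff_of_nodup _ List.nodup_range']
    · intro k; simp only [List.mem_append, mem_desc, List.mem_range'_1, List.mem_singleton]; omega
    · simp only [List.nodup_append', nodup_desc, List.disjoint_left, mem_desc, true_and,
        List.nodup_singleton, List.mem_append, List.mem_singleton]
      and_intros <;> intros <;> omega)
  hi := ofOneLine (a + b + 4)
    ([a + 3] ++ desc (a + 1) 2 ++ [a + b + 4] ++ [1] ++ desc (a + b + 3) (a + 4) ++ [a + 2]) (by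
    rw [List.perm_ext_iff_of_nodup _ List.nodup_range']
    · intro k; simp only [List.mem_append, mem_desc, List.mem_range'_1, List.mem_singleton]; omega
    · simp only [List.nodup_append', nodup_desc, List.disjoint_left, mem_desc, true_and,
        List.nodup_singleton, List.mem_append, List.mem_singleton]
      and_intros <;> intros <;> omega)

def intervalC : PermInterval where
  n := 5
  lo := ofOneLine 5 [2, 1, 3, 5, 4] (by decide)
  hi := ofOneLine 5 [5, 2, 3, 4, 1] (by decide)

def intervalD : PermInterval where
  n := 6
  lo := ofOneLine 6 [1, 3, 2, 5, 4, 6] (by decide)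
  hi := ofOneLine 6 [3, 5, 1, 6, 2, 4] (by decide)

def intervalE : PermInterval where
  n := 6
  lo := ofOneLine 6 [4, 2, 1, 6, 5, 3] (by decide)
  hi := ofOneLine 6 [6, 4, 2, 5, 3, 1] (by decide)

/-- `E^i` -/
def intervalEi : PermInterval where
  n := 6
  lo := ofOneLine 6 [3, 2, 6, 1, 5, 4] (by decide)
  hi := ofOneLine 6 [6, 3, 5, 2, 4, 1] (by decide)

def intervalF : PermInterval where
  n := 6
  lo := ofOneLine 6 [2, 1, 5, 4, 3, 6] (by decide)
  hi := ofOneLine 6 [5, 2, 6, 3, 1, 4] (by decide)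

/-- `F^i` -/
def intervalFi : PermInterval where
  n := 6
  lo := ofOneLine 6 [2, 1, 5, 4, 3, 6] (by decide)
  hi := ofOneLine 6 [5, 2, 4, 6, 1, 3] (by decide)

/-- `F^rc` -/
def intervalFrc : PermInterval where
  n := 6
  lo := ofOneLine 6 [1, 4, 3, 2, 6, 5] (by decide)
  hi := ofOneLine 6 [3, 6, 4, 1, 5, 2] (by decide)

/-- `F^irc` -/
def intervalFirc : PermInterval where
  n := 6
  lo := ofOneLine 6 [1, 4, 3, 2, 6, 5] (by decide)
  hi := ofOneLine 6 [4, 6, 1, 3, 5, 2] (by decide)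

def intervalG : PermInterval where
  n := 6
  lo := ofOneLine 6 [2, 1, 5, 4, 3, 6] (by decide)
  hi := ofOneLine 6 [5, 2, 6, 4, 1, 3] (by decide)

/-- `G^rc` -/
def intervalGrc : PermInterval where
  n := 6
  lo := ofOneLine 6 [1, 4, 3, 2, 6, 5] (by decide)
  hi := ofOneLine 6 [4, 6, 3, 1, 5, 2] (by decide)

def intervalH : PermInterval where
  n := 7
  lo := ofOneLine 7 [2, 1, 5, 4, 3, 7, 6] (by decide)
  hi := ofOneLine 7 [5, 2, 7, 4, 1, 6, 3] (by decide)

/-- The non-lci locus of `N_{u,v}`, among all points of the scheme `Spec` of its coordinate ring,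
consists exactly of the origin (which in particular lies on `N_{u,v}`). -/
def PermInterval.NotLCIExactlyAtOrigin (I : PermInterval) : Prop :=
  ∃ o : PrimeSpectrum (KLRing I.lo I.hi), o.asIdeal = originIdeal I.lo I.hi ∧
    ∀ P : PrimeSpectrum (KLRing I.lo I.hi),
      ¬ IsLCILocalRing (Localization.AtPrime P.asIdeal) ↔ P = o

/-- `N_{u,v}` is isomorphic to the affine scheme cut out by the ideal `J` in an affine space. -/
def PermInterval.IsoTo (I : PermInterval) {σ : Type} (J : Ideal (MvPolynomial σ ℂ)) : Prop :=
  Nonempty (KLRing I.lo I.hi ≃ₐ[ℂ] MvPolynomial σ ℂ ⧸ J)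

/-! ### The explicit varieties -/

/-- The ideal of `2 × 2` minors of the generic `m × k` matrix, defining the variety of
`m × k` matrices of rank at most `1`. -/
def rankLeOneIdeal (m k : ℕ) : Ideal (MvPolynomial (Fin m × Fin k) ℂ) :=
  Ideal.span {f | ∃ (i i' : Fin m) (j j' : Fin k),
    f = X (i, j) * X (i', j') - X (i, j') * X (i', j)}

/-- The ideal of the `2 × 2` minors of the `3 × 3` matrix with a cut corner
`(a b _ ; c d e ; f g h)`. The variables `a, …, h` are numbered `0, …, 7`. -/
def cutCornerIdeal : Ideal (MvPolynomial (Fin 8) ℂ) :=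
  Ideal.span
    {X 0 * X 3 - X 1 * X 2,
     X 0 * X 6 - X 1 * X 5,
     X 2 * X 6 - X 3 * X 5,
     X 2 * X 7 - X 4 * X 5,
     X 3 * X 7 - X 4 * X 6}

/-- The ideal in the entries of a `3 × 3` matrix saying that the first two rows are dependent and
that both are orthogonal to the third row (for the standard bilinear form). -/
def dependentOrthogonalIdealG : Ideal (MvPolynomial (Fin 3 × Fin 3) ℂ) :=
  Ideal.span
    {X (0, 0) * X (1, 1) - X (0, 1) * X (1, 0),
     X (0, 0) * X (1, 2) - X (0, 2) * X (1, 0),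
     X (0, 1) * X (1, 2) - X (0, 2) * X (1, 1),
     X (0, 0) * X (2, 0) + X (0, 1) * X (2, 1) + X (0, 2) * X (2, 2),
     X (1, 0) * X (2, 0) + X (1, 1) * X (2, 1) + X (1, 2) * X (2, 2)}

/-- The ideal in the entries of a `4 × 3` matrix saying that the first two rows are dependent, that
the last two rows are dependent, and that the first two rows are orthogonal to the last two. -/
def dependentOrthogonalIdealH : Ideal (MvPolynomial (Fin 4 × Fin 3) ℂ) :=
  Ideal.span
    {X (0, 0) * X (1, 1) - X (0, 1) * X (1, 0),
     X (0, 0) * X (1, 2) - X (0, 2) * X (1, 0),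
     X (0, 1) * X (1, 2) - X (0, 2) * X (1, 1),
     X (2, 0) * X (3, 1) - X (2, 1) * X (3, 0),
     X (2, 0) * X (3, 2) - X (2, 2) * X (3, 0),
     X (2, 1) * X (3, 2) - X (2, 2) * X (3, 1),
     X (0, 0) * X (2, 0) + X (0, 1) * X (2, 1) + X (0, 2) * X (2, 2),
     X (1, 0) * X (2, 0) + X (1, 1) * X (2, 1) + X (1, 2) * X (2, 2),
     X (0, 0) * X (3, 0) + X (0, 1) * X (3, 1) + X (0, 2) * X (3, 2),
     X (1, 0) * X (3, 0) + X (1, 1) * X (3, 1) + X (1, 2) * X (3, 2)}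

/-- The subscheme of affine space cut out by `J` has codimension `c`, the minimal number of
generators of `J` is `g`, and `c < g`. -/
def MoreGeneratorsThanCodim {σ : Type} [Fintype σ] (J : Ideal (MvPolynomial σ ℂ))
    (c g : ℕ) : Prop :=
  ringKrullDim (MvPolynomial σ ℂ ⧸ J) + c = Fintype.card σ ∧ J.spanFinrank = g ∧ c < g

end SchubertLCI

end

open SchubertLCI

/-! ### Local algebra: how many generators the square of the maximal ideal of an lci local ring
needs. -/

namespace SchubertLCI

open IsLocalRing

/-! Every model is an irreducible cone cut out by quadrics. The proof has two halves: commutative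
algebra on such a cone, and explicit matrix computations which identify each Kazhdan–Lusztig variety
with its model.

At the vertex. Let the cone have dimension `D` in a space with `N` coordinates, and let its ideal be
generated by `g` quadrics, each containing a monomial that occurs in no other of them. The local
ring at the vertex has embedding dimension `N`, and the square of its maximal ideal has at most `(N
+ 1).choose 2 - g` generators, since each quadric makes one product of coordinates redundant. In an
lci local ring of dimension `n` and embedding dimension `e` that square needs at least `(e +
1).choose 2 - (e - n)` generators: in a regular local ring all products of a minimal system of
generators are needed, and each further equation removes at most one
(`IsLCILocalRing.choose_two_add_le`). So lci at the vertex would force `g ≤ N - D = c`, against `c <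
g`.

Away from the vertex some coordinate is invertible. There the other coordinates can be solved for in
terms of a few, which are free or satisfy a single prime equation. The local rings are therefore
regular, or regular modulo one element (`HasChart.isLCI_and_height_le`).

The dimension. The charts bound it from above. From below it is bounded by explicit chains of
primes, the closures of images of coordinate subspaces under a parametrization by products of a row
and a column parameter (`orbitIdeal`). The same parametrization shows that the ideals are prime:
monomials with the same rows and columns are congruent by straightening
(`prod_eq_of_rows_eq_of_cols_eq`), so the quadrics generate the whole kernel. For G and H the
parameters satisfy in addition one bilinear equation.

The identification. Rank conditions hold on the Schubert variety, and they imply the equations of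
the model. Conversely, explicit column operations show that a point of the model with nonzero
coordinates (and one more nonvanishing condition for C) lies on the Schubert cell itself. As the
ideal of the model is prime, the Nullstellensatz turns these two facts into an equality of ideals
(`exists_klRing_equiv`). No generators of ideals of Schubert varieties have to be known. -/

theorem card_le_spanFinrank {R M L : Type*} [CommRing R] [IsLocalRing R] [AddCommGroup M]
    [Module R M] [Fintype L] {N : Submodule R M} (hN : N.FG) (x : L → M) (hx : ∀ l, x l ∈ N)
    (h : ∀ a : L → R, ∑ l, a l • x l ∈ maximalIdeal R • N → ∀ l, a l ∈ maximalIdeal R) :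
    Fintype.card L ≤ N.spanFinrank := by
  rw [spanFinrank_eq_finrank_quotient N hN]
  let y : L → N ⧸ (maximalIdeal R • (⊤ : Submodule R N)) := fun l => Submodule.Quotient.mk ⟨x l, hx l⟩
  have : Field (R ⧸ maximalIdeal R) := Ideal.Quotient.field _
  -- By Nakayama the number of generators is a dimension over the residue field, so independence of
  -- the classes modulo `𝔪N` is enough.
  have hli : LinearIndependent (R ⧸ maximalIdeal R) y := by
    rw [Fintype.linearIndependent_iff]
    intro g hg
    choose a ha using fun l => Ideal.Quotient.mk_surjective (g l)
    have key : ∑ l, a l • (⟨x l, hx l⟩ : N) ∈ maximalIdeal R • (⊤ : Submodule R N) := by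
      rw [← Submodule.Quotient.mk_eq_zero, ← hg, ← Submodule.mkQ_apply, map_sum]
      refine Finset.sum_congr rfl fun l _ => ?_
      rw [← ha l]
      rfl
    have key2 : ∑ l, a l • x l ∈ maximalIdeal R • N := by
      have := Submodule.mem_map_of_mem (f := N.subtype) key
      rw [Submodule.map_smul'', Submodule.map_top, Submodule.range_subtype] at this
      simpa using this
    intro l
    rw [← ha l]
    exact Ideal.Quotient.eq_zero_iff_mem.2 (h a key2 l)
  have : Module.Finite R N := Module.Finite.iff_fg.2 hN
  have : Module.Finite (R ⧸ maximalIdeal R) (N ⧸ (maximalIdeal R • (⊤ : Submodule R N))) :=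
    Module.Finite.of_restrictScalars_finite R _ _
  exact hli.fintype_card_le_finrank

/-- The product of the two entries of an unordered pair. -/
def pairMul {R L : Type*} [CommMonoid R] (x : L → R) (s : Sym2 L) : R :=
  Sym2.mul (s.map x)

@[simp] theorem pairMul_mk {R L : Type*} [CommMonoid R] (x : L → R) (i j : L) :
    pairMul x s(i, j) = x i * x j := by
  simp [pairMul]

theorem map_pairMul {R S L F : Type*} [CommMonoid R] [CommMonoid S] [FunLike F R S]
    [MulHomClass F R S] (f : F) (x : L → R) (s : Sym2 L) :
    f (pairMul x s) = pairMul (fun i => f (x i)) s := by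
  induction s with
  | _ i j => simp

theorem span_sq_eq_span_pairMul {R L : Type*} [CommRing R] (x : L → R) :
    Ideal.span (Set.range x) ^ 2 = Ideal.span (Set.range (pairMul x)) := by
  rw [sq, Ideal.span_mul_span']
  congr 1
  ext r
  constructor
  · rintro ⟨_, ⟨i, rfl⟩, _, ⟨j, rfl⟩, rfl⟩
    exact ⟨s(i, j), by simp⟩
  · rintro ⟨s, rfl⟩
    induction s with
    | _ i j => exact ⟨x i, ⟨i, rfl⟩, x j, ⟨j, rfl⟩, by simp⟩

section Regular

variable {S : Type*} [CommRing S] [IsLocalRing S] [IsNoetherianRing S] {d : ℕ}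

/-- A quadratic form in minimal generators of the maximal ideal that lies in the cube of the
maximal ideal takes values in the maximal ideal. -/
theorem sum_pairMul_mem_maximalIdeal (hd : ringKrullDim S = d) {x : Fin d → S}
    (hx : Ideal.span (Set.range x) = maximalIdeal S) {a : Sym2 (Fin d) → S}
    (ha : ∑ s, a s * pairMul x s ∈ maximalIdeal S ^ 3) (e : Fin d → S) (i : Fin d) (hi : e i = 1) :
    ∑ s, a s * pairMul e s ∈ maximalIdeal S := by
  by_contra hu
  rw [mem_maximalIdeal, mem_nonunits_iff, not_not] at hu
  classical
  -- Restriction to the line through `e`: modulo `J` each `x k` becomes `e k * x i`, so the form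
  -- becomes its value at `e` times `x i ^ 2`.
  let T : Finset S := (Finset.univ.erase i).image fun k => x k - e k * x i
  let J : Ideal S := Ideal.span (T : Set S)
  have hxm : ∀ k, x k ∈ maximalIdeal S := fun k => hx ▸ Ideal.subset_span ⟨k, rfl⟩
  have hJm : J ≤ maximalIdeal S := by
    refine Ideal.span_le.2 fun y hy => ?_
    obtain ⟨k, -, rfl⟩ := Finset.mem_image.1 (Finset.mem_coe.1 hy)
    exact sub_mem (hxm k) (Ideal.mul_mem_left _ _ (hxm i))
  let π := Ideal.Quotient.mk J
  have hπ : ∀ k, π (x k) = π (e k) * π (x i) := by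
    intro k
    rw [← map_mul, Ideal.Quotient.mk_eq_mk_iff_sub_mem]
    by_cases hk : k = i
    · subst hk; simp [hi]
    · exact Ideal.subset_span (Finset.mem_coe.2 (Finset.mem_image.2 ⟨k, by simp [hk], rfl⟩))
  have hmap : (maximalIdeal S).map π = Ideal.span {π (x i)} := by
    rw [← hx, Ideal.map_span]
    apply le_antisymm
    · refine Ideal.span_le.2 ?_
      rintro _ ⟨_, ⟨k, rfl⟩, rfl⟩
      rw [SetLike.mem_coe, hπ k]
      exact Ideal.mul_mem_left _ _ (Ideal.mem_span_singleton_self _)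
    · exact Ideal.span_mono (by rintro _ rfl; exact ⟨_, ⟨i, rfl⟩, rfl⟩)
  have h3 := Ideal.mem_map_of_mem π ha
  rw [Ideal.map_pow, hmap, Ideal.span_singleton_pow, Ideal.mem_span_singleton] at h3
  obtain ⟨c, hc⟩ := h3
  have hsum : π (∑ s, a s * pairMul x s) = π (∑ s, a s * pairMul e s) * π (x i) ^ 2 := by
    rw [map_sum, map_sum, Finset.sum_mul]
    refine Finset.sum_congr rfl fun s _ => ?_
    rw [map_mul, map_mul, mul_assoc, map_pairMul, map_pairMul]
    congr 1
    induction s with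
    | _ k l => simp only [pairMul_mk, hπ k, hπ l]; ring
  obtain ⟨c, rfl⟩ := Ideal.Quotient.mk_surjective c
  have h4 : π ((∑ s, a s * pairMul e s - x i * c) * x i ^ 2) = 0 := by
    have : π (x i) ^ 3 * π c = π (∑ s, a s * pairMul e s) * π (x i) ^ 2 := by rw [← hsum, hc]
    rw [map_mul, map_sub, map_mul, map_pow, sub_mul, ← this]; ring
  have h5 : IsUnit (∑ s, a s * pairMul e s - x i * c) := by
    by_contra h
    have h := (mem_maximalIdeal _).2 h
    have := add_mem h (Ideal.mul_mem_right c _ (hxm i))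
    rw [sub_add_cancel] at this
    exact (mem_maximalIdeal _).1 this hu
  have h6 : x i ^ 2 ∈ J := by
    rw [Ideal.Quotient.eq_zero_iff_mem] at h4
    exact (Ideal.unit_mul_mem_iff_mem _ h5).1 h4
  -- If the value at `e` were a unit, `x i ^ 2` would lie in `J`. The maximal ideal would then be
  -- minimal over fewer than `d` elements, against Krull's height theorem.
  have hmin : maximalIdeal S ∈ J.minimalPrimes := by
    refine ⟨⟨inferInstance, hJm⟩, fun P ⟨hP, hJP⟩ _ => ?_⟩
    rw [← hx, Ideal.span_le]
    rintro _ ⟨k, rfl⟩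
    have hi : x i ∈ P := hP.mem_of_pow_mem 2 (hJP h6)
    have h := hπ k
    rw [← map_mul, Ideal.Quotient.mk_eq_mk_iff_sub_mem] at h
    have := add_mem (hJP h) (Ideal.mul_mem_left P (e k) hi)
    simpa using this
  have hht := Ideal.height_le_card_of_mem_minimalPrimes_span_finset hmin
  have hcard : T.card < d := by
    refine Finset.card_image_le.trans_lt ?_
    rw [Finset.card_erase_of_mem (Finset.mem_univ _), Finset.card_univ, Fintype.card_fin]
    have := i.2
    omega
  have h7 := IsLocalRing.maximalIdeal_height_eq_ringKrullDim (R := S)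
  rw [hd] at h7
  have h8 : (maximalIdeal S).height = (d : ℕ∞) := by exact_mod_cast h7
  rw [h8] at hht
  have : d ≤ T.card := by exact_mod_cast hht
  omega

/-- Polarization: the value at the `i`-th basis vector is the coefficient of `x i ^ 2`, and the
value at the sum of two basis vectors is the mixed coefficient plus two diagonal ones. With
unordered pairs no division by two occurs. -/
theorem coeff_mem_maximalIdeal (hd : ringKrullDim S = d) {x : Fin d → S}
    (hx : Ideal.span (Set.range x) = maximalIdeal S) {a : Sym2 (Fin d) → S}
    (ha : ∑ s, a s * pairMul x s ∈ maximalIdeal S ^ 3) (s : Sym2 (Fin d)) :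
    a s ∈ maximalIdeal S := by
  classical
  have hdiag : ∀ i, a s(i, i) ∈ maximalIdeal S := by
    intro i
    have h := sum_pairMul_mem_maximalIdeal hd hx ha (Pi.single i 1) i (by simp)
    rw [Finset.sum_eq_single s(i, i)] at h
    · simpa using h
    · intro t _ ht
      induction t with
      | _ k l =>
        rw [pairMul_mk]
        by_cases hk : k = i
        · by_cases hl : l = i
          · subst hk; subst hl; exact absurd rfl ht
          · simp [hl]
        · simp [hk]
    · simp
  induction s with
  | _ i j =>
    by_cases hij : i = j
    · subst hij; exact hdiag i
    · have h := sum_pairMul_mem_maximalIdeal hd hx ha (Pi.single i 1 + Pi.single j 1) i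
        (by simp [hij])
      rw [← Finset.add_sum_erase _ _ (Finset.mem_univ s(i, j))] at h
      have hrest : ∑ t ∈ Finset.univ.erase s(i, j),
          a t * pairMul (Pi.single i 1 + Pi.single j 1 : Fin d → S) t ∈ maximalIdeal S := by
        refine Ideal.sum_mem _ fun t ht => ?_
        have ht := (Finset.mem_erase.1 ht).1
        induction t with
        | _ k l =>
          by_cases hkl : k = l
          · subst hkl; exact Ideal.mul_mem_right _ _ (hdiag k)
          · rw [pairMul_mk]
            by_cases h1 : k = i ∨ k = j
            · by_cases h2 : l = i ∨ l = j
              · exfalso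
                apply ht
                rw [Sym2.eq_iff]
                rcases h1 with rfl | rfl <;> rcases h2 with rfl | rfl <;> simp_all
              · push Not at h2
                simp [h2.1, h2.2]
            · push Not at h1
              simp [h1.1, h1.2]
      have h9 := (Ideal.add_mem_iff_left _ hrest).1 h
      have hji : j ≠ i := Ne.symm hij
      simpa [hij, hji] using h9

end Regular

/-- The products of pairs from a minimal system of generators of the maximal ideal are independent
in `𝔪² / 𝔪³`, and there are as many as unordered pairs of indices. -/
theorem choose_two_le_spanFinrank_maximalIdeal_sq {S : Type*} [CommRing S]
    [IsRegularLocalRing S] {d : ℕ}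
    (hd : ringKrullDim S = d) : (d + 1).choose 2 ≤ (maximalIdeal S ^ 2).spanFinrank := by
  have hs : (maximalIdeal S).spanFinrank = d := by
    have := IsRegularLocalRing.spanFinrank_maximalIdeal (R := S)
    rw [hd] at this
    exact_mod_cast this
  obtain ⟨T, hT, hTm⟩ := Submodule.FG.exists_span_finset_card_eq_spanFinrank
    (maximalIdeal S).fg_of_isNoetherianRing
  let x : Fin d → S := fun i => (T.equivFinOfCardEq (hT.trans hs)).symm i
  have hxr : Set.range x = T := by
    ext y
    constructor
    · rintro ⟨i, rfl⟩; exact Subtype.prop _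
    · intro hy; exact ⟨T.equivFinOfCardEq (hT.trans hs) ⟨y, hy⟩, by simp [x]⟩
  have hx : Ideal.span (Set.range x) = maximalIdeal S := by rw [hxr]; exact hTm
  have h := card_le_spanFinrank (N := maximalIdeal S ^ 2) (IsNoetherian.noetherian _)
    (pairMul x) (by
      intro s
      rw [← hx, span_sq_eq_span_pairMul]
      exact Ideal.subset_span ⟨s, rfl⟩) (by
      intro a ha l
      refine coeff_mem_maximalIdeal hd hx (a := a) ?_ l
      rw [pow_succ']
      simpa using ha)
  simpa [Sym2.card] using h

/-- An element outside `𝔪²` has a unit coefficient at some minimal generator `t`. Modulo `f` this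
`t` becomes redundant, so the embedding dimension drops, while the Krull dimension drops by at most
one. Both are then equal to `d - 1`. -/
theorem isRegularLocalRing_quotient {S : Type*} [CommRing S] [IsRegularLocalRing S] {f : S}
    {d : ℕ} (hd : ringKrullDim S = d) (hf : f ∈ maximalIdeal S) (hf2 : f ∉ maximalIdeal S ^ 2) :
    ∃ d', d = d' + 1 ∧ IsRegularLocalRing (S ⧸ Ideal.span {f}) ∧
      ringKrullDim (S ⧸ Ideal.span {f}) = d' := by
  classical
  have hs : (maximalIdeal S).spanFinrank = d := by
    have := IsRegularLocalRing.spanFinrank_maximalIdeal (R := S)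
    rw [hd] at this
    exact_mod_cast this
  obtain ⟨T, hT, hTm⟩ := Submodule.FG.exists_span_finset_card_eq_spanFinrank
    (maximalIdeal S).fg_of_isNoetherianRing
  have hTm' : Ideal.span (T : Set S) = maximalIdeal S := hTm
  have hne : Ideal.span {f} ≠ ⊤ := fun h =>
    (Ideal.ne_top_iff_one _).1 (maximalIdeal.isMaximal S).ne_top
      ((Ideal.span_singleton_le_iff_mem _).2 hf (h ▸ Submodule.mem_top))
  have : Nontrivial (S ⧸ Ideal.span {f}) := Ideal.Quotient.nontrivial_iff.2 hne
  have : IsLocalRing (S ⧸ Ideal.span {f}) :=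
    IsLocalRing.of_surjective' (Ideal.Quotient.mk _) Ideal.Quotient.mk_surjective
  have : IsLocalHom (Ideal.Quotient.mk (Ideal.span {f})) :=
    IsLocalHom.of_surjective _ Ideal.Quotient.mk_surjective
  have hmap : (maximalIdeal S).map (Ideal.Quotient.mk (Ideal.span {f})) =
      maximalIdeal (S ⧸ Ideal.span {f}) :=
    IsLocalRing.map_maximalIdeal_of_surjective _ Ideal.Quotient.mk_surjective
  obtain ⟨a, ha⟩ : ∃ a : T → S, ∑ t, a t * (t : S) = f := by
    have : f ∈ Ideal.span (Set.range ((↑) : T → S)) := by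
      rw [Subtype.range_coe_subtype]; simpa using hTm' ▸ hf
    obtain ⟨c, hc⟩ := Ideal.mem_span_range_iff_exists_fun.1 this
    exact ⟨c, hc⟩
  obtain ⟨t, ht⟩ : ∃ t, IsUnit (a t) := by
    by_contra! h
    apply hf2
    rw [← ha, sq]
    exact Ideal.sum_mem _ fun t _ => Ideal.mul_mem_mul ((mem_maximalIdeal _).2 (h t))
      (hTm' ▸ Ideal.subset_span t.2)
  have hspan : (maximalIdeal (S ⧸ Ideal.span {f})) =
      Ideal.span (((T.erase t).image (Ideal.Quotient.mk (Ideal.span {f})) : Finset _) : Set _) := by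
    apply le_antisymm
    · rw [← hmap, ← hTm', Ideal.map_span, Ideal.span_le]
      have hmem : ∀ s ∈ T, s ≠ t → Ideal.Quotient.mk (Ideal.span {f}) s ∈ Ideal.span
          (((T.erase t).image (Ideal.Quotient.mk (Ideal.span {f})) : Finset _) : Set _) := by
        intro s hs hst
        exact Ideal.subset_span (by
          rw [Finset.coe_image]; exact ⟨s, by simp [hs, hst], rfl⟩)
      rintro _ ⟨s, hs, rfl⟩
      by_cases hst : s = t
      · subst hst
        have h1 : Ideal.Quotient.mk (Ideal.span {f}) (∑ t, a t * (t : S)) = 0 := by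
          rw [ha]; exact Ideal.Quotient.eq_zero_iff_mem.2 (Ideal.mem_span_singleton_self _)
        rw [← Finset.add_sum_erase _ _ (Finset.mem_univ t), map_add, map_mul, map_sum] at h1
        rw [SetLike.mem_coe, ← Ideal.unit_mul_mem_iff_mem _ (ht.map (Ideal.Quotient.mk _)),
          eq_neg_of_add_eq_zero_left h1]
        refine neg_mem (Ideal.sum_mem _ fun r hr => ?_)
        rw [map_mul]
        refine Ideal.mul_mem_left _ _ (hmem _ r.2 fun h => ?_)
        exact (Finset.mem_erase.1 hr).1 (Subtype.ext h)
      · exact hmem s hs hst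
    · rw [Ideal.span_le, Finset.coe_image, ← hmap]
      rintro _ ⟨s, hs, rfl⟩
      refine Ideal.mem_map_of_mem _ (hTm' ▸ Ideal.subset_span ?_)
      exact Finset.mem_of_mem_erase hs
  have hTcard : (T.erase (t : S)).card + 1 = d := by
    rw [Finset.card_erase_add_one t.2, hT, hs]
  have hle : (maximalIdeal (S ⧸ Ideal.span {f})).spanFinrank ≤ (T.erase (t : S)).card := by
    rw [hspan]
    refine (Submodule.spanFinrank_span_le_ncard_of_finite (Finset.finite_toSet _)).trans ?_
    rw [Set.ncard_coe_finset]
    exact Finset.card_image_le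
  have hdim : ((T.erase (t : S)).card : WithBot ℕ∞) ≤ ringKrullDim (S ⧸ Ideal.span {f}) := by
    have h := ringKrullDim_le_ringKrullDim_quotient_add_card (R := S) ({f} : Finset S) (by
      rw [IsLocalRing.ringJacobson_eq_maximalIdeal]; simpa using hf)
    rw [hd, ← hTcard] at h
    rw [Finset.coe_singleton, Finset.card_singleton] at h
    push_cast at h
    exact (ENat.WithBot.add_le_add_one_right_iff).1 h
  have hreg : IsRegularLocalRing (S ⧸ Ideal.span {f}) :=
    .of_spanFinrank_maximalIdeal_le _ ((Nat.cast_le.2 hle).trans hdim)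
  refine ⟨(T.erase (t : S)).card, hTcard.symm, hreg, le_antisymm ?_ hdim⟩
  rw [← IsRegularLocalRing.spanFinrank_maximalIdeal]
  exact_mod_cast hle

/-- Generators of `𝔪_R²` lift to elements of `𝔪_S²` because the kernel is contained in `𝔪_S²`.
Together with the generators of the kernel they generate `𝔪_S²`. -/
theorem spanFinrank_sq_le_of_surjective {S R : Type*} [CommRing S] [IsRegularLocalRing S]
    [CommRing R] [IsLocalRing R] (f : S →+* R) (hf : Function.Surjective f) (T : Finset S)
    (hT : RingHom.ker f = Ideal.span T) (hker : RingHom.ker f ≤ maximalIdeal S ^ 2) :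
    (maximalIdeal S ^ 2).spanFinrank ≤ (maximalIdeal R ^ 2).spanFinrank + T.card := by
  classical
  have : IsLocalHom f := IsLocalHom.of_surjective f hf
  have : IsNoetherianRing R := isNoetherianRing_of_surjective S R f hf
  have hmap : (maximalIdeal S ^ 2).map f = maximalIdeal R ^ 2 := by
    rw [Ideal.map_pow, IsLocalRing.map_maximalIdeal_of_surjective _ hf]
  obtain ⟨U, hU, hUm⟩ := Submodule.FG.exists_span_finset_card_eq_spanFinrank
    (p := maximalIdeal R ^ 2) (IsNoetherian.noetherian _)
  have hUm' : Ideal.span (U : Set R) = maximalIdeal R ^ 2 := hUm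
  obtain ⟨g, hg⟩ := hf.hasRightInverse
  have hgU : f '' (U.image g : Finset S) = U := by
    rw [Finset.coe_image, Set.image_image]
    simp [hg _]
  have hspan : maximalIdeal S ^ 2 = Ideal.span ((U.image g ∪ T : Finset S) : Set S) := by
    rw [Finset.coe_union, Ideal.span_union, ← hT]
    apply le_antisymm
    · intro y hy
      have h1 : f y ∈ (Ideal.span ((U.image g : Finset S) : Set S)).map f := by
        rw [Ideal.map_span, hgU, hUm', ← hmap]
        exact Ideal.mem_map_of_mem f hy
      obtain ⟨z, hz, hzy⟩ := (Ideal.mem_map_iff_of_surjective f hf).1 h1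
      rw [← add_sub_cancel z y]
      refine Submodule.add_mem_sup hz ?_
      rw [RingHom.mem_ker, map_sub, hzy, sub_self]
    · refine sup_le (Ideal.span_le.2 fun y hy => ?_) hker
      have h1 : f y ∈ (maximalIdeal S ^ 2).map f := by
        rw [hmap, ← hUm']
        exact Ideal.subset_span (hgU ▸ ⟨y, hy, rfl⟩)
      obtain ⟨z, hz, hzy⟩ := (Ideal.mem_map_iff_of_surjective f hf).1 h1
      have h2 : y - z ∈ RingHom.ker f := by rw [RingHom.mem_ker, map_sub, hzy, sub_self]
      simpa using add_mem (hker h2) hz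
  rw [hspan]
  refine (Submodule.spanFinrank_span_le_ncard_of_finite (Finset.finite_toSet _)).trans ?_
  rw [Set.ncard_coe_finset, ← hU]
  exact (Finset.card_union_le _ _).trans (Nat.add_le_add_right Finset.card_image_le _)

/-- The fundamental inequality between the embedding dimension `e`, the number `t` of generators of
the square of the maximal ideal of a quotient `R` of a regular local ring of dimension `d`, and the
number of equations. -/
theorem choose_two_add_le_of_surjective {R : Type*} [CommRing R] [IsLocalRing R] (d : ℕ) :
    ∀ (S : Type*) [CommRing S] [IsRegularLocalRing S] (_ : ringKrullDim S = d) (f : S →+* R)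
      (_ : Function.Surjective f) (T : Finset S) (_ : RingHom.ker f = Ideal.span T),
      ((maximalIdeal R).spanFinrank + 1).choose 2 + d ≤
        (maximalIdeal R ^ 2).spanFinrank + T.card + (maximalIdeal R).spanFinrank := by
  classical
  induction d using Nat.strong_induction_on with
  | _ d ih =>
  intro S _ _ hd f hf T hT
  by_cases hker : RingHom.ker f ≤ maximalIdeal S ^ 2
  -- No equation has a linear part: the products in `S` are counted, and the embedding dimension of
  -- `R` is at most `d`.
  · have h1 := choose_two_le_spanFinrank_maximalIdeal_sq hd
    have h2 := spanFinrank_sq_le_of_surjective f hf T hT hker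
    have h3 : (maximalIdeal R).spanFinrank ≤ d := by
      have : IsLocalHom f := IsLocalHom.of_surjective f hf
      rw [← IsLocalRing.map_maximalIdeal_of_surjective _ hf]
      refine (Ideal.spanFinrank_map_le_of_fg f (IsNoetherian.noetherian _)).trans ?_
      have := IsRegularLocalRing.spanFinrank_maximalIdeal (R := S)
      rw [hd] at this
      exact (Nat.cast_injective this).le
    have h4 := Nat.choose_le_choose 2 h3
    rw [Nat.choose_succ_succ' _ 1, Nat.choose_one_right] at h1 ⊢
    simp only [Nat.reduceAdd] at h1 ⊢
    omega
  -- Some equation `t` has a linear part. Dividing by it keeps the ring regular and lowers both `d`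
  -- and the number of equations by one, while `R` stays the same.
  · rw [hT, Ideal.span_le, Set.not_subset] at hker
    obtain ⟨t, htT, ht⟩ := hker
    have htT : t ∈ T := htT
    have htm : t ∈ maximalIdeal S := by
      have h1 : t ∈ RingHom.ker f := hT ▸ Ideal.subset_span htT
      exact IsLocalRing.le_maximalIdeal (RingHom.ker_ne_top f) h1
    obtain ⟨d', rfl, hreg, hd'⟩ := isRegularLocalRing_quotient hd htm ht
    have hle : Ideal.span {t} ≤ RingHom.ker f := by
      rw [Ideal.span_singleton_le_iff_mem, hT]
      exact Ideal.subset_span htT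
    let f' : S ⧸ Ideal.span {t} →+* R := Ideal.Quotient.lift _ f hle
    have h := ih d' (Nat.lt_succ_self _) (S ⧸ Ideal.span {t}) hd' f' (Ideal.Quotient.lift_surjective_of_surjective _ hle hf)
      ((T.erase t).image (Ideal.Quotient.mk _)) (by
        rw [Ideal.ker_quotient_lift, hT, Finset.coe_image, ← Ideal.map_span]
        conv_lhs => rw [← Finset.insert_erase htT, Finset.coe_insert, Ideal.span_insert,
          Ideal.map_sup, Ideal.map_quotient_self, bot_sup_eq])
    have hc : ((T.erase t).image (Ideal.Quotient.mk (Ideal.span {t}))).card + 1 ≤ T.card := by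
      rw [← Finset.card_erase_add_one htT]
      exact Nat.add_le_add_right Finset.card_image_le 1
    omega

/-- In an lci local ring the number of generators of the square of the maximal ideal is bounded
below in terms of the dimension and the embedding dimension. -/
theorem IsLCILocalRing.choose_two_add_le {R : Type} [CommRing R] [IsLocalRing R]
    (h : IsLCILocalRing R) {n : ℕ} (hn : n ≤ ringKrullDim R) :
    ((maximalIdeal R).spanFinrank + 1).choose 2 + n ≤
      (maximalIdeal R ^ 2).spanFinrank + (maximalIdeal R).spanFinrank := by
  classical
  obtain ⟨S, _, _, rs, hrs, ⟨φ⟩⟩ := h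
  have hdim := ringKrullDim_add_length_eq_ringKrullDim_of_isRegular rs hrs
  rw [← ringKrullDim_eq_of_ringEquiv φ, ← IsRegularLocalRing.spanFinrank_maximalIdeal (R := S)] at hdim
  have h1 : n + rs.length ≤ (maximalIdeal S).spanFinrank := by
    have : ((n : WithBot ℕ∞) + rs.length) ≤ (maximalIdeal S).spanFinrank := by
      rw [← hdim]; gcongr
    exact_mod_cast this
  have h2 := choose_two_add_le_of_surjective (R := R) (maximalIdeal S).spanFinrank S
    IsRegularLocalRing.spanFinrank_maximalIdeal.symm
    ((φ.symm : S ⧸ Ideal.ofList rs →+* R).comp (Ideal.Quotient.mk _))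
    (φ.symm.surjective.comp Ideal.Quotient.mk_surjective) rs.toFinset (by
      rw [RingHom.ker_comp_of_injective _ φ.symm.injective, Ideal.mk_ker, Ideal.ofList]
      congr 1
      ext; simp)
  have h3 := rs.toFinset_card_le
  omega

end SchubertLCI

/-! ### Hypersurface charts, and minimal generators of ideals of quadrics. -/

noncomputable section

namespace SchubertLCI

open IsLocalRing MvPolynomial

/-- Where `β x` is invertible, the spectrum of `A` is the hypersurface `q = 0` in that of `B`.
Powers of `x` clear denominators, which gives surjectivity. As `A` is a domain, a fraction that dies
has its numerator in the kernel of `β`. -/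
theorem exists_equiv_localization_quotient {A B : Type*} [CommRing A] [CommRing B] [IsDomain A]
    (β : B →+* A) {q x : B} (hker : RingHom.ker β = Ideal.span {q})
    (hx : ∀ a : A, ∃ (k : ℕ) (p : B), β x ^ k * a = β p) (P : Ideal A) [P.IsPrime]
    (hxP : β x ∉ P) :
    Nonempty (Localization.AtPrime P ≃+* Localization.AtPrime (P.comap β) ⧸
      Ideal.span {algebraMap B (Localization.AtPrime (P.comap β)) q}) := by
  let φ := Localization.localRingHom (P.comap β) P β rfl
  have hsurj : Function.Surjective φ := by
    intro z
    obtain ⟨a, s, rfl⟩ := IsLocalization.exists_mk'_eq P.primeCompl z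
    obtain ⟨k, p, hp⟩ := hx a
    obtain ⟨l, r, hr⟩ := hx s
    have hpow : ∀ k, β x ^ k ∉ P := fun k h => hxP (Ideal.IsPrime.mem_of_pow_mem ‹_› k h)
    have hrP : β r ∉ P := by
      rw [← hr]
      exact fun h => (Ideal.IsPrime.mem_or_mem ‹_› h).elim (hpow l) s.2
    have hden : β (x ^ k * r) ∉ P := by
      rw [map_mul, map_pow]
      exact fun h => (Ideal.IsPrime.mem_or_mem ‹_› h).elim (hpow k) hrP
    refine ⟨IsLocalization.mk' _ (x ^ l * p) (⟨x ^ k * r, hden⟩ : (P.comap β).primeCompl), ?_⟩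
    rw [Localization.localRingHom_mk', IsLocalization.mk'_eq_iff_eq]
    congr 1
    simp only [map_mul, map_pow, ← hp, ← hr]
    ring
  have hkerφ : RingHom.ker φ = Ideal.span {algebraMap B _ q} := by
    apply le_antisymm
    · intro z hz
      obtain ⟨b, s, rfl⟩ := IsLocalization.exists_mk'_eq (P.comap β).primeCompl z
      rw [RingHom.mem_ker, Localization.localRingHom_mk', IsLocalization.mk'_eq_zero_iff] at hz
      obtain ⟨m, hm⟩ := hz
      have hm0 : (m : A) ≠ 0 := fun h => m.2 (h ▸ P.zero_mem)
      have hb : b ∈ RingHom.ker β := (mul_eq_zero.1 hm).resolve_left hm0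
      rw [hker, Ideal.mem_span_singleton] at hb
      obtain ⟨c, rfl⟩ := hb
      rw [Ideal.mem_span_singleton, ← IsLocalization.mul_mk'_eq_mk'_of_mul]
      exact dvd_mul_right _ _
    · rw [Ideal.span_singleton_le_iff_mem, RingHom.mem_ker, Localization.localRingHom_to_map]
      have : q ∈ RingHom.ker β := hker ▸ Ideal.mem_span_singleton_self q
      rw [(RingHom.mem_ker).1 this, map_zero]
  exact ⟨(RingHom.quotientKerEquivOfSurjective hsurj).symm.trans (Ideal.quotEquivOfEq hkerφ)⟩

/-- If `q = 0`, the local ring is regular and the empty sequence serves. Otherwise it is the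
quotient of a regular local domain by one nonzero nonunit, and the dimension drops by exactly one.
-/
theorem isLCILocalRing_and_height_le_of_chart {A B : Type} [CommRing A] [CommRing B] [IsDomain A]
    [IsDomain B] [IsRegularRing B] (β : B →+* A) {q x : B} (hker : RingHom.ker β = Ideal.span {q})
    (hx : ∀ a : A, ∃ (k : ℕ) (p : B), β x ^ k * a = β p) {D : ℕ}
    (hD : q = 0 ∧ ringKrullDim B = D ∨ q ≠ 0 ∧ ringKrullDim B = (D + 1 : ℕ))
    (P : Ideal A) [P.IsPrime] (hxP : β x ∉ P) :
    IsLCILocalRing (Localization.AtPrime P) ∧ P.height ≤ D := by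
  obtain ⟨e⟩ := exists_equiv_localization_quotient β hker hx P hxP
  have hdimP : ringKrullDim (Localization.AtPrime P) = P.height :=
    IsLocalization.AtPrime.ringKrullDim_eq_height P _
  have hdimB : ringKrullDim (Localization.AtPrime (P.comap β)) ≤ ringKrullDim B := by
    rw [IsLocalization.AtPrime.ringKrullDim_eq_height (P.comap β)]
    exact Ideal.height_le_ringKrullDim_of_isPrime
  rcases hD with ⟨rfl, hD⟩ | ⟨hq, hD⟩
  · have he : Ideal.span {algebraMap B (Localization.AtPrime (P.comap β)) 0} = ⊥ := by simp
    have e' : Localization.AtPrime P ≃+* Localization.AtPrime (P.comap β) :=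
      (e.trans (Ideal.quotEquivOfEq he)).trans (RingEquiv.quotientBot _)
    constructor
    · refine ⟨Localization.AtPrime (P.comap β), inferInstance, inferInstance, [],
        .nil _ _, ⟨e.trans (Ideal.quotEquivOfEq (by simp))⟩⟩
    · rw [← ringKrullDim_eq_of_ringEquiv e', hdimP, hD] at hdimB
      exact_mod_cast hdimB
  · have hq0 : algebraMap B (Localization.AtPrime (P.comap β)) q ≠ 0 := by
      rw [Ne, IsLocalization.to_map_eq_zero_iff _ (Ideal.primeCompl_le_nonZeroDivisors (P.comap β))]
      exact hq
    have hqm : algebraMap B (Localization.AtPrime (P.comap β)) q ∈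
        maximalIdeal (Localization.AtPrime (P.comap β)) := by
      rw [IsLocalization.AtPrime.to_map_mem_maximal_iff _ (P.comap β), Ideal.mem_comap]
      have : q ∈ RingHom.ker β := hker ▸ Ideal.mem_span_singleton_self q
      rw [(RingHom.mem_ker).1 this]
      exact P.zero_mem
    have : IsDomain (Localization.AtPrime (P.comap β)) :=
      IsLocalization.isDomain_localization (Ideal.primeCompl_le_nonZeroDivisors (P.comap β))
    constructor
    · refine ⟨Localization.AtPrime (P.comap β), inferInstance, inferInstance,
        [algebraMap B _ q], ?_, ⟨e.trans (Ideal.quotEquivOfEq (by simp))⟩⟩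
      rw [RingTheory.Sequence.isRegular_iff, RingTheory.Sequence.isWeaklyRegular_singleton_iff]
      refine ⟨isSMulRegular_iff_right_eq_zero_of_smul.2 fun y hy => (mul_eq_zero.1 hy).resolve_left hq0, fun h => ?_⟩
      rw [smul_eq_mul, Ideal.mul_top, Ideal.ofList_singleton, eq_comm,
        Ideal.span_singleton_eq_top] at h
      exact (mem_maximalIdeal _).1 hqm h
    · have h1 := ringKrullDim_quotient_span_singleton_succ_eq_ringKrullDim_of_mem_nonZeroDivisors
        (mem_nonZeroDivisors_of_ne_zero hq0) hqm
      rw [← ringKrullDim_eq_of_ringEquiv e, hdimP] at h1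
      rw [← h1, hD] at hdimB
      push_cast at hdimB
      have := ENat.WithBot.add_le_add_one_right_iff.1 hdimB
      exact_mod_cast this

/-- The exponent of the monomial that is the product of an unordered pair of variables. -/
def pairExp {σ : Type} (s : Sym2 σ) : σ →₀ ℕ :=
  Sym2.lift ⟨fun i j => Finsupp.single i 1 + Finsupp.single j 1, fun _ _ => add_comm _ _⟩ s

theorem pairExp_injective {σ : Type} : Function.Injective (pairExp (σ := σ)) := by
  intro s t h
  induction s with
  | _ i j =>
    induction t with
    | _ k l =>
      simp only [pairExp, Sym2.lift_mk] at h
      rw [Finsupp.single_add_single_eq_single_add_single one_ne_zero one_ne_zero] at h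
      rw [Sym2.eq_iff]
      simpa using h

theorem degree_pairExp {σ : Type} (s : Sym2 σ) : (pairExp s).degree = 2 := by
  induction s with
  | _ i j => simp [pairExp, Sym2.lift_mk, Finsupp.degree_single]

theorem pairMul_X {σ : Type} (s : Sym2 σ) :
    pairMul (X : σ → MvPolynomial σ ℂ) s = monomial (pairExp s) 1 := by
  induction s with
  | _ i j => simp [pairExp, Sym2.lift_mk, X, monomial_mul]

theorem coeff_pairMul_X {σ : Type} [DecidableEq σ] (s t : Sym2 σ) :
    coeff (pairExp t) (pairMul (X : σ → MvPolynomial σ ℂ) s) = if s = t then 1 else 0 := by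
  rw [pairMul_X, coeff_monomial]
  simp [pairExp_injective.eq_iff]

/-- Homogeneous quadrics. -/
abbrev quadrics (σ : Type) : Submodule ℂ (MvPolynomial σ ℂ) :=
  Submodule.span ℂ (Set.range (pairMul X))

theorem quadrics_le {σ : Type} {f : MvPolynomial σ ℂ} (hf : f ∈ quadrics σ) :
    f ∈ idealOfVars σ ℂ ^ 2 := by
  refine Submodule.span_le (p := (idealOfVars σ ℂ ^ 2).restrictScalars ℂ).2 ?_ hf
  rintro _ ⟨s, rfl⟩
  rw [SetLike.mem_coe, Submodule.restrictScalars_mem, span_sq_eq_span_pairMul]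
  exact Ideal.subset_span ⟨s, rfl⟩

/-- The ideal `J` is generated by the quadrics `q l`, and `μ l` is a monomial that occurs with
coefficient one in `q l` and in no other of them. -/
structure QuadricGenerators {σ : Type} (J : Ideal (MvPolynomial σ ℂ)) (L : Type) where
  q : L → MvPolynomial σ ℂ
  μ : L → Sym2 σ
  span_eq : J = Ideal.span (Set.range q)
  mem_quadrics : ∀ l, q l ∈ quadrics σ
  coeff_self : ∀ l, coeff (pairExp (μ l)) (q l) = 1
  coeff_ne : ∀ l l', l ≠ l' → coeff (pairExp (μ l')) (q l) = 0

namespace QuadricGenerators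

variable {σ L : Type} {J : Ideal (MvPolynomial σ ℂ)}

theorem coeff_q (Q : QuadricGenerators J L) [DecidableEq L] (l l' : L) :
    coeff (pairExp (Q.μ l')) (Q.q l) = if l = l' then 1 else 0 := by
  split_ifs with h
  · subst h; exact Q.coeff_self l
  · exact Q.coeff_ne l l' h

theorem μ_injective (Q : QuadricGenerators J L) : Function.Injective Q.μ := by
  intro l l' h
  by_contra hne
  have h1 := Q.coeff_self l
  rw [h, Q.coeff_ne l l' hne] at h1
  exact zero_ne_one h1

theorem q_mem (Q : QuadricGenerators J L) (l : L) : Q.q l ∈ J :=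
  Q.span_eq.ge (Ideal.subset_span ⟨l, rfl⟩)

theorem le_sq (Q : QuadricGenerators J L) : J ≤ idealOfVars σ ℂ ^ 2 := by
  rw [Q.span_eq, Ideal.span_le]
  rintro _ ⟨l, rfl⟩
  exact quadrics_le (Q.mem_quadrics l)

/-- Graded Nakayama by hand. The map `c` reads off the coefficients of the distinguished monomials.
On `J` multiplication by a polynomial acts on these through its constant term only, so any ideal
generators of `J` are mapped to a system that spans `L → ℂ` over `ℂ`. -/
theorem spanFinrank_eq (Q : QuadricGenerators J L) [Fintype L] :
    J.spanFinrank = Fintype.card L := by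
  classical
  have hfin : J.FG := by
    rw [Q.span_eq]; exact Submodule.fg_span (Set.finite_range _)
  apply le_antisymm
  · conv_lhs => rw [Q.span_eq]
    refine (Submodule.spanFinrank_span_le_ncard_of_finite (Set.finite_range _)).trans ?_
    rw [← Set.image_univ, ← Finset.coe_univ, ← Finset.coe_image, Set.ncard_coe_finset]
    exact Finset.card_image_le
  · obtain ⟨T, hT, hTJ⟩ := Submodule.FG.exists_span_finset_card_eq_spanFinrank hfin
    have hTJ' : Ideal.span (T : Set (MvPolynomial σ ℂ)) = J := hTJ
    let c : MvPolynomial σ ℂ →ₗ[ℂ] (L → ℂ) :=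
      LinearMap.pi fun l => lcoeff ℂ (pairExp (Q.μ l))
    -- Since `J` has nothing in degree below two, a quadratic coefficient of `h * f` can only come
    -- from the constant term of `h`.
    have hc : ∀ h f, f ∈ J → c (h * f) = constantCoeff h • c f := by
      intro h f hf
      ext l
      have hf := (mem_pow_idealOfVars_iff' 2 f).1 (Q.le_sq hf)
      simp only [c, LinearMap.pi_apply, lcoeff_apply, Pi.smul_apply, smul_eq_mul, coeff_mul]
      rw [Finset.sum_eq_single (0, pairExp (Q.μ l))]
      · rfl
      · rintro ⟨a, b⟩ hab hne
        rw [Finset.HasAntidiagonal.mem_antidiagonal] at hab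
        simp only at hab ⊢
        rw [hf b, mul_zero]
        have h2 := degree_pairExp (Q.μ l)
        rw [← hab, map_add] at h2
        have ha : a.degree ≠ 0 := by
          intro ha
          rw [Finsupp.degree_eq_zero_iff] at ha
          subst ha
          rw [zero_add] at hab
          exact hne (by rw [hab])
        omega
      · simp
    have hspan : ∀ f ∈ J, c f ∈ Submodule.span ℂ ((T.image c : Finset (L → ℂ)) : Set (L → ℂ)) := by
      intro f hf
      rw [← hTJ'] at hf
      refine Submodule.span_induction (p := fun f _ => c f ∈ _) ?_ ?_ ?_ ?_ hf
      · intro x hx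
        exact Submodule.subset_span (by rw [Finset.coe_image]; exact ⟨x, hx, rfl⟩)
      · rw [map_zero]; exact zero_mem _
      · intro x y _ _ hx hy
        rw [map_add]; exact add_mem hx hy
      · intro a x hx hcx
        rw [smul_eq_mul, hc a x (hTJ' ▸ hx)]
        exact Submodule.smul_mem _ _ hcx
    have htop : Submodule.span ℂ ((T.image c : Finset (L → ℂ)) : Set (L → ℂ)) = ⊤ := by
      rw [eq_top_iff, ← (Pi.basisFun ℂ L).span_eq, Submodule.span_le]
      rintro _ ⟨l, rfl⟩
      have h1 := hspan (Q.q l) (Q.q_mem l)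
      convert! h1 using 1
      ext l'
      simp only [c, LinearMap.pi_apply, lcoeff_apply, Q.coeff_q, Pi.basisFun_apply, Pi.single_apply]
      simp [eq_comm]
    have h1 := finrank_span_finset_le_card (R := ℂ) (T.image c)
    rw [Set.finrank, htop, finrank_top, Module.finrank_pi] at h1
    exact (h1.trans Finset.card_image_le).trans hT.le

end QuadricGenerators

end SchubertLCI

end

/-! ### The local ring at the vertex of a cone. -/

noncomputable section

namespace SchubertLCI

open IsLocalRing MvPolynomial

theorem ker_constantCoeff {σ : Type} :
    RingHom.ker (constantCoeff : MvPolynomial σ ℂ →+* ℂ) = idealOfVars σ ℂ := by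
  ext f
  rw [RingHom.mem_ker, ← pow_one (idealOfVars σ ℂ), mem_pow_idealOfVars_iff']
  constructor
  · intro h x hx
    rw [Nat.lt_one_iff, Finsupp.degree_eq_zero_iff] at hx
    subst hx; exact h
  · intro h
    exact h 0 (by simp)

instance {σ : Type} : (idealOfVars σ ℂ).IsMaximal := by
  rw [← ker_constantCoeff]
  exact RingHom.ker_isMaximal_of_surjective _ (fun c => ⟨C c, constantCoeff_C _ c⟩)

/-- The ideal of the origin in `ℂ[σ] / J`. -/
abbrev originOf {σ : Type} (J : Ideal (MvPolynomial σ ℂ)) : Ideal (MvPolynomial σ ℂ ⧸ J) :=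
  (idealOfVars σ ℂ).map (Ideal.Quotient.mk J)

theorem originOf_isMaximal {σ : Type} {J : Ideal (MvPolynomial σ ℂ)} (hJ : J ≤ idealOfVars σ ℂ) :
    (originOf J).IsMaximal := by
  refine (Ideal.map_eq_top_or_isMaximal_of_surjective _ Ideal.Quotient.mk_surjective
    inferInstance).resolve_left fun h => ?_
  have h1 := congrArg (Ideal.comap (Ideal.Quotient.mk J)) h
  rw [Ideal.comap_map_of_surjective _ Ideal.Quotient.mk_surjective, Ideal.comap_top,
    ← RingHom.ker_eq_comap_bot, Ideal.mk_ker, sup_eq_left.2 hJ] at h1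
  exact Ideal.IsPrime.ne_top inferInstance h1

theorem originOf_eq_span {σ : Type} (J : Ideal (MvPolynomial σ ℂ)) :
    originOf J = Ideal.span (Set.range fun i => Ideal.Quotient.mk J (X i)) := by
  rw [originOf, idealOfVars, Ideal.map_span, ← Set.range_comp]
  rfl

theorem mk_mem_originOf {σ : Type} {J : Ideal (MvPolynomial σ ℂ)} (hJ : J ≤ idealOfVars σ ℂ)
    {f : MvPolynomial σ ℂ} :
    Ideal.Quotient.mk J f ∈ originOf J ↔ constantCoeff f = 0 := by
  rw [← RingHom.mem_ker, ker_constantCoeff]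
  constructor
  · intro h
    have h1 : f ∈ (originOf J).comap (Ideal.Quotient.mk J) := h
    rwa [Ideal.comap_map_of_surjective _ Ideal.Quotient.mk_surjective,
      ← RingHom.ker_eq_comap_bot, Ideal.mk_ker, sup_eq_left.2 hJ] at h1
  · exact Ideal.mem_map_of_mem _

section Origin

variable {σ : Type} {J : Ideal (MvPolynomial σ ℂ)} (R : Type) [CommRing R]
  [Algebra (MvPolynomial σ ℂ ⧸ J) R] [(originOf J).IsPrime]
  [IsLocalization.AtPrime R (originOf J)]

/-- The image of a variable in the local ring at the origin. -/
abbrev localVar (i : σ) : R := algebraMap (MvPolynomial σ ℂ ⧸ J) R (Ideal.Quotient.mk J (X i))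

/-- This is the tangent vector at the origin in the direction `j`. It kills `J` because `J` has no
constant or linear part, and it extends to the local ring because a function outside the ideal of
the origin has a nonzero constant term. It serves to detect the coefficient of the variable `j`
modulo `𝔪²`. -/
theorem exists_dualNumber_lift (hJ : J ≤ idealOfVars σ ℂ ^ 2) (j : σ) [DecidableEq σ] :
    ∃ δ : R →+* DualNumber ℂ, ∀ i,
      δ (localVar (J := J) R i) = if i = j then DualNumber.eps else 0 := by
  let ψ : MvPolynomial σ ℂ →ₐ[ℂ] DualNumber ℂ := aeval fun i => if i = j then DualNumber.eps else 0
  have hψ : ∀ i, ψ (X i) = if i = j then DualNumber.eps else 0 := fun i => aeval_X _ i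
  have hψJ : ∀ f ∈ J, ψ f = 0 := by
    intro f hf
    have h := hJ hf
    rw [idealOfVars, span_sq_eq_span_pairMul] at h
    refine (Ideal.span_le (I := RingHom.ker (ψ : MvPolynomial σ ℂ →+* DualNumber ℂ))).2 ?_ h
    rintro _ ⟨s, rfl⟩
    rw [SetLike.mem_coe, RingHom.mem_ker]
    induction s with
    | _ a b =>
      simp only [pairMul_mk, map_mul, RingHom.coe_coe, hψ]
      split_ifs <;> simp
  let ψ' : MvPolynomial σ ℂ ⧸ J →+* DualNumber ℂ := Ideal.Quotient.lift J (ψ : _ →+* _) hψJ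
  have hunit : ∀ y : (originOf J).primeCompl, IsUnit (ψ' y) := by
    rintro ⟨y, hy⟩
    obtain ⟨f, rfl⟩ := Ideal.Quotient.mk_surjective y
    have hJ1 : J ≤ idealOfVars σ ℂ := hJ.trans (Ideal.pow_le_self two_ne_zero)
    have hf : constantCoeff f ≠ 0 := fun h => hy ((mk_mem_originOf hJ1).2 h)
    rw [TrivSqZeroExt.isUnit_iff_isUnit_fst, isUnit_iff_ne_zero]
    have hfst : (TrivSqZeroExt.fstHom ℂ ℂ ℂ).comp ψ = aeval (0 : σ → ℂ) := by
      ext i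
      rw [AlgHom.comp_apply, hψ]
      split_ifs <;> simp
    have h1 := DFunLike.congr_fun hfst f
    have h2 : aeval (0 : σ → ℂ) f = constantCoeff f := by
      rw [show aeval (0 : σ → ℂ) f = aeval (fun _ => (0 : ℂ)) f from rfl, aeval_zero']
      rfl
    rw [h2] at h1
    exact fun h => hf (h1.symm.trans h)
  refine ⟨IsLocalization.lift hunit, fun i => ?_⟩
  rw [localVar, IsLocalization.lift_eq]
  exact hψ i

variable [IsLocalRing R]

theorem maximalIdeal_eq_span_localVar :
    maximalIdeal R = Ideal.span (Set.range (localVar (J := J) R)) := by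
  rw [← IsLocalization.AtPrime.map_eq_maximalIdeal (originOf J) R, originOf_eq_span, Ideal.map_span,
    ← Set.range_comp]
  rfl

theorem card_le_spanFinrank_maximalIdeal [Fintype σ] [IsNoetherianRing R]
    (hJ : J ≤ idealOfVars σ ℂ ^ 2) : Fintype.card σ ≤ (maximalIdeal R).spanFinrank := by
  classical
  refine card_le_spanFinrank (IsNoetherian.noetherian _) (localVar (J := J) R) (fun i => ?_)
    fun a ha j => ?_
  · rw [maximalIdeal_eq_span_localVar (J := J)]
    exact Ideal.subset_span ⟨i, rfl⟩
  · obtain ⟨δ, hδ⟩ := exists_dualNumber_lift R hJ j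
    have h0 : δ (∑ i, a i • localVar (J := J) R i) = 0 := by
      rw [smul_eq_mul, ← sq, maximalIdeal_eq_span_localVar (J := J),
        span_sq_eq_span_pairMul] at ha
      refine (Ideal.span_le (I := RingHom.ker δ)).2 ?_ ha
      rintro _ ⟨s, rfl⟩
      rw [SetLike.mem_coe, RingHom.mem_ker]
      induction s with
      | _ a b =>
        simp only [pairMul_mk, map_mul, hδ]
        split_ifs <;> simp
    simp only [smul_eq_mul, map_sum, map_mul, hδ, mul_ite, mul_zero, Finset.sum_ite_eq',
      Finset.mem_univ, if_true] at h0
    rw [mem_maximalIdeal, mem_nonunits_iff]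
    intro hu
    have h1 := (hu.map δ).mul_right_eq_zero.1 h0
    have h2 := congrArg TrivSqZeroExt.snd h1
    rw [DualNumber.snd_eps, TrivSqZeroExt.snd_zero] at h2
    exact one_ne_zero h2

/-- The products of pairs of coordinates generate `𝔪²`. Each quadric `Q.q l` expresses the product
`Q.μ l` by products that are not distinguished, so all the distinguished ones can be dropped at
once. -/
theorem spanFinrank_maximalIdeal_sq_add_card_le [Fintype σ] {L : Type} [Fintype L]
    (Q : QuadricGenerators J L) :
    (maximalIdeal R ^ 2).spanFinrank + Fintype.card L ≤ (Fintype.card σ + 1).choose 2 := by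
  classical
  let T : Finset (Sym2 σ) := (Finset.univ.image Q.μ)ᶜ
  have hTcard : T.card + Fintype.card L = (Fintype.card σ + 1).choose 2 := by
    rw [← Sym2.card, ← Finset.card_univ (α := L), ← Finset.card_image_of_injective _ Q.μ_injective,
      Finset.card_compl_add_card]
  have hspan : maximalIdeal R ^ 2 =
      Ideal.span ((T.image (pairMul (localVar (J := J) R)) : Finset R) : Set R) := by
    rw [maximalIdeal_eq_span_localVar (J := J), span_sq_eq_span_pairMul]
    apply le_antisymm
    · rw [Ideal.span_le]
      have hT : ∀ s ∈ T, pairMul (localVar (J := J) R) s ∈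
          Ideal.span ((T.image (pairMul (localVar (J := J) R)) : Finset R) : Set R) := by
        intro s hs
        exact Ideal.subset_span (by rw [Finset.coe_image]; exact ⟨s, hs, rfl⟩)
      rintro _ ⟨s, rfl⟩
      by_cases hs : s ∈ T
      · exact hT s hs
      · simp only [T, Finset.mem_compl, not_not, Finset.mem_image, Finset.mem_univ, true_and] at hs
        obtain ⟨l, rfl⟩ := hs
        obtain ⟨c, hc⟩ := (Submodule.mem_span_range_iff_exists_fun ℂ).1 (Q.mem_quadrics l)
        have hcoef : ∀ s, coeff (pairExp s) (Q.q l) = c s := by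
          intro s
          rw [← hc, coeff_sum]
          simp [coeff_smul, coeff_pairMul_X]
        let ρ : MvPolynomial σ ℂ →+* R := (algebraMap (MvPolynomial σ ℂ ⧸ J) R).comp (Ideal.Quotient.mk J)
        have hρ : ρ (Q.q l) = 0 := by
          rw [RingHom.comp_apply, Ideal.Quotient.eq_zero_iff_mem.2 (Q.q_mem l), map_zero]
        have hρs : ∀ s, ρ (c s • pairMul X s) = ρ (C (c s)) * pairMul (localVar (J := J) R) s := by
          intro s
          rw [smul_eq_C_mul, map_mul, map_pairMul ρ]
          rfl
        rw [← hc, map_sum, ← Finset.add_sum_erase _ _ (Finset.mem_univ (Q.μ l)), hρs,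
          ← hcoef (Q.μ l), Q.coeff_self, C_1, map_one, one_mul] at hρ
        rw [SetLike.mem_coe, eq_neg_of_add_eq_zero_left hρ]
        refine neg_mem (Ideal.sum_mem _ fun s hs => ?_)
        rw [hρs]
        by_cases hsT : s ∈ T
        · exact Ideal.mul_mem_left _ _ (hT s hsT)
        · simp only [T, Finset.mem_compl, not_not, Finset.mem_image, Finset.mem_univ,
            true_and] at hsT
          obtain ⟨l', rfl⟩ := hsT
          rw [← hcoef, Q.coeff_ne _ _ fun h => (Finset.mem_erase.1 hs).1 (by rw [h]), C_0, map_zero,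
            zero_mul]
          exact zero_mem _
    · exact Ideal.span_mono (by rw [Finset.coe_image]; exact Set.image_subset_range _ _)
  rw [← hTcard, hspan]
  refine Nat.add_le_add_right ?_ _
  refine (Submodule.spanFinrank_span_le_ncard_of_finite (Finset.finite_toSet _)).trans ?_
  rw [Set.ncard_coe_finset]
  exact Finset.card_image_le

end Origin

end SchubertLCI

end

/-! ### Quadric cones with hypersurface charts: dimension and non-lci locus. -/

noncomputable section

namespace SchubertLCI

open IsLocalRing MvPolynomial

/-- A chart of the cone of `J` around the points where the variable `i` does not vanish: after
inverting this variable, the cone is the hypersurface `q = 0` (or the whole space, if `q = 0`) in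
the affine space of dimension `D + 1` (or `D`) with the coordinates `ι t`. -/
def HasChart {σ : Type} (J : Ideal (MvPolynomial σ ℂ)) (D : ℕ) (i : σ) : Prop :=
  ∃ (τ : Type) (_ : Fintype τ) (ι : τ → σ) (b : τ) (q : MvPolynomial τ ℂ), ι b = i ∧
    rename ι q ∈ J ∧ (∀ f, rename ι f ∈ J → q ∣ f) ∧
    (∀ s, ∃ (k : ℕ) (p : MvPolynomial τ ℂ), X i ^ k * X s - rename ι p ∈ J) ∧
    (q = 0 ∧ Fintype.card τ = D ∨ q ≠ 0 ∧ Fintype.card τ = D + 1)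

theorem HasChart.isLCI_and_height_le {σ : Type} {J : Ideal (MvPolynomial σ ℂ)} [J.IsPrime] {D : ℕ}
    {i : σ} (h : HasChart J D i) (P : Ideal (MvPolynomial σ ℂ ⧸ J)) [P.IsPrime]
    (hi : Ideal.Quotient.mk J (X i) ∉ P) :
    IsLCILocalRing (Localization.AtPrime P) ∧ P.height ≤ D := by
  obtain ⟨τ, _, ι, b, q, rfl, hq, hker, hs, hD⟩ := h
  let β : MvPolynomial τ ℂ →+* MvPolynomial σ ℂ ⧸ J :=
    (Ideal.Quotient.mk J).comp (rename ι : MvPolynomial τ ℂ →ₐ[ℂ] MvPolynomial σ ℂ)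
  have hβ : ∀ f, β f = Ideal.Quotient.mk J (rename ι f) := fun _ => rfl
  have hβb : β (X b) = Ideal.Quotient.mk J (X (ι b)) := by rw [hβ, rename_X]
  refine isLCILocalRing_and_height_le_of_chart β (q := q) (x := X b) ?_ ?_ ?_ P (hβb ▸ hi)
  · ext f
    rw [RingHom.mem_ker, hβ, Ideal.Quotient.eq_zero_iff_mem, Ideal.mem_span_singleton]
    refine ⟨hker f, ?_⟩
    rintro ⟨g, rfl⟩
    rw [map_mul]
    exact J.mul_mem_right _ hq
  -- Being moved into the image of `β` by a power of `x` is stable under sums and products, so the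
  -- condition on the variables suffices.
  · intro a
    obtain ⟨f, rfl⟩ := Ideal.Quotient.mk_surjective a
    induction f using MvPolynomial.induction_on with
    | C c => exact ⟨0, C c, by rw [hβ (C c), rename_C, pow_zero, one_mul]⟩
    | add f g hf hg =>
      obtain ⟨k, p, hp⟩ := hf
      obtain ⟨l, r, hr⟩ := hg
      refine ⟨k + l, X b ^ l * p + X b ^ k * r, ?_⟩
      simp only [map_add, map_mul, map_pow, ← hp, ← hr]
      ring
    | mul_X f s hf =>
      obtain ⟨k, p, hp⟩ := hf
      obtain ⟨l, r, hr⟩ := hs s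
      refine ⟨k + l, p * r, ?_⟩
      rw [← Ideal.Quotient.mk_eq_mk_iff_sub_mem, map_mul, map_pow, ← hβb, ← hβ] at hr
      rw [map_mul, map_mul, ← hp, ← hr]
      ring
  · rw [MvPolynomial.ringKrullDim_of_isNoetherianRing, ringKrullDim_eq_zero_of_field]
    rcases hD with ⟨h1, h2⟩ | ⟨h1, h2⟩
    · exact Or.inl ⟨h1, by simp [h2]⟩
    · exact Or.inr ⟨h1, by simp [h2]⟩

/-- The data on the cone of `J` from which everything that is needed here can be derived. -/
structure IsQuadricCone {σ : Type} (J : Ideal (MvPolynomial σ ℂ)) (D g : ℕ) : Prop where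
  isPrime : J.IsPrime
  generators : ∃ (L : Type) (_ : Fintype L), Fintype.card L = g ∧ Nonempty (QuadricGenerators J L)
  le_height : (D : ℕ∞) ≤ (originOf J).height
  chart : ∀ i, HasChart J D i

namespace IsQuadricCone

variable {σ : Type} {J : Ideal (MvPolynomial σ ℂ)} {D g : ℕ}

theorem le_sq (h : IsQuadricCone J D g) : J ≤ idealOfVars σ ℂ ^ 2 := by
  obtain ⟨L, _, -, ⟨Q⟩⟩ := h.generators
  exact Q.le_sq

theorem originOf_isMaximal (h : IsQuadricCone J D g) : (originOf J).IsMaximal :=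
  SchubertLCI.originOf_isMaximal (h.le_sq.trans (Ideal.pow_le_self two_ne_zero))

theorem exists_notMem (h : IsQuadricCone J D g) {P : Ideal (MvPolynomial σ ℂ ⧸ J)} [P.IsPrime]
    (hP : P ≠ originOf J) : ∃ i, Ideal.Quotient.mk J (X i) ∉ P := by
  by_contra! hc
  refine hP (h.originOf_isMaximal.eq_of_le (Ideal.IsPrime.ne_top ‹_›) ?_).symm
  rw [originOf_eq_span, Ideal.span_le]
  rintro _ ⟨i, rfl⟩
  exact hc i

variable [Fintype σ]

/-- Charts cover everything except the origin. A prime `q` strictly below the origin misses some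
variable; the ring being Jacobson, `q` lies in a maximal ideal `M` that misses it as well, and `q ≠
M`. So `q` has height smaller than that of `M`, which is at most `D`. -/
theorem height_le (h : IsQuadricCone J D g) (P : Ideal (MvPolynomial σ ℂ ⧸ J)) [P.IsPrime] :
    P.height ≤ D := by
  have := h.isPrime
  by_cases hP : P = originOf J
  · rw [Ideal.height_le_iff]
    intro q hq hqP
    obtain ⟨i, hi⟩ := h.exists_notMem (P := q) (hP ▸ hqP.ne)
    have hjac : q.jacobson = q := IsJacobsonRing.out inferInstance (Ideal.IsPrime.isRadical hq)
    rw [← hjac, Ideal.jacobson, Ideal.mem_sInf] at hi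
    push Not at hi
    obtain ⟨M, ⟨hqM, hM⟩, hiM⟩ := hi
    have hlt : q < M := by
      refine lt_of_le_of_ne hqM ?_
      rintro rfl
      exact hqP.ne (hM.eq_of_le (Ideal.IsPrime.ne_top ‹_›) hqP.le)
    exact (Ideal.height_strict_mono_of_isPrime hlt).trans_le
      ((h.chart i).isLCI_and_height_le M hiM).2
  · obtain ⟨i, hi⟩ := h.exists_notMem hP
    exact ((h.chart i).isLCI_and_height_le P hi).2

theorem ringKrullDim_eq (h : IsQuadricCone J D g) : ringKrullDim (MvPolynomial σ ℂ ⧸ J) = D := by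
  have := h.originOf_isMaximal
  apply le_antisymm
  · rw [ringKrullDim_le_iff_height_le]
    intro P hP
    exact_mod_cast h.height_le P
  · refine le_trans ?_ (Ideal.height_le_ringKrullDim_of_isPrime (I := originOf J))
    exact_mod_cast h.le_height

theorem moreGeneratorsThanCodim (h : IsQuadricCone J D g) {c : ℕ} (hc : D + c = Fintype.card σ)
    (hcg : c < g) : MoreGeneratorsThanCodim J c g := by
  obtain ⟨L, _, hL, ⟨Q⟩⟩ := h.generators
  refine ⟨?_, Q.spanFinrank_eq.trans hL, hcg⟩
  rw [h.ringKrullDim_eq]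
  exact_mod_cast hc

/-- With `N` variables, embedding dimension `e ≥ N` and `t` generators of `𝔪²`, the lci inequality
reads `e.choose 2 + D ≤ t`, while `t + g ≤ N.choose 2 + N`. Hence `g ≤ N - D = c`. -/
theorem not_isLCILocalRing_origin (h : IsQuadricCone J D g) {c : ℕ} (hc : D + c = Fintype.card σ)
    (hcg : c < g) (P : Ideal (MvPolynomial σ ℂ ⧸ J)) [P.IsPrime] (hP : P = originOf J) :
    ¬ IsLCILocalRing (Localization.AtPrime P) := by
  subst hP
  intro hlci
  obtain ⟨L, _, hL, ⟨Q⟩⟩ := h.generators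
  have h1 := hlci.choose_two_add_le (n := D) (by
    rw [IsLocalization.AtPrime.ringKrullDim_eq_height (originOf J)]
    exact_mod_cast h.le_height)
  have h2 := card_le_spanFinrank_maximalIdeal (J := J) (Localization.AtPrime (originOf J)) h.le_sq
  have h3 := spanFinrank_maximalIdeal_sq_add_card_le (Localization.AtPrime (originOf J)) Q
  have h4 := Nat.choose_le_choose 2 h2
  rw [Nat.choose_succ_succ' _ 1, Nat.choose_one_right] at h1 h3
  simp only [Nat.reduceAdd] at h1 h3
  omega

theorem not_isLCILocalRing_iff (h : IsQuadricCone J D g) {c : ℕ} (hc : D + c = Fintype.card σ)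
    (hcg : c < g) (P : Ideal (MvPolynomial σ ℂ ⧸ J)) [P.IsPrime] :
    ¬ IsLCILocalRing (Localization.AtPrime P) ↔ P = originOf J := by
  have := h.isPrime
  refine ⟨fun hP => ?_, h.not_isLCILocalRing_origin hc hcg P⟩
  by_contra hne
  obtain ⟨i, hi⟩ := h.exists_notMem hne
  exact hP ((h.chart i).isLCI_and_height_le P hi).1

end IsQuadricCone

theorem IsLCILocalRing.of_ringEquiv {R S : Type} [CommRing R] [CommRing S] (h : IsLCILocalRing R)
    (e : R ≃+* S) : IsLCILocalRing S := by
  obtain ⟨T, _, _, rs, hrs, ⟨φ⟩⟩ := h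
  exact ⟨T, _, ‹_›, rs, hrs, ⟨e.symm.trans φ⟩⟩

theorem PermInterval.notLCIExactlyAtOrigin {I : PermInterval} {σ : Type} [Fintype σ]
    {J : Ideal (MvPolynomial σ ℂ)} {D g c : ℕ} (h : IsQuadricCone J D g)
    (hc : D + c = Fintype.card σ) (hcg : c < g)
    (e : KLRing I.lo I.hi ≃+* MvPolynomial σ ℂ ⧸ J)
    (he : (originIdeal I.lo I.hi).map e = originOf J) : I.NotLCIExactlyAtOrigin := by
  have := h.originOf_isMaximal
  have ho : originIdeal I.lo I.hi = (originOf J).comap e := by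
    rw [← he, Ideal.comap_map_of_bijective _ e.bijective]
  refine ⟨⟨originIdeal I.lo I.hi, ho ▸ Ideal.comap_isPrime e (originOf J)⟩, rfl, fun P => ?_⟩
  let P' : Ideal (MvPolynomial σ ℂ ⧸ J) := P.asIdeal.comap e.symm
  have hP' : P.asIdeal = P'.comap e := by
    ext x; simp [P']
  have eloc : Localization.AtPrime P.asIdeal ≃+* Localization.AtPrime P' :=
    Localization.localRingEquiv _ _ e hP'
  have h1 : IsLCILocalRing (Localization.AtPrime P.asIdeal) ↔
      IsLCILocalRing (Localization.AtPrime P') :=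
    ⟨fun h => h.of_ringEquiv eloc, fun h => h.of_ringEquiv eloc.symm⟩
  rw [h1, h.not_isLCILocalRing_iff hc hcg, PrimeSpectrum.ext_iff]
  show _ ↔ P.asIdeal = originIdeal I.lo I.hi
  rw [ho, hP']
  exact (Ideal.comap_injective_of_surjective e e.surjective).eq_iff.symm

end SchubertLCI

end

/-! ### Straightening: the binomial relations of monomial parametrizations by rows and columns. -/

noncomputable section

namespace SchubertLCI

open MvPolynomial

section Toric

variable {E : Type} {r c : E → ℕ}

/-- One straightening step. An entry in the least row and an entry in the greatest column are
exchanged for the corner where that row and that column meet and a fourth entry. The multisets of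
rows and of columns do not change, and the corner splits off. -/
theorem exists_corner_factor {A : Type} [CommMonoid A] {x : E → A}
    (hx : ∀ e f, r e < r f → c e < c f → ∃ e' f', r e' = r e ∧ c e' = c f ∧ r f' = r f ∧
      c f' = c e ∧ x e * x f = x e' * x f') (M : Multiset E) {e₁ f₁ : E} (he : e₁ ∈ M)
    (hf : f₁ ∈ M) (hmin : ∀ e ∈ M, r e₁ ≤ r e) (hmax : ∀ e ∈ M, c e ≤ c f₁) :
    ∃ (e : E) (N : Multiset E), r e = r e₁ ∧ c e = c f₁ ∧ N.card + 1 = M.card ∧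
      (M.map x).prod = x e * (N.map x).prod ∧ M.map r = r e₁ ::ₘ N.map r ∧
      M.map c = c f₁ ::ₘ N.map c := by
  obtain ⟨N, rfl⟩ := Multiset.exists_cons_of_mem he
  rcases (hmax e₁ he).eq_or_lt with h1 | h1
  · exact ⟨e₁, N, rfl, h1, by simp, by simp, by simp, by simp [h1]⟩
  rcases (hmin f₁ hf).eq_or_lt with h2 | h2
  · obtain ⟨N', hN'⟩ := Multiset.exists_cons_of_mem hf
    refine ⟨f₁, N', h2.symm, rfl, ?_, ?_, ?_, ?_⟩ <;> rw [hN'] <;> simp [h2]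
  · have hne : f₁ ≠ e₁ := by rintro rfl; exact lt_irrefl _ h2
    have hfN : f₁ ∈ N := by
      rcases Multiset.mem_cons.1 hf with h | h
      · exact absurd h hne
      · exact h
    obtain ⟨N', rfl⟩ := Multiset.exists_cons_of_mem hfN
    obtain ⟨e', f', h3, h4, h5, h6, h7⟩ := hx e₁ f₁ h2 h1
    refine ⟨e', f' ::ₘ N', h3, h4, by simp, ?_, by simp [h5], ?_⟩
    · simp only [Multiset.map_cons, Multiset.prod_cons, ← mul_assoc, h7]
    · simp only [Multiset.map_cons, h6]
      exact Multiset.cons_swap _ _ _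

/-- A product of the entries of a partial matrix is determined by its rows and its columns, if the
product of the two ends of a diagonal is the product of the two ends of the antidiagonal. -/
theorem prod_eq_of_rows_eq_of_cols_eq {A : Type} [CommMonoid A] {x : E → A}
    (hinj : ∀ e f, r e = r f → c e = c f → e = f)
    (hx : ∀ e f, r e < r f → c e < c f → ∃ e' f', r e' = r e ∧ c e' = c f ∧ r f' = r f ∧
      c f' = c e ∧ x e * x f = x e' * x f') (n : ℕ) :
    ∀ M M' : Multiset E, M.card = n → M.map r = M'.map r → M.map c = M'.map c →
      (M.map x).prod = (M'.map x).prod := by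
  induction n with
  | zero =>
    intro M M' hM h _
    rw [Multiset.card_eq_zero] at hM
    subst hM
    rw [Multiset.map_zero, eq_comm, Multiset.map_eq_zero] at h
    rw [h]
  | succ n ih =>
    intro M M' hM hr hc
    have key : ∀ M : Multiset E, M.card = n + 1 → ∃ e₁ ∈ M, ∃ f₁ ∈ M, (∀ e ∈ M, r e₁ ≤ r e) ∧
        ∀ e ∈ M, c e ≤ c f₁ := by
      intro M hM
      classical
      have hne : M.toFinset.Nonempty := by
        rw [Multiset.toFinset_nonempty]; rintro rfl; simp at hM
      obtain ⟨e₁, he₁, h1⟩ := Finset.exists_min_image M.toFinset r hne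
      obtain ⟨f₁, hf₁, h2⟩ := Finset.exists_max_image M.toFinset c hne
      exact ⟨e₁, by simpa using he₁, f₁, by simpa using hf₁, by simpa using h1, by simpa using h2⟩
    have hM' : M'.card = n + 1 := by
      rw [← Multiset.card_map r, ← hr, Multiset.card_map, hM]
    obtain ⟨e₁, he₁, f₁, hf₁, h1, h2⟩ := key M hM
    obtain ⟨e₂, he₂, f₂, hf₂, h3, h4⟩ := key M' hM'
    obtain ⟨e, N, a1, a2, a3, a4, a5, a6⟩ := exists_corner_factor hx M he₁ hf₁ h1 h2
    obtain ⟨e', N', b1, b2, b3, b4, b5, b6⟩ := exists_corner_factor hx M' he₂ hf₂ h3 h4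
    -- The least row and the greatest column depend only on the multisets of rows and columns, so
    -- both products contain the same corner. It is cancelled from these multisets before the
    -- induction hypothesis is applied.
    have hr12 : r e₁ = r e₂ := by
      apply le_antisymm
      · have : r e₂ ∈ M.map r := hr ▸ Multiset.mem_map_of_mem r he₂
        obtain ⟨e, he, h⟩ := Multiset.mem_map.1 this
        exact h ▸ h1 e he
      · have : r e₁ ∈ M'.map r := hr ▸ Multiset.mem_map_of_mem r he₁
        obtain ⟨e, he, h⟩ := Multiset.mem_map.1 this
        exact h ▸ h3 e he
    have hc12 : c f₁ = c f₂ := by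
      apply le_antisymm
      · have : c f₁ ∈ M'.map c := hc ▸ Multiset.mem_map_of_mem c hf₁
        obtain ⟨e, he, h⟩ := Multiset.mem_map.1 this
        exact h ▸ h4 e he
      · have : c f₂ ∈ M.map c := hc ▸ Multiset.mem_map_of_mem c hf₂
        obtain ⟨e, he, h⟩ := Multiset.mem_map.1 this
        exact h ▸ h2 e he
    obtain rfl : e = e' := hinj _ _ (by rw [a1, b1, hr12]) (by rw [a2, b2, hc12])
    rw [a4, b4]
    congr 1
    refine ih N N' (by omega) ?_ ?_
    · rw [a5, b5, hr12] at hr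
      exact (Multiset.cons_inj_right _).1 hr
    · rw [a6, b6, hc12] at hc
      exact (Multiset.cons_inj_right _).1 hc

variable {W : Type}

/-- The exponent of the monomial `∏ (y (row e) * y (col e)) ^ m e`. -/
def toricExp (row col : E → W) : (E →₀ ℕ) →+ (W →₀ ℕ) :=
  Finsupp.mapDomain.addMonoidHom row + Finsupp.mapDomain.addMonoidHom col

/-- The monomial map `x e ↦ y (row e) * y (col e)`. -/
def toricMap (row col : E → W) : MvPolynomial E ℂ →ₐ[ℂ] MvPolynomial W ℂ :=
  aeval fun e => X (row e) * X (col e)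

@[simp] theorem toricMap_X (row col : E → W) (e : E) :
    toricMap row col (X e) = X (row e) * X (col e) :=
  aeval_X _ e

theorem toricExp_single (row col : E → W) (e : E) (n : ℕ) : toricExp row col (Finsupp.single e n) =
    Finsupp.single (row e) n + Finsupp.single (col e) n := by
  simp [toricExp]

theorem toricMap_monomial (row col : E → W) (m : E →₀ ℕ) :
    toricMap row col (monomial m 1) = monomial (toricExp row col m) 1 := by
  induction m using Finsupp.induction_linear with
  | zero => simp
  | add f g hf hg =>
    rw [← one_mul (1 : ℂ), ← monomial_mul, map_mul, hf, hg, map_add, monomial_mul]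
  | single e n =>
    rw [toricExp_single, ← X_pow_eq_monomial, map_pow, toricMap_X, mul_pow, X_pow_eq_monomial,
      X_pow_eq_monomial, monomial_mul, one_mul]

theorem filterMap_none {α β : Type} (M : Multiset α) :
    Multiset.filterMap (fun _ => (none : Option β)) M = 0 := by
  induction M using Multiset.induction_on with
  | empty => rfl
  | cons a M ih => rw [Multiset.filterMap_cons_none _ _ rfl, ih]

theorem filterMap_some {α β : Type} (f : α → β) (M : Multiset α) :
    Multiset.filterMap (fun a => some (f a)) M = M.map f := by
  rw [← Multiset.filterMap_eq_map]
  rfl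

/-- The linear section of the quotient map by `J` on the monomials in the image of the toric map. -/
theorem exists_toricSection (row col : E → W) {J : Ideal (MvPolynomial E ℂ)}
    (hJ : ∀ m m' : E →₀ ℕ, toricExp row col m = toricExp row col m' →
      Ideal.Quotient.mk J (monomial m 1) = Ideal.Quotient.mk J (monomial m' 1)) :
    ∃ σ : MvPolynomial W ℂ →ₗ[ℂ] MvPolynomial E ℂ ⧸ J,
      (∀ f, σ (toricMap row col f) = Ideal.Quotient.mk J f) ∧
      ∀ w, w ∉ Set.range (toricExp row col) → σ (monomial w 1) = 0 := by
  classical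
  -- A monomial in the image goes to the class of an arbitrary preimage, which by `hJ` does not
  -- depend on the choice. All other monomials go to zero.
  let σ : MvPolynomial W ℂ →ₗ[ℂ] MvPolynomial E ℂ ⧸ J :=
    (basisMonomials W ℂ).constr ℂ fun w =>
      if h : ∃ m, toricExp row col m = w then Ideal.Quotient.mk J (monomial h.choose 1) else 0
  have hσ : ∀ w, σ (monomial w 1) =
      if h : ∃ m, toricExp row col m = w then Ideal.Quotient.mk J (monomial h.choose 1) else 0 := by
    intro w
    have := (basisMonomials W ℂ).constr_basis ℂ (fun w =>
      if h : ∃ m, toricExp row col m = w then Ideal.Quotient.mk J (monomial h.choose 1) else 0) w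
    rwa [coe_basisMonomials] at this
  refine ⟨σ, fun f => ?_, fun w hw => ?_⟩
  · have : σ ∘ₗ (toricMap row col).toLinearMap = (Ideal.Quotient.mkₐ ℂ J).toLinearMap := by
      refine (basisMonomials E ℂ).ext fun m => ?_
      rw [coe_basisMonomials, LinearMap.comp_apply, AlgHom.toLinearMap_apply, toricMap_monomial, hσ]
      have h : ∃ m', toricExp row col m' = toricExp row col m := ⟨m, rfl⟩
      rw [dif_pos h]
      exact hJ _ _ h.choose_spec
    exact LinearMap.congr_fun this f
  · rw [hσ, dif_neg]
    rintro ⟨m, hm⟩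
    exact hw ⟨m, hm⟩

/-- The exponents of the parameters record in which rows and columns the factors lie, and
straightening shows that a monomial modulo `J` depends on nothing else. The labelling `ρ` allows the
parameters to come from any type, with a row and column numbering adapted to the relations. -/
theorem mk_monomial_eq_of_toricExp_eq {row col : E → W} {ρ : W → ℕ ⊕ ℕ}
    (hrow : ∀ e, ρ (row e) = Sum.inl (r e)) (hcol : ∀ e, ρ (col e) = Sum.inr (c e))
    (hinj : ∀ e f, r e = r f → c e = c f → e = f) {J : Ideal (MvPolynomial E ℂ)}
    (hJ : ∀ e f, r e < r f → c e < c f → ∃ e' f', r e' = r e ∧ c e' = c f ∧ r f' = r f ∧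
      c f' = c e ∧ X e * X f - X e' * X f' ∈ J) (m m' : E →₀ ℕ)
    (h : toricExp row col m = toricExp row col m') :
    Ideal.Quotient.mk J (monomial m 1) = Ideal.Quotient.mk J (monomial m' 1) := by
  classical
  have hmon : ∀ m : E →₀ ℕ, Ideal.Quotient.mk J (monomial m 1) =
      ((Finsupp.toMultiset m).map fun e => Ideal.Quotient.mk J (X e)).prod := by
    intro m
    rw [monomial_eq, C_1, one_mul, Finsupp.prod, map_prod, Finsupp.toMultiset_map,
      Finsupp.prod_toMultiset, Finsupp.prod_mapDomain_index (fun _ => pow_zero _)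
        (fun _ _ _ => pow_add _ _ _)]
    simp only [map_pow, Finsupp.prod]
  have hct : ∀ m : E →₀ ℕ, (Finsupp.toMultiset (toricExp row col m)).map ρ =
      (Finsupp.toMultiset m).map (fun e => Sum.inl (r e)) +
      (Finsupp.toMultiset m).map (fun e => Sum.inr (c e)) := by
    intro m
    rw [toricExp, AddMonoidHom.add_apply, map_add, Multiset.map_add]
    simp only [Finsupp.mapDomain.addMonoidHom_apply, ← Finsupp.toMultiset_map, Multiset.map_map,
      Function.comp_def, hrow, hcol]
  have h2 := congrArg (fun M => (Finsupp.toMultiset M).map ρ) h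
  simp only [hct] at h2
  rw [hmon, hmon]
  refine prod_eq_of_rows_eq_of_cols_eq (r := r) (c := c) hinj ?_ _ _ _ rfl ?_ ?_
  · intro e f h3 h4
    obtain ⟨e', f', a1, a2, a3, a4, a5⟩ := hJ e f h3 h4
    refine ⟨e', f', a1, a2, a3, a4, ?_⟩
    rw [← map_mul, ← map_mul]
    exact Ideal.Quotient.eq.2 a5
  · have := congrArg (Multiset.filterMap Sum.getLeft?) h2
    simpa [Multiset.filterMap_map, Function.comp_def, filterMap_none, filterMap_some] using this
  · have := congrArg (Multiset.filterMap Sum.getRight?) h2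
    simpa [Multiset.filterMap_map, Function.comp_def, filterMap_none, filterMap_some] using this

end Toric

end SchubertLCI

end

/-! ### Chains of primes below the vertex, and a criterion for charts. -/

noncomputable section

namespace SchubertLCI

open MvPolynomial

/-- A chain of primes below the origin modulo `J'` pulls back to one modulo `J`. It can be prolonged
by the zero ideal, because its least member contains the nonzero image of `J'`. -/
theorem add_one_le_height_originOf {σ : Type} {J J' : Ideal (MvPolynomial σ ℂ)} [J.IsPrime]
    [J'.IsPrime] (h : J < J') (hJ' : J' ≤ idealOfVars σ ℂ) {n : ℕ}
    (hn : (n : ℕ∞) ≤ (originOf J').height) : ((n + 1 : ℕ) : ℕ∞) ≤ (originOf J).height := by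
  have := originOf_isMaximal (h.le.trans hJ')
  have := originOf_isMaximal hJ'
  have : Nontrivial (MvPolynomial σ ℂ ⧸ J) := Ideal.Quotient.nontrivial_iff.2 ‹J.IsPrime›.ne_top
  let π : MvPolynomial σ ℂ ⧸ J →+* MvPolynomial σ ℂ ⧸ J' := Ideal.Quotient.factor h.le
  have hπ : Function.Surjective π := Ideal.Quotient.factor_surjective h.le
  have hcomap : originOf J = (originOf J').comap π := by
    ext x
    obtain ⟨f, rfl⟩ := Ideal.Quotient.mk_surjective x
    rw [Ideal.mem_comap, Ideal.Quotient.factor_mk, mk_mem_originOf (h.le.trans hJ'),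
      mk_mem_originOf hJ']
  obtain ⟨p, hp, hpn⟩ := Order.exists_series_of_le_height
    (⟨originOf J', inferInstance⟩ : PrimeSpectrum (MvPolynomial σ ℂ ⧸ J'))
    (n := n) (by rwa [← PrimeSpectrum.height_eq_orderHeight])
  have hmono : StrictMono (PrimeSpectrum.comap π) := by
    refine Monotone.strictMono_of_injective (fun a b hab => ?_)
      (PrimeSpectrum.comap_injective_of_surjective π hπ)
    exact Ideal.comap_mono hab
  let p' := p.map (PrimeSpectrum.comap π) hmono
  have hbot : (⊥ : PrimeSpectrum (MvPolynomial σ ℂ ⧸ J)) < p'.head := by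
    rw [bot_lt_iff_ne_bot]
    intro h0
    obtain ⟨f, hf, hfJ⟩ := SetLike.exists_of_lt h
    have h1 : Ideal.Quotient.mk J f ∈ p'.head.asIdeal := by
      show π (Ideal.Quotient.mk J f) ∈ p.head.asIdeal
      rw [Ideal.Quotient.factor_mk, Ideal.Quotient.eq_zero_iff_mem.2 hf]
      exact Ideal.zero_mem _
    rw [h0] at h1
    exact hfJ (Ideal.Quotient.eq_zero_iff_mem.1 h1)
  have h2 := Order.length_le_height_last (p := p'.cons ⊥ hbot)
  have h3 : (p'.cons ⊥ hbot).last = ⟨originOf J, inferInstance⟩ := by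
    rw [RelSeries.last_cons]
    refine PrimeSpectrum.ext ?_
    show (p.last).asIdeal.comap π = _
    rw [hp]
    exact hcomap.symm
  rw [h3, ← PrimeSpectrum.height_eq_orderHeight, RelSeries.cons_length] at h2
  have h4 : p'.length = n := hpn
  rwa [h4] at h2

section Orbit

variable {σ W : Type} [DecidableEq W]

/-- The endomorphism that sets the variables in `D` to zero. -/
def killVars (D : Finset W) : MvPolynomial W ℂ →ₐ[ℂ] MvPolynomial W ℂ :=
  aeval fun w => if w ∈ D then 0 else X w

theorem killVars_X (D : Finset W) (w : W) : killVars D (X w) = if w ∈ D then 0 else X w :=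
  aeval_X _ w

theorem killVars_killVars {D D' : Finset W} (h : D ⊆ D') (f : MvPolynomial W ℂ) :
    killVars D' (killVars D f) = killVars D' f := by
  have : (killVars D').comp (killVars D) = killVars (W := W) D' := by
    ext w
    rw [AlgHom.comp_apply, killVars_X, killVars_X]
    split_ifs with h1 h2 h2
    · simp
    · exact absurd (h h1) h2
    · simp [killVars_X, h2]
    · simp [killVars_X, h2]
  exact DFunLike.congr_fun this f

/-- The ideal of the closure of the image of the points of `Q = 0` at which the coordinates in `D`
vanish. -/
def orbitIdeal (φ : MvPolynomial σ ℂ →ₐ[ℂ] MvPolynomial W ℂ) (Q : MvPolynomial W ℂ)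
    (D : Finset W) : Ideal (MvPolynomial σ ℂ) :=
  (Ideal.span {killVars D Q}).comap ((killVars D).comp φ)

variable {φ : MvPolynomial σ ℂ →ₐ[ℂ] MvPolynomial W ℂ} {Q : MvPolynomial W ℂ}

theorem mem_orbitIdeal {D : Finset W} {f : MvPolynomial σ ℂ} :
    f ∈ orbitIdeal φ Q D ↔ killVars D Q ∣ killVars D (φ f) := by
  rw [orbitIdeal, Ideal.mem_comap, Ideal.mem_span_singleton]
  rfl

theorem orbitIdeal_isPrime {D : Finset W} (h : killVars D Q = 0 ∨ Prime (killVars D Q)) :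
    (orbitIdeal φ Q D).IsPrime := by
  have : (Ideal.span {killVars D Q}).IsPrime := by
    rcases h with h | h
    · rw [h, Set.singleton_zero, Ideal.span_zero]
      exact Ideal.isPrime_bot
    · exact (Ideal.span_singleton_prime h.ne_zero).2 h
  exact Ideal.comap_isPrime _ _

/-- The coordinate `e` separates the two closures: it vanishes on the smaller one, but not at the
image of `v`, which is a point of the larger one since the equation vanishes at `v`. -/
theorem orbitIdeal_lt {D D' : Finset W} (h : D ⊆ D') (e : σ) (v : W → ℂ)
    (hv : eval v (killVars D (φ (X e))) ≠ 0) (hQ : eval v (killVars D Q) = 0)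
    (he : killVars D' (φ (X e)) = 0) : orbitIdeal φ Q D < orbitIdeal φ Q D' := by
  refine lt_of_le_of_ne (fun f hf => ?_) fun heq => ?_
  · rw [mem_orbitIdeal] at hf ⊢
    rw [← killVars_killVars h, ← killVars_killVars h (φ f)]
    exact map_dvd _ hf
  · have : X e ∈ orbitIdeal φ Q D' := by
      rw [mem_orbitIdeal, he]
      exact dvd_zero _
    rw [← heq, mem_orbitIdeal] at this
    obtain ⟨p, hp⟩ := this
    rw [hp, map_mul, hQ, zero_mul] at hv
    exact hv rfl

theorem orbitIdeal_le (hφ : ∀ e, constantCoeff (φ (X e)) = 0) (hQ : constantCoeff Q = 0)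
    (D : Finset W) : orbitIdeal φ Q D ≤ idealOfVars σ ℂ := by
  have hk : ∀ f : MvPolynomial W ℂ, constantCoeff (killVars D f) = constantCoeff f := by
    intro f
    have : (constantCoeff : MvPolynomial W ℂ →+* ℂ).comp ((killVars D : MvPolynomial W ℂ →ₐ[ℂ] MvPolynomial W ℂ) :
        MvPolynomial W ℂ →+* MvPolynomial W ℂ) = constantCoeff := by
      ext w
      · simp
      · simp only [RingHom.comp_apply, RingHom.coe_coe, killVars_X]
        split_ifs <;> simp
    exact DFunLike.congr_fun this f
  have hc : (constantCoeff : MvPolynomial W ℂ →+* ℂ).comp (φ : MvPolynomial σ ℂ →+* MvPolynomial W ℂ) =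
      constantCoeff := by
    refine ringHom_ext (fun c => ?_) fun e => ?_
    · simp
    · simp [hφ]
  intro f hf
  rw [mem_orbitIdeal] at hf
  rw [← ker_constantCoeff, RingHom.mem_ker, ← hc, RingHom.comp_apply, RingHom.coe_coe, ← hk]
  obtain ⟨p, hp⟩ := hf
  rw [hp, map_mul, hk, hQ, zero_mul]

end Orbit

theorem isPrime_span_of_eq_zero_or_prime {R : Type} [CommRing R] [IsDomain R] {q : R}
    (h : q = 0 ∨ Prime q) : (Ideal.span {q}).IsPrime := by
  rcases h with rfl | h
  · rw [Set.singleton_zero, Ideal.span_zero]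
    exact Ideal.isPrime_bot
  · exact (Ideal.span_singleton_prime h.ne_zero).2 h

/-- The fractions `num s / X b` express all coordinates through those of the chart, and `γ` is this
substitution into the fraction field of `ℂ[τ] / (q)`. Because the generators are quadrics, the
denominator `X b ^ 2` is the same for all their terms, and divisibility of the numerators by `q`
shows that `γ` kills the ideal. On polynomials in the chart coordinates `γ` is reduction modulo `q`,
so these satisfy no other relation. -/
theorem HasChart.of_subst {σ τ : Type} [Fintype τ] {S : Set (MvPolynomial σ ℂ)} {D : ℕ}
    (hS : ∀ f ∈ S, f ∈ quadrics σ) (ι : τ → σ) (b : τ) {q : MvPolynomial τ ℂ}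
    (hq : q = 0 ∧ Fintype.card τ = D ∨ Prime q ∧ Fintype.card τ = D + 1) (hqb : ¬ q ∣ X b)
    (hqJ : rename ι q ∈ Ideal.span S) (num : σ → MvPolynomial τ ℂ)
    (hnum : ∀ t, num (ι t) = X t * X b)
    (hsub : ∀ s, X (ι b) * X s - rename ι (num s) ∈ Ideal.span S)
    (hdvd : ∀ f ∈ S, q ∣ aeval num f) : HasChart (Ideal.span S) D (ι b) := by
  have hP : (Ideal.span {q}).IsPrime :=
    isPrime_span_of_eq_zero_or_prime (hq.imp And.left And.left)
  let B := MvPolynomial τ ℂ ⧸ Ideal.span {q}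
  let F := FractionRing B
  let η : MvPolynomial τ ℂ →ₐ[ℂ] F :=
    (IsScalarTower.toAlgHom ℂ B F).comp (Ideal.Quotient.mkₐ ℂ (Ideal.span {q}))
  have hη : ∀ f, η f = 0 ↔ q ∣ f := by
    intro f
    rw [← Ideal.mem_span_singleton, ← Ideal.Quotient.eq_zero_iff_mem]
    exact map_eq_zero_iff (algebraMap B F) (IsFractionRing.injective B F)
  have hb : η (X b) ≠ 0 := fun h => hqb ((hη _).1 h)
  let γ : MvPolynomial σ ℂ →ₐ[ℂ] F := aeval fun s => η (num s) / η (X b)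
  have hγ : ∀ s, γ (X s) = η (num s) / η (X b) := fun s => aeval_X _ s
  have hγη : ∀ f, γ (rename ι f) = η f := by
    intro f
    have : γ.comp (rename ι) = η := by
      ext t
      rw [AlgHom.comp_apply, rename_X, hγ, hnum, map_mul, mul_div_cancel_right₀ _ hb]
    exact DFunLike.congr_fun this f
  have hquad : ∀ f ∈ quadrics σ, γ f * η (X b) ^ 2 = η (aeval num f) := by
    intro f hf
    refine Submodule.span_induction (p := fun f _ => γ f * η (X b) ^ 2 = η (aeval num f))
      ?_ ?_ ?_ ?_ hf
    · rintro _ ⟨s, rfl⟩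
      induction s with
      | _ i j =>
        simp only [pairMul_mk, map_mul, hγ, aeval_X]
        rw [div_mul_div_comm, ← sq, div_mul_cancel₀ _ (pow_ne_zero 2 hb)]
    · simp
    · intro x y _ _ hx hy
      rw [map_add, map_add, map_add, add_mul, hx, hy]
    · intro a x _ hx
      rw [map_smul, map_smul, map_smul, smul_mul_assoc, hx]
  have hγJ : ∀ f ∈ Ideal.span S, γ f = 0 := by
    intro f hf
    refine (Ideal.span_le (I := RingHom.ker (γ : _ →+* F))).2 (fun g hg => ?_) hf
    rw [SetLike.mem_coe, RingHom.mem_ker]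
    have h1 := hquad g (hS g hg)
    rw [(hη _).2 (hdvd g hg)] at h1
    exact (mul_eq_zero.1 h1).resolve_right (pow_ne_zero 2 hb)
  refine ⟨τ, ‹_›, ι, b, q, rfl, hqJ, fun f hf => ?_, fun s => ⟨1, num s, by rw [pow_one]; exact hsub s⟩,
    ?_⟩
  · rw [← hη, ← hγη]
    exact hγJ _ hf
  · rcases hq with hq | hq
    · exact Or.inl hq
    · exact Or.inr ⟨hq.1.ne_zero, hq.2⟩

/-- Symmetries of the cone carry charts to charts, so one chart for each orbit of variables is
enough. -/
theorem HasChart.of_involutive {σ : Type} {J : Ideal (MvPolynomial σ ℂ)} {D : ℕ} {i : σ}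
    (h : HasChart J D i) (e : σ → σ) (he : Function.Involutive e) (hJ : ∀ f ∈ J, rename e f ∈ J) :
    HasChart J D (e i) := by
  obtain ⟨τ, _, ι, b, q, rfl, hq, hker, hs, hD⟩ := h
  have hee : ∀ f : MvPolynomial σ ℂ, rename e (rename e f) = f := by
    intro f
    rw [rename_rename, he.comp_self, rename_id_apply]
  refine ⟨τ, _, e ∘ ι, b, q, rfl, ?_, fun f hf => ?_, fun s => ?_, hD⟩
  · rw [← rename_rename]
    exact hJ _ hq
  · rw [← rename_rename] at hf
    exact hker f (by rw [← hee (rename ι f)]; exact hJ _ hf)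
  · obtain ⟨k, p, hp⟩ := hs (e s)
    refine ⟨k, p, ?_⟩
    have := hJ _ hp
    rwa [map_sub, map_mul, map_pow, rename_X, rename_X, he s, rename_rename] at this

/-- The polynomial is linear in `X a` with coprime coefficients, hence irreducible. -/
theorem prime_X_mul_X_sub {τ : Type} {a b c d : τ} (hab : a ≠ b) (hac : a ≠ c) (had : a ≠ d)
    (hbc : b ≠ c) (hbd : b ≠ d) : Prime (X a * X b - X c * X d : MvPolynomial τ ℂ) := by
  classical
  rw [← UniqueFactorizationMonoid.irreducible_iff_prime, mul_comm, sub_eq_add_neg]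
  refine irreducible_mul_X_add _ _ a (X_ne_zero b) ?_ ?_ ?_
  · simp [vars_X, hab]
  · rw [vars_neg]
    intro h
    have := vars_mul _ _ h
    simp [vars_X, hac, had] at this
  · rw [IsRelPrime.neg_right_iff]
    have hX : ∀ i j : τ, i ≠ j → IsRelPrime (X i : MvPolynomial τ ℂ) (X j) := by
      intro i j hij
      refine (X_prime (i := i)).irreducible.isRelPrime_iff_not_dvd.2 ?_
      rw [X_dvd_X]
      exact hij
    exact (hX b c hbc).mul_right (hX b d hbd)

end SchubertLCI

end

/-! ### Kernels of toric maps; matrices of rank at most one. -/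

noncomputable section

namespace SchubertLCI

open MvPolynomial

/-- The linear section recovers a polynomial modulo `J` from its toric image, so the kernel of the
toric map is contained in `J`. -/
theorem mem_of_toricMap_eq_zero {E W : Type} {r c : E → ℕ} {row col : E → W} {ρ : W → ℕ ⊕ ℕ}
    (hrow : ∀ e, ρ (row e) = Sum.inl (r e)) (hcol : ∀ e, ρ (col e) = Sum.inr (c e))
    (hinj : ∀ e f, r e = r f → c e = c f → e = f) {J : Ideal (MvPolynomial E ℂ)}
    (hJ : ∀ e f, r e < r f → c e < c f → ∃ e' f', r e' = r e ∧ c e' = c f ∧ r f' = r f ∧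
      c f' = c e ∧ X e * X f - X e' * X f' ∈ J) {f : MvPolynomial E ℂ}
    (hf : toricMap row col f = 0) : f ∈ J := by
  obtain ⟨s, hs, -⟩ := exists_toricSection row col
    (mk_monomial_eq_of_toricExp_eq hrow hcol hinj hJ)
  rw [← Ideal.Quotient.eq_zero_iff_mem, ← hs, hf, map_zero]

/-- Generators of the form "leading monomial plus a combination of monomials that do not lead". -/
def QuadricGenerators.ofLeading {σ L : Type} {J : Ideal (MvPolynomial σ ℂ)} (μ : L → Sym2 σ)
    (hμ : Function.Injective μ) (rest : L → MvPolynomial σ ℂ)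
    (hrest : ∀ l, rest l ∈ Submodule.span ℂ (pairMul X '' {s | ∀ l', μ l' ≠ s}))
    (hJ : J = Ideal.span (Set.range fun l => pairMul X (μ l) + rest l)) :
    QuadricGenerators J L := by
  classical
  have hcoeff : ∀ l l', coeff (pairExp (μ l')) (rest l) = 0 := by
    intro l l'
    refine Submodule.span_induction (p := fun f _ => coeff (pairExp (μ l')) f = 0) ?_ ?_ ?_ ?_
      (hrest l)
    · rintro _ ⟨s, hs, rfl⟩
      rw [coeff_pairMul_X, if_neg (Ne.symm (hs l'))]
    · simp
    · intro x y _ _ hx hy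
      rw [coeff_add, hx, hy, add_zero]
    · intro a x _ hx
      rw [coeff_smul, hx, smul_zero]
  exact
  { q := fun l => pairMul X (μ l) + rest l
    μ := μ
    span_eq := hJ
    mem_quadrics := fun l => add_mem (Submodule.subset_span ⟨_, rfl⟩)
      (Submodule.span_mono (Set.image_subset_range _ _) (hrest l))
    coeff_self := fun l => by rw [coeff_add, coeff_pairMul_X, if_pos rfl, hcoeff, add_zero]
    coeff_ne := fun l l' h => by
      rw [coeff_add, coeff_pairMul_X, if_neg (fun h' => h (hμ h')), hcoeff, add_zero] }

theorem X_mul_X_mem_quadrics {σ : Type} (i j : σ) : (X i * X j : MvPolynomial σ ℂ) ∈ quadrics σ :=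
  Submodule.subset_span ⟨s(i, j), by simp⟩

theorem X_mul_X_mem_span {σ : Type} {s : Set (Sym2 σ)} {i j : σ} (h : s(i, j) ∈ s) :
    (X i * X j : MvPolynomial σ ℂ) ∈ Submodule.span ℂ (pairMul X '' s) :=
  Submodule.subset_span ⟨s(i, j), h, by simp⟩

section RankLeOne

variable (m k : ℕ)

theorem minor_mem_rankLeOneIdeal {m k : ℕ} (i i' : Fin m) (j j' : Fin k) :
    X (i, j) * X (i', j') - X (i, j') * X (i', j) ∈ rankLeOneIdeal m k :=
  Ideal.subset_span ⟨i, i', j, j', rfl⟩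

/-- The parametrization `x_{ij} = s_i t_j` of the matrices of rank at most one. -/
abbrev segreMap : MvPolynomial (Fin m × Fin k) ℂ →ₐ[ℂ] MvPolynomial (ℕ ⊕ ℕ) ℂ :=
  toricMap (fun e => Sum.inl (e.1 : ℕ)) (fun e => Sum.inr (e.2 : ℕ))

theorem rankLeOneIdeal_eq_orbitIdeal :
    rankLeOneIdeal m k = orbitIdeal (segreMap m k) 0 ∅ := by
  have hk : killVars (∅ : Finset (ℕ ⊕ ℕ)) = AlgHom.id ℂ _ := by
    ext w; simp [killVars_X]
  apply le_antisymm
  · refine Ideal.span_le.2 ?_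
    rintro _ ⟨i, i', j, j', rfl⟩
    rw [SetLike.mem_coe, mem_orbitIdeal, map_zero, zero_dvd_iff, hk, AlgHom.id_apply]
    simp only [map_sub, map_mul, toricMap_X]
    ring
  · intro f hf
    rw [mem_orbitIdeal, map_zero, zero_dvd_iff, hk, AlgHom.id_apply] at hf
    refine mem_of_toricMap_eq_zero (r := fun e : Fin m × Fin k => (e.1 : ℕ))
      (c := fun e : Fin m × Fin k => (e.2 : ℕ))
      (row := fun e : Fin m × Fin k => (Sum.inl (e.1 : ℕ) : ℕ ⊕ ℕ))
      (col := fun e : Fin m × Fin k => (Sum.inr (e.2 : ℕ) : ℕ ⊕ ℕ)) (ρ := id)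
      (fun _ => rfl) (fun _ => rfl) ?_ ?_ hf
    · intro e f h1 h2
      exact Prod.ext (Fin.ext h1) (Fin.ext h2)
    · intro e f _ _
      exact ⟨(e.1, f.2), (f.1, e.2), rfl, rfl, rfl, rfl, minor_mem_rankLeOneIdeal _ _ _ _⟩

instance orbitIdeal_segre_isPrime (D : Finset (ℕ ⊕ ℕ)) :
    (orbitIdeal (segreMap m k) 0 D).IsPrime :=
  orbitIdeal_isPrime (Or.inl (map_zero _))

instance : (rankLeOneIdeal m k).IsPrime := by
  rw [rankLeOneIdeal_eq_orbitIdeal]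
  infer_instance

theorem orbitIdeal_segre_le (D : Finset (ℕ ⊕ ℕ)) :
    orbitIdeal (segreMap m k) 0 D ≤ idealOfVars _ ℂ :=
  orbitIdeal_le (fun e => by simp) (map_zero _) D

theorem orbitIdeal_segre_lt {m k : ℕ} {D D' : Finset (ℕ ⊕ ℕ)} (h : D ⊆ D') (i : Fin m) (j : Fin k)
    (h1 : Sum.inl (i : ℕ) ∉ D) (h2 : Sum.inr (j : ℕ) ∉ D)
    (h3 : Sum.inl (i : ℕ) ∈ D' ∨ Sum.inr (j : ℕ) ∈ D') :
    orbitIdeal (segreMap m k) 0 D < orbitIdeal (segreMap m k) 0 D' := by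
  refine orbitIdeal_lt h (i, j) 1 ?_ (by simp) ?_
  · rw [toricMap_X, map_mul, killVars_X, killVars_X, if_neg h1, if_neg h2]
    simp
  · rw [toricMap_X, map_mul, killVars_X, killVars_X]
    rcases h3 with h3 | h3 <;> simp [h3]

/-- The lower half of the chain: with only the last row parameter alive, the column parameters are
set to zero one by one, which gives `b + 1` strict inclusions. -/
theorem le_height_orbitIdeal_segre (a b : ℕ) {q n : ℕ} (h : q + n = b + 1) :
    (n : ℕ∞) ≤ (originOf (orbitIdeal (segreMap (a + 1) (b + 1)) 0
      ((Finset.range a).disjSum (Finset.range q)))).height := by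
  induction n generalizing q with
  | zero => simp
  | succ n ih =>
    refine add_one_le_height_originOf (orbitIdeal_segre_lt ?_ (Fin.last a) ⟨q, by omega⟩ ?_ ?_ ?_)
      (orbitIdeal_segre_le _ _ _) (ih (q := q + 1) (by omega))
    · exact Finset.disjSum_mono le_rfl (Finset.range_mono (Nat.le_succ q))
    · simp
    · simp
    · simp

/-- The upper half: with all columns alive, the first `a` row parameters are set to zero one by one.
Together the chain has length `a + b + 1`. -/
theorem le_height_orbitIdeal_segre' (a b : ℕ) {p n : ℕ} (h : p + n = a) :
    ((n + (b + 1) : ℕ) : ℕ∞) ≤ (originOf (orbitIdeal (segreMap (a + 1) (b + 1)) 0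
      ((Finset.range p).disjSum (Finset.range 0)))).height := by
  induction n generalizing p with
  | zero =>
    obtain rfl : p = a := h
    rw [zero_add]
    exact le_height_orbitIdeal_segre p b (zero_add _)
  | succ n ih =>
    rw [Nat.add_right_comm]
    refine add_one_le_height_originOf (orbitIdeal_segre_lt ?_ ⟨p, by omega⟩ 0 ?_ ?_ ?_)
      (orbitIdeal_segre_le _ _ _) (ih (p := p + 1) (by omega))
    · exact Finset.disjSum_mono (Finset.range_mono (Nat.le_succ p)) le_rfl
    · simp
    · simp
    · simp

/-- Pairs of elements of `Fin m`, the second smaller than the first. -/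
abbrev OrderedPairs (m : ℕ) : Type := Σ i : Fin m, Fin (i : ℕ)

/-- The smaller element of a pair. -/
def OrderedPairs.fst {m : ℕ} (p : OrderedPairs m) : Fin m := p.2.castLE p.1.2.le

theorem OrderedPairs.fst_lt {m : ℕ} (p : OrderedPairs m) : p.fst < p.1 := p.2.2

theorem OrderedPairs.ext' {m : ℕ} {p p' : OrderedPairs m} (h1 : p.1 = p'.1) (h2 : p.fst = p'.fst) :
    p = p' := by
  obtain ⟨i, k⟩ := p
  obtain ⟨i', k'⟩ := p'
  obtain rfl : i = i' := h1
  congr 1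
  simpa [OrderedPairs.fst, Fin.ext_iff] using h2

theorem OrderedPairs.card (m : ℕ) : Fintype.card (OrderedPairs m) = m.choose 2 := by
  rw [Fintype.card_sigma]
  simp only [Fintype.card_fin]
  rw [Fin.sum_univ_eq_sum_range (fun i => i), Finset.sum_range_id, Nat.choose_two_right]

theorem OrderedPairs.exists_of_lt {m : ℕ} {i i' : Fin m} (h : i < i') :
    ∃ p : OrderedPairs m, p.fst = i ∧ p.1 = i' :=
  ⟨⟨i', ⟨i, h⟩⟩, rfl, rfl⟩

/-- The `2 × 2` minors as generators. -/
def rankLeOneGenerators :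
    QuadricGenerators (rankLeOneIdeal m k) (OrderedPairs m × OrderedPairs k) := by
  refine .ofLeading (fun l => s((l.1.fst, l.2.fst), (l.1.1, l.2.1))) ?_
    (fun l => -(X (l.1.fst, l.2.1) * X (l.1.1, l.2.fst))) ?_ ?_
  · rintro ⟨p, r⟩ ⟨p', r'⟩ h
    have hp := p.fst_lt
    have hp' := p'.fst_lt
    simp only [Sym2.eq_iff, Prod.mk.injEq] at h
    rcases h with ⟨⟨h1, h2⟩, h3, h4⟩ | ⟨⟨h1, -⟩, h3, -⟩
    · exact Prod.ext (OrderedPairs.ext' h3 h1) (OrderedPairs.ext' h4 h2)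
    · rw [h1, h3] at hp
      exact absurd hp hp'.asymm
  · rintro ⟨p, r⟩
    refine neg_mem (X_mul_X_mem_span ?_)
    rintro ⟨p', r'⟩ h
    have hp := p.fst_lt
    have hp' := p'.fst_lt
    have hr := r.fst_lt
    have hr' := r'.fst_lt
    simp only [Sym2.eq_iff, Prod.mk.injEq] at h
    rcases h with ⟨⟨-, h2⟩, -, h4⟩ | ⟨⟨h1, -⟩, h3, -⟩
    · rw [h2, h4] at hr'
      exact hr.asymm hr'
    · rw [h1, h3] at hp'
      exact hp.asymm hp'
  · have hgen : ∀ i i' : Fin m, i < i' → ∀ j j' : Fin k, j < j' →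
        X (i, j) * X (i', j') - X (i, j') * X (i', j) ∈ Ideal.span (Set.range
          fun l : OrderedPairs m × OrderedPairs k =>
            pairMul X s((l.1.fst, l.2.fst), (l.1.1, l.2.1)) +
              -(X (l.1.fst, l.2.1) * X (l.1.1, l.2.fst)) : Set (MvPolynomial _ ℂ)) := by
      intro i i' hi j j' hj
      obtain ⟨p, rfl, rfl⟩ := OrderedPairs.exists_of_lt hi
      obtain ⟨r, rfl, rfl⟩ := OrderedPairs.exists_of_lt hj
      refine Ideal.subset_span ⟨(p, r), ?_⟩
      simp only [pairMul_mk]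
      ring
    apply le_antisymm
    · refine Ideal.span_le.2 ?_
      rintro _ ⟨i, i', j, j', rfl⟩
      rw [SetLike.mem_coe]
      rcases lt_trichotomy i i' with hi | rfl | hi <;> rcases lt_trichotomy j j' with hj | rfl | hj
      · exact hgen _ _ hi _ _ hj
      · rw [sub_self]; exact zero_mem _
      · rw [← neg_sub]; exact neg_mem (hgen _ _ hi _ _ hj)
      · rw [mul_comm, sub_self]; exact zero_mem _
      · rw [sub_self]; exact zero_mem _
      · rw [mul_comm, sub_self]; exact zero_mem _
      · rw [mul_comm, mul_comm (X (i, j')), ← neg_sub]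
        exact neg_mem (hgen _ _ hi _ _ hj)
      · rw [sub_self]; exact zero_mem _
      · rw [mul_comm, mul_comm (X (i, j'))]
        exact hgen _ _ hi _ _ hj
    · refine Ideal.span_le.2 ?_
      rintro _ ⟨⟨p, r⟩, rfl⟩
      simp only [pairMul_mk, ← sub_eq_add_neg]
      exact minor_mem_rankLeOneIdeal _ _ _ _

/-- Where the entry `(i, j)` is invertible, a matrix of rank at most one is determined by its row
`i` and its column `j`, and these `a + b + 1` entries are free. -/
theorem hasChart_rankLeOneIdeal (a b : ℕ) (i : Fin (a + 1)) (j : Fin (b + 1)) :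
    HasChart (rankLeOneIdeal (a + 1) (b + 1)) (a + b + 1) (i, j) := by
  let ι : Fin (b + 1) ⊕ Fin a → Fin (a + 1) × Fin (b + 1) :=
    Sum.elim (fun j' => (i, j')) (fun t => (i.succAbove t, j))
  -- The entry `(i, j)` is shared by the row and the column and is counted with the row.
  let colVar : Fin (a + 1) → Fin (b + 1) ⊕ Fin a :=
    i.insertNth (α := fun _ => Fin (b + 1) ⊕ Fin a) (Sum.inl j) Sum.inr
  have hcol : ∀ i', ι (colVar i') = (i', j) := by
    intro i'
    induction i' using i.succAboveCases with
    | x => simp [colVar, ι]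
    | p t => simp [colVar, ι]
  refine HasChart.of_subst (S := {f | ∃ (i i' : Fin (a + 1)) (j j' : Fin (b + 1)),
    f = X (i, j) * X (i', j') - X (i, j') * X (i', j)}) ?_ ι (Sum.inl j) (q := 0)
    (Or.inl ⟨rfl, by simp; omega⟩) ?_ ?_ (fun e => X (Sum.inl e.2) * X (colVar e.1)) ?_ ?_ ?_
  · rintro _ ⟨i, i', j, j', rfl⟩
    exact sub_mem (X_mul_X_mem_quadrics _ _) (X_mul_X_mem_quadrics _ _)
  · rw [zero_dvd_iff]; exact X_ne_zero _
  · rw [map_zero]; exact zero_mem _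
  · rintro (j' | t)
    · simp [ι, colVar]
    · simp [ι, colVar, mul_comm]
  · rintro ⟨i', j'⟩
    rw [map_mul, rename_X, rename_X, hcol]
    exact minor_mem_rankLeOneIdeal _ _ _ _
  · rintro _ ⟨i, i', j, j', rfl⟩
    simp only [map_sub, map_mul, aeval_X]
    ring_nf
    exact dvd_zero _

theorem isQuadricCone_rankLeOneIdeal (a b : ℕ) : IsQuadricCone (rankLeOneIdeal (a + 1) (b + 1))
    (a + b + 1) ((a + 1).choose 2 * (b + 1).choose 2) where
  isPrime := inferInstance
  generators := ⟨_, _, by rw [Fintype.card_prod, OrderedPairs.card, OrderedPairs.card],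
    ⟨rankLeOneGenerators _ _⟩⟩
  le_height := by
    have := le_height_orbitIdeal_segre' a b (zero_add a)
    have h0 : (Finset.range 0).disjSum (Finset.range 0) = (∅ : Finset (ℕ ⊕ ℕ)) := by simp
    rw [h0] at this
    rw [rankLeOneIdeal_eq_orbitIdeal]
    simpa [add_assoc] using this
  chart := fun ⟨i, j⟩ => hasChart_rankLeOneIdeal a b i j

end RankLeOne

end SchubertLCI

end

/-! ### The three by three matrix with a corner cut out. -/

noncomputable section

namespace SchubertLCI

open MvPolynomial

theorem mem_of_eq_neg {R : Type} [CommRing R] {J : Ideal R} {f g : R} (hg : g ∈ J) (h : f = -g) :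
    f ∈ J :=
  h ▸ neg_mem hg

theorem rename_mem_span {σ : Type} {S : Set (MvPolynomial σ ℂ)} {e : σ → σ}
    (h : ∀ f ∈ S, rename e f ∈ Ideal.span S) : ∀ f ∈ Ideal.span S, rename e f ∈ Ideal.span S := by
  intro f hf
  have : Ideal.span S ≤ (Ideal.span S).comap (rename e : MvPolynomial σ ℂ →ₐ[ℂ] _) :=
    Ideal.span_le.2 h
  exact this hf

theorem orbitIdeal_toric_lt {E W : Type} [DecidableEq W] {row col : E → W} {Q : MvPolynomial W ℂ}
    {D D' : Finset W} (h : D ⊆ D') (e : E) (h1 : row e ∉ D) (h2 : col e ∉ D)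
    (h3 : row e ∈ D' ∨ col e ∈ D')
    (hQ : eval (fun w => if w = row e ∨ w = col e then 1 else 0) (killVars D Q) = 0) :
    orbitIdeal (toricMap row col) Q D < orbitIdeal (toricMap row col) Q D' := by
  refine orbitIdeal_lt h e _ ?_ hQ ?_
  · rw [toricMap_X, map_mul, killVars_X, killVars_X, if_neg h1, if_neg h2]
    simp
  · rw [toricMap_X, map_mul, killVars_X, killVars_X]
    rcases h3 with h3 | h3 <;> simp [h3]

theorem killVars_empty {W : Type} [DecidableEq W] : killVars (∅ : Finset W) = AlgHom.id ℂ _ := by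
  ext w; simp [killVars_X]

section CutCorner

/-- The row of a variable, counted from below. -/
def cutRow : Fin 8 → ℕ := ![2, 2, 1, 1, 1, 0, 0, 0]

/-- The column of a variable. -/
def cutCol : Fin 8 → ℕ := ![0, 1, 0, 1, 2, 0, 1, 2]

abbrev cutMap : MvPolynomial (Fin 8) ℂ →ₐ[ℂ] MvPolynomial (ℕ ⊕ ℕ) ℂ :=
  toricMap (fun e => Sum.inl (cutRow e)) (fun e => Sum.inr (cutCol e))

theorem cutCorner_minors_mem :
    X 0 * X 3 - X 1 * X 2 ∈ cutCornerIdeal ∧ X 0 * X 6 - X 1 * X 5 ∈ cutCornerIdeal ∧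
    X 2 * X 6 - X 3 * X 5 ∈ cutCornerIdeal ∧ X 2 * X 7 - X 4 * X 5 ∈ cutCornerIdeal ∧
    X 3 * X 7 - X 4 * X 6 ∈ cutCornerIdeal := by
  refine ⟨?_, ?_, ?_, ?_, ?_⟩ <;> exact Ideal.subset_span (by simp)

/-- Straightening replaces a diagonal pair by the antidiagonal one. With rows counted from below,
the missing corner has both the greatest row and the greatest column, so it is never an end of an
antidiagonal, and the five minors suffice. -/
theorem cutCornerIdeal_eq_orbitIdeal : cutCornerIdeal = orbitIdeal cutMap 0 ∅ := by
  apply le_antisymm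
  · refine Ideal.span_le.2 ?_
    intro f hf
    rw [SetLike.mem_coe, mem_orbitIdeal, map_zero, zero_dvd_iff, killVars_empty, AlgHom.id_apply]
    simp only [Set.mem_insert_iff, Set.mem_singleton_iff] at hf
    rcases hf with rfl | rfl | rfl | rfl | rfl <;>
      simp only [map_sub, map_mul, toricMap_X, cutRow, cutCol, Matrix.cons_val] <;> ring
  · intro f hf
    rw [mem_orbitIdeal, map_zero, zero_dvd_iff, killVars_empty, AlgHom.id_apply] at hf
    refine mem_of_toricMap_eq_zero (r := cutRow) (c := cutCol)
      (row := fun e => (Sum.inl (cutRow e) : ℕ ⊕ ℕ))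
      (col := fun e => (Sum.inr (cutCol e) : ℕ ⊕ ℕ)) (ρ := id)
      (fun _ => rfl) (fun _ => rfl) (by decide) ?_ hf
    obtain ⟨h1, h2, h3, h4, h5⟩ := cutCorner_minors_mem
    have key : ∀ e f, cutRow e < cutRow f → cutCol e < cutCol f →
        e = 2 ∧ f = 1 ∨ e = 5 ∧ f = 1 ∨ e = 5 ∧ f = 3 ∨ e = 5 ∧ f = 4 ∨ e = 6 ∧ f = 4 := by
      decide
    intro e f he hf
    rcases key e f he hf with ⟨rfl, rfl⟩ | ⟨rfl, rfl⟩ | ⟨rfl, rfl⟩ | ⟨rfl, rfl⟩ | ⟨rfl, rfl⟩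
    · exact ⟨3, 0, rfl, rfl, rfl, rfl, mem_of_eq_neg h1 (by ring)⟩
    · exact ⟨6, 0, rfl, rfl, rfl, rfl, mem_of_eq_neg h2 (by ring)⟩
    · exact ⟨6, 2, rfl, rfl, rfl, rfl, mem_of_eq_neg h3 (by ring)⟩
    · exact ⟨7, 2, rfl, rfl, rfl, rfl, mem_of_eq_neg h4 (by ring)⟩
    · exact ⟨7, 3, rfl, rfl, rfl, rfl, mem_of_eq_neg h5 (by ring)⟩

instance orbitIdeal_cut_isPrime (D : Finset (ℕ ⊕ ℕ)) : (orbitIdeal cutMap 0 D).IsPrime :=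
  orbitIdeal_isPrime (Or.inl (map_zero _))

theorem orbitIdeal_cut_step {D : Finset (ℕ ⊕ ℕ)} (w : ℕ ⊕ ℕ) (e : Fin 8)
    (h1 : Sum.inl (cutRow e) ∉ D) (h2 : Sum.inr (cutCol e) ∉ D)
    (h3 : Sum.inl (cutRow e) = w ∨ Sum.inr (cutCol e) = w) {n : ℕ}
    (hn : (n : ℕ∞) ≤ (originOf (orbitIdeal cutMap 0 (insert w D))).height) :
    ((n + 1 : ℕ) : ℕ∞) ≤ (originOf (orbitIdeal cutMap 0 D)).height :=
  add_one_le_height_originOf (orbitIdeal_toric_lt (Finset.subset_insert w D) e h1 h2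
    (h3.imp (fun h => by simp [h]) (fun h => by simp [h])) (by simp))
    (orbitIdeal_le (fun e => by simp) (map_zero _) _) hn

/-- The parameters are set to zero in an order in which each step still finds an entry that is alive
before it and dies with it. -/
theorem le_height_cutCorner : ((5 : ℕ) : ℕ∞) ≤ (originOf cutCornerIdeal).height := by
  rw [cutCornerIdeal_eq_orbitIdeal]
  refine orbitIdeal_cut_step (.inr 2) 4 (by decide) (by decide) (by decide) ?_
  refine orbitIdeal_cut_step (.inl 2) 0 (by decide) (by decide) (by decide) ?_
  refine orbitIdeal_cut_step (.inl 1) 2 (by decide) (by decide) (by decide) ?_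
  refine orbitIdeal_cut_step (.inr 1) 6 (by decide) (by decide) (by decide) ?_
  exact orbitIdeal_cut_step (n := 0) (.inr 0) 5 (by decide) (by decide) (by decide) (by simp)

def cutCornerGenerators : QuadricGenerators cutCornerIdeal (Fin 5) := by
  refine .ofLeading ![s(0, 3), s(0, 6), s(2, 6), s(2, 7), s(3, 7)] (by decide)
    ![-(X 1 * X 2), -(X 1 * X 5), -(X 3 * X 5), -(X 4 * X 5), -(X 4 * X 6)] ?_ ?_
  · intro l
    fin_cases l <;> exact neg_mem (X_mul_X_mem_span (by decide))
  · rw [cutCornerIdeal]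
    congr 1
    ext f
    simp [Fin.exists_fin_succ, sub_eq_add_neg, eq_comm]

theorem cutCorner_subset_quadrics : ∀ f ∈ ({X 0 * X 3 - X 1 * X 2, X 0 * X 6 - X 1 * X 5,
    X 2 * X 6 - X 3 * X 5, X 2 * X 7 - X 4 * X 5, X 3 * X 7 - X 4 * X 6} :
      Set (MvPolynomial (Fin 8) ℂ)), f ∈ quadrics (Fin 8) := by
  rintro _ (rfl | rfl | rfl | rfl | rfl) <;>
    exact sub_mem (X_mul_X_mem_quadrics _ _) (X_mul_X_mem_quadrics _ _)

/-- The entry `d` has a full row and a full column: where it is invertible, `b, c, d, e, g` are free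
and determine `a`, `f` and `h`. -/
theorem hasChart_cutCorner_three : HasChart cutCornerIdeal 5 3 := by
  obtain ⟨h1, h2, h3, h4, h5⟩ := cutCorner_minors_mem
  refine HasChart.of_subst cutCorner_subset_quadrics (τ := Fin 5) ![1, 2, 3, 4, 6] 2 (q := 0)
    (Or.inl ⟨rfl, rfl⟩) ?_ ?_ ![X 0 * X 1, X 0 * X 2, X 1 * X 2, X 2 * X 2, X 3 * X 2, X 1 * X 4,
      X 4 * X 2, X 3 * X 4] ?_ ?_ ?_
  · rw [zero_dvd_iff]; exact X_ne_zero _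
  · rw [map_zero]; exact Ideal.zero_mem _
  · intro t; fin_cases t <;> rfl
  · intro s
    change _ ∈ cutCornerIdeal
    fin_cases s <;> simp <;> first
      | exact mem_of_eq_neg (neg_mem h1) (by ring1)
      | exact mem_of_eq_neg h3 (by ring1) | exact h5
      | (ring_nf; exact zero_mem _)
  · rintro _ (rfl | rfl | rfl | rfl | rfl) <;> simp [zero_dvd_iff] <;> ring

/-- Where `a` is invertible, `d` and `g` are determined, but `e` and `h` lie in a column that does
not meet the row of `a`. The equation `ch = ef` remains. -/
theorem hasChart_cutCorner_zero : HasChart cutCornerIdeal 5 0 := by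
  obtain ⟨h1, h2, h3, h4, h5⟩ := cutCorner_minors_mem
  refine HasChart.of_subst cutCorner_subset_quadrics (τ := Fin 6) ![0, 1, 2, 4, 5, 7] 0
    (q := X 2 * X 5 - X 3 * X 4)
    (Or.inr ⟨prime_X_mul_X_sub (by decide) (by decide) (by decide) (by decide) (by decide),
      rfl⟩) ?_ ?_ ![X 0 * X 0, X 1 * X 0, X 2 * X 0, X 1 * X 2, X 3 * X 0, X 4 * X 0, X 1 * X 4,
      X 5 * X 0] ?_ ?_ ?_
  · rintro ⟨f, hf⟩
    simpa using congrArg (eval (fun i : Fin 6 => if i = 0 then (1 : ℂ) else 0)) hf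
  · change _ ∈ cutCornerIdeal
    simpa using h4
  · intro t; fin_cases t <;> rfl
  · intro s
    change _ ∈ cutCornerIdeal
    fin_cases s <;> simp <;> first
      | exact h1 | exact h2
      | (ring_nf; exact zero_mem _)
  · rintro _ (rfl | rfl | rfl | rfl | rfl) <;> simp
    · exact ⟨0, by ring⟩
    · exact ⟨0, by ring⟩
    · exact ⟨0, by ring⟩
    · exact ⟨X 0 * X 0, by ring⟩
    · exact ⟨X 0 * X 1, by ring⟩

theorem HasChart.cutCorner_swap_columns {i : Fin 8} (h : HasChart cutCornerIdeal 5 i) :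
    HasChart cutCornerIdeal 5 ((![1, 0, 3, 2, 4, 6, 5, 7] : Fin 8 → Fin 8) i) := by
  obtain ⟨h1, h2, h3, h4, h5⟩ := cutCorner_minors_mem
  refine h.of_involutive _ (fun i => by fin_cases i <;> rfl) (rename_mem_span ?_)
  change ∀ f ∈ _, _ ∈ cutCornerIdeal
  rintro _ (rfl | rfl | rfl | rfl | rfl) <;>
    simp only [map_sub, map_mul, rename_X, Matrix.cons_val]
  · exact mem_of_eq_neg h1 (by ring1)
  · exact mem_of_eq_neg h2 (by ring1)
  · exact mem_of_eq_neg h3 (by ring1)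
  · exact h5
  · exact h4

theorem HasChart.cutCorner_swap_rows {i : Fin 8} (h : HasChart cutCornerIdeal 5 i) :
    HasChart cutCornerIdeal 5 ((![0, 1, 5, 6, 7, 2, 3, 4] : Fin 8 → Fin 8) i) := by
  obtain ⟨h1, h2, h3, h4, h5⟩ := cutCorner_minors_mem
  refine h.of_involutive _ (fun i => by fin_cases i <;> rfl) (rename_mem_span ?_)
  change ∀ f ∈ _, _ ∈ cutCornerIdeal
  rintro _ (rfl | rfl | rfl | rfl | rfl) <;>
    simp only [map_sub, map_mul, rename_X, Matrix.cons_val]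
  · exact h2
  · exact h1
  · exact mem_of_eq_neg h3 (by ring1)
  · exact mem_of_eq_neg h4 (by ring1)
  · exact mem_of_eq_neg h5 (by ring1)

theorem HasChart.cutCorner_antitranspose {i : Fin 8} (h : HasChart cutCornerIdeal 5 i) :
    HasChart cutCornerIdeal 5 ((![7, 4, 6, 3, 1, 5, 2, 0] : Fin 8 → Fin 8) i) := by
  obtain ⟨h1, h2, h3, h4, h5⟩ := cutCorner_minors_mem
  refine h.of_involutive _ (fun i => by fin_cases i <;> rfl) (rename_mem_span ?_)
  change ∀ f ∈ _, _ ∈ cutCornerIdeal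
  rintro _ (rfl | rfl | rfl | rfl | rfl) <;>
    simp only [map_sub, map_mul, rename_X, Matrix.cons_val]
  · exact mem_of_eq_neg (neg_mem h5) (by ring1)
  · exact mem_of_eq_neg (neg_mem h4) (by ring1)
  · exact mem_of_eq_neg (neg_mem h3) (by ring1)
  · exact mem_of_eq_neg (neg_mem h2) (by ring1)
  · exact mem_of_eq_neg (neg_mem h1) (by ring1)

/-- The symmetries have two orbits on the variables, that of `a`, consisting of `a, b, e, h`, and
that of `d`, consisting of `c, d, f, g`. -/
theorem hasChart_cutCorner (i : Fin 8) : HasChart cutCornerIdeal 5 i := by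
  have ha := hasChart_cutCorner_zero
  have hd := hasChart_cutCorner_three
  fin_cases i
  · exact ha
  · exact ha.cutCorner_swap_columns
  · exact hd.cutCorner_swap_columns
  · exact hd
  · exact ha.cutCorner_swap_columns.cutCorner_antitranspose
  · exact hd.cutCorner_swap_columns.cutCorner_swap_rows
  · exact hd.cutCorner_swap_rows
  · exact ha.cutCorner_antitranspose

theorem isQuadricCone_cutCornerIdeal : IsQuadricCone cutCornerIdeal 5 5 where
  isPrime := by rw [cutCornerIdeal_eq_orbitIdeal]; infer_instance
  generators := ⟨_, _, rfl, ⟨cutCornerGenerators⟩⟩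
  le_height := le_height_cutCorner
  chart := hasChart_cutCorner

end CutCorner

end SchubertLCI

end

/-! ### Two blocks of dependent rows that are orthogonal to each other. -/

noncomputable section

namespace SchubertLCI

open MvPolynomial

theorem prime_sum_X_mul_X {n : Type} {A : Finset n} (hA : A.Nontrivial) :
    Prime (∑ j ∈ A, X (Sum.inl j) * X (Sum.inr j) : MvPolynomial (n ⊕ n) ℂ) := by
  classical
  let c : n →₀ ℂ := Finsupp.indicator A fun _ _ => 1
  have hs : c.support = A := by
    ext j
    simp [c, Finsupp.indicator_apply]
  have hc : sumSMulXSMulY c = ∑ j ∈ A, X (Sum.inl j) * X (Sum.inr j) := by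
    rw [sumSMulXSMulY, Finsupp.linearCombination_apply, Finsupp.sum, hs]
    refine Finset.sum_congr rfl fun j hj => ?_
    simp [c, Finsupp.indicator_apply, hj]
  rw [← hc, ← UniqueFactorizationMonoid.irreducible_iff_prime]
  refine irreducible_sumSMulXSMulY c (by rw [hs]; exact hA) fun r hr => ?_
  obtain ⟨j, hj⟩ := hA.nonempty
  have := hr j
  simp only [c, Finsupp.indicator_apply, hj, dif_pos] at this
  exact isUnit_of_dvd_one this

section Block

variable {m : ℕ} (blk : Fin m → Bool)

/-- The `m × 3` matrices whose rows fall into two blocks, such that the rows of the same block are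
dependent and the rows of different blocks are orthogonal. -/
def blockIdeal : Ideal (MvPolynomial (Fin m × Fin 3) ℂ) :=
  Ideal.span ({f | ∃ i i' j j', blk i = blk i' ∧ f = X (i, j) * X (i', j') - X (i, j') * X (i', j)} ∪
    {f | ∃ i i', blk i = false ∧ blk i' = true ∧ f = ∑ j, X (i, j) * X (i', j)})

variable {blk}

theorem minor_mem_blockIdeal {i i' : Fin m} (h : blk i = blk i') (j j' : Fin 3) :
    X (i, j) * X (i', j') - X (i, j') * X (i', j) ∈ blockIdeal blk :=
  Ideal.subset_span (Or.inl ⟨i, i', j, j', h, rfl⟩)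

theorem orthogonal_mem_blockIdeal {i i' : Fin m} (h : blk i ≠ blk i') :
    ∑ j, X (i, j) * X (i', j) ∈ blockIdeal blk := by
  cases h1 : blk i <;> cases h2 : blk i'
  · exact absurd (h1.trans h2.symm) h
  · exact Ideal.subset_span (Or.inr ⟨i, i', h1, h2, rfl⟩)
  · simp_rw [mul_comm (X (i, _))]
    exact Ideal.subset_span (Or.inr ⟨i', i, h2, h1, rfl⟩)
  · exact absurd (h1.trans h2.symm) h

theorem blockIdeal_le {I : Ideal (MvPolynomial (Fin m × Fin 3) ℂ)}
    (h1 : ∀ i i', i < i' → blk i = blk i' → ∀ j j', j < j' →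
      X (i, j) * X (i', j') - X (i, j') * X (i', j) ∈ I)
    (h2 : ∀ i i', blk i = false → blk i' = true → ∑ j, X (i, j) * X (i', j) ∈ I) :
    blockIdeal blk ≤ I := by
  refine Ideal.span_le.2 ?_
  rintro _ (⟨i, i', j, j', h, rfl⟩ | ⟨i, i', h, h', rfl⟩)
  · rw [SetLike.mem_coe]
    rcases lt_trichotomy i i' with hi | rfl | hi <;> rcases lt_trichotomy j j' with hj | rfl | hj
    · exact h1 _ _ hi h _ _ hj
    · rw [sub_self]; exact zero_mem _
    · exact mem_of_eq_neg (h1 _ _ hi h _ _ hj) (by ring)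
    · rw [mul_comm, sub_self]; exact zero_mem _
    · rw [sub_self]; exact zero_mem _
    · rw [mul_comm, sub_self]; exact zero_mem _
    · exact mem_of_eq_neg (h1 _ _ hi h.symm _ _ hj) (by ring)
    · rw [sub_self]; exact zero_mem _
    · exact mem_of_eq_neg (neg_mem (h1 _ _ hi h.symm _ _ hj)) (by ring)
  · exact h2 _ _ h h'

variable (blk)

/-- Two copies of three column parameters and `m` row parameters. -/
abbrev BlockParams (m : ℕ) : Type := (Fin 3 ⊕ Fin m) ⊕ (Fin 3 ⊕ Fin m)

def blockRow (e : Fin m × Fin 3) : BlockParams m :=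
  if blk e.1 then .inr (.inr e.1) else .inl (.inr e.1)

def blockCol (e : Fin m × Fin 3) : BlockParams m :=
  if blk e.1 then .inr (.inl e.2) else .inl (.inl e.2)

abbrev blockMap : MvPolynomial (Fin m × Fin 3) ℂ →ₐ[ℂ] MvPolynomial (BlockParams m) ℂ :=
  toricMap (blockRow blk) (blockCol blk)

/-- The pairing of the two vectors of column parameters. -/
def blockForm (m : ℕ) : MvPolynomial (BlockParams m) ℂ :=
  ∑ j, X (.inl (.inl j)) * X (.inr (.inl j))

theorem killVars_blockForm (D : Finset (BlockParams m)) : killVars D (blockForm m) =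
    ∑ j with Sum.inl (Sum.inl j) ∉ D ∧ Sum.inr (Sum.inl j) ∉ D,
      X (.inl (.inl j)) * X (.inr (.inl j)) := by
  rw [blockForm, map_sum, Finset.sum_filter]
  refine Finset.sum_congr rfl fun j _ => ?_
  rw [map_mul, killVars_X, killVars_X]
  split_ifs <;> simp_all

/-- What remains of the pairing is a sum of products of disjoint pairs of variables. Only a single
remaining product would be nonzero and reducible, and this is excluded by the hypothesis. -/
theorem killVars_blockForm_eq_zero_or_prime {D : Finset (BlockParams m)}
    (h : (Finset.univ.filter fun j : Fin 3 =>
      Sum.inl (Sum.inl j) ∉ D ∧ Sum.inr (Sum.inl j) ∉ D).card ≠ 1) :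
    killVars D (blockForm m) = 0 ∨ Prime (killVars D (blockForm m)) := by
  rw [killVars_blockForm]
  generalize (Finset.univ.filter fun j : Fin 3 =>
    Sum.inl (Sum.inl j) ∉ D ∧ Sum.inr (Sum.inl j) ∉ D) = A at h ⊢
  rcases Nat.lt_or_gt_of_ne h with h | h
  · rw [Nat.lt_one_iff, Finset.card_eq_zero] at h
    simp [h]
  · right
    have := prime_sum_X_mul_X (n := Fin 3 ⊕ Fin m) (A := A.map Function.Embedding.inl)
      (by rwa [← Finset.one_lt_card_iff_nontrivial, Finset.card_map])
    rwa [Finset.sum_map] at this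

theorem toricExp_blockMap_ne_zero {M : Fin m × Fin 3 →₀ ℕ} {w : BlockParams m}
    (h : toricExp (blockRow blk) (blockCol blk) M w ≠ 0) :
    ∃ e ∈ M.support, blockRow blk e = w ∨ blockCol blk e = w := by
  classical
  have h1 : w ∈ (Finsupp.mapDomain (blockRow blk) M + Finsupp.mapDomain (blockCol blk) M).support :=
    Finsupp.mem_support_iff.2 h
  rcases Finset.mem_union.1 (Finsupp.support_add h1) with h1 | h1
  · obtain ⟨e, he, hw⟩ := Finset.mem_image.1 (Finsupp.mapDomain_support h1)
    exact ⟨e, he, Or.inl hw⟩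
  · obtain ⟨e, he, hw⟩ := Finset.mem_image.1 (Finsupp.mapDomain_support h1)
    exact ⟨e, he, Or.inr hw⟩

/-- For a monomial `w`, either none or all of the three terms of the pairing times `w` are toric
images. If one of them is, its preimage contains entries `(i, j)` and `(i', j)` from the two blocks,
and changing `j` in both gives preimages of the other terms. The sum of the preimages is then a
multiple of the orthogonality relation of the rows `i` and `i'`. -/
theorem blockMap_section_blockForm_mul
    {s : MvPolynomial (BlockParams m) ℂ →ₗ[ℂ] MvPolynomial (Fin m × Fin 3) ℂ ⧸ blockIdeal blk}
    (h1 : ∀ f, s (blockMap blk f) = Ideal.Quotient.mk _ f)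
    (h2 : ∀ w, w ∉ Set.range (toricExp (blockRow blk) (blockCol blk)) → s (monomial w 1) = 0)
    (g : MvPolynomial (BlockParams m) ℂ) : s (blockForm m * g) = 0 := by
  classical
  induction g using MvPolynomial.induction_on' with
  | add p q hp hq => rw [mul_add, map_add, hp, hq, add_zero]
  | monomial w c =>
  have hc : (monomial w c : MvPolynomial (BlockParams m) ℂ) = c • monomial w 1 := by
    rw [smul_monomial, smul_eq_mul, mul_one]
  rw [hc, mul_smul_comm, map_smul]
  suffices h : s (blockForm m * monomial w 1) = 0 by rw [h, smul_zero]
  have hX : ∀ j : Fin 3, (X (.inl (.inl j)) * X (.inr (.inl j)) * monomial w 1 :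
      MvPolynomial (BlockParams m) ℂ) =
      monomial (Finsupp.single (.inl (.inl j)) 1 + Finsupp.single (.inr (.inl j)) 1 + w) 1 := by
    intro j
    rw [X, X, monomial_mul, monomial_mul, one_mul, one_mul]
  rw [blockForm, Finset.sum_mul, map_sum]
  simp only [hX]
  by_cases h : ∃ j : Fin 3, Finsupp.single (.inl (.inl j)) 1 + Finsupp.single (.inr (.inl j)) 1 + w ∈
      Set.range (toricExp (blockRow blk) (blockCol blk))
  · obtain ⟨j, M, hM⟩ := h
    obtain ⟨⟨i, k⟩, he, he'⟩ := toricExp_blockMap_ne_zero blk (M := M) (w := .inl (.inl j))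
      (by rw [hM]; simp)
    obtain ⟨⟨i', k'⟩, hf, hf'⟩ := toricExp_blockMap_ne_zero blk (M := M) (w := .inr (.inl j))
      (by rw [hM]; simp)
    have hi : blk i = false ∧ k = j := by
      cases hb : blk i <;> simp [blockRow, blockCol, hb] at he'
      exact ⟨rfl, he'⟩
    have hi' : blk i' = true ∧ k' = j := by
      cases hb : blk i' <;> simp [blockRow, blockCol, hb] at hf'
      exact ⟨rfl, hf'⟩
    obtain ⟨hi, rfl⟩ := hi
    obtain ⟨hi', rfl⟩ := hi'
    have hne : (i, k') ≠ (i', k') := by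
      rintro h
      rw [(Prod.mk.inj h).1, hi'] at hi
      cases hi
    have hle : Finsupp.single (i, k') 1 + Finsupp.single (i', k') 1 ≤ M := by
      intro x
      rw [Finsupp.add_apply, Finsupp.single_apply, Finsupp.single_apply]
      rw [Finsupp.mem_support_iff] at he hf
      split_ifs with h3 h4 h4
      · exact absurd (h3.trans h4.symm) hne
      · subst h3; omega
      · subst h4; omega
      · omega
    obtain ⟨N, rfl⟩ := exists_add_of_le hle
    have key : ∀ j : Fin 3, Finsupp.single (.inl (.inl j)) 1 + Finsupp.single (.inr (.inl j)) 1 + w =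
        toricExp (blockRow blk) (blockCol blk)
          (Finsupp.single (i, j) 1 + Finsupp.single (i', j) 1 + N) := by
      have h5 : ∀ j : Fin 3, toricExp (blockRow blk) (blockCol blk)
          (Finsupp.single (i, j) 1 + Finsupp.single (i', j) 1 + N) =
          Finsupp.single (.inl (.inl j)) 1 + Finsupp.single (.inr (.inl j)) 1 +
          (Finsupp.single (.inl (.inr i)) 1 + Finsupp.single (.inr (.inr i')) 1 +
            toricExp (blockRow blk) (blockCol blk) N) := by
        intro j
        rw [map_add, map_add, toricExp_single, toricExp_single]
        simp only [blockRow, blockCol, hi, hi', if_true, Bool.false_eq_true, if_false]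
        abel
      rw [h5] at hM
      intro j
      rw [h5, add_left_cancel hM]
    have h6 : ∀ j : Fin 3, s (monomial (Finsupp.single (.inl (.inl j)) 1 +
        Finsupp.single (.inr (.inl j)) 1 + w) 1) =
        Ideal.Quotient.mk _ (X (i, j) * X (i', j) * monomial N 1) := by
      intro j
      rw [key, ← toricMap_monomial, h1, X, X, monomial_mul, monomial_mul, one_mul, one_mul]
    simp only [h6]
    rw [← map_sum, ← Finset.sum_mul, Ideal.Quotient.eq_zero_iff_mem]
    exact Ideal.mul_mem_right _ _ (orthogonal_mem_blockIdeal (by simp [hi, hi']))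
  · push Not at h
    exact Finset.sum_eq_zero fun j _ => h2 _ (h j)

/-- A polynomial in the orbit ideal has a toric image divisible by the pairing. The section sends
this image to zero as well as to the class of the polynomial. -/
theorem blockIdeal_eq_orbitIdeal :
    blockIdeal blk = orbitIdeal (blockMap blk) (blockForm m) ∅ := by
  apply le_antisymm
  · refine Ideal.span_le.2 ?_
    rintro _ (⟨i, i', j, j', h, rfl⟩ | ⟨i, i', h, h', rfl⟩) <;>
      rw [SetLike.mem_coe, mem_orbitIdeal, killVars_empty, AlgHom.id_apply, AlgHom.id_apply]
    · convert dvd_zero _ using 1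
      simp only [map_sub, map_mul, toricMap_X, blockRow, blockCol, h]
      split_ifs <;> ring
    · refine ⟨X (.inl (.inr i)) * X (.inr (.inr i')), ?_⟩
      simp only [map_sum, map_mul, toricMap_X, blockRow, blockCol, h, h', blockForm,
        Finset.sum_mul, if_true, Bool.false_eq_true, if_false]
      exact Finset.sum_congr rfl fun j _ => by ring
  · intro f hf
    rw [mem_orbitIdeal, killVars_empty, AlgHom.id_apply, AlgHom.id_apply] at hf
    obtain ⟨g, hg⟩ := hf
    -- The second block gets the greater row numbers and the first block the greater column numbers.
    -- Two entries of different blocks then never form a diagonal, and no straightening relation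
    -- between them is needed.
    let r : Fin m × Fin 3 → ℕ := fun e => e.1 + if blk e.1 then m else 0
    let c : Fin m × Fin 3 → ℕ := fun e => e.2 + if blk e.1 then 0 else 3
    let ρ : BlockParams m → ℕ ⊕ ℕ := Sum.elim
      (Sum.elim (fun j => .inr (j + 3)) (fun i => .inl i))
      (Sum.elim (fun j => .inr j) (fun i => .inl (i + m)))
    have hr : ∀ e f, r e = r f → e.1 = f.1 := by
      intro e f
      dsimp only [r]
      intro h
      ext
      split_ifs at h <;> omega
    have hb : ∀ e f, r e < r f → c e < c f → blk e.1 = blk f.1 := by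
      intro e f
      dsimp only [r, c]
      intro h h'
      cases h1 : blk e.1 <;> cases h2 : blk f.1 <;> simp [h1, h2] at h h' ⊢ <;> omega
    obtain ⟨s, h1, h2⟩ := exists_toricSection (blockRow blk) (blockCol blk)
      (J := blockIdeal blk) (mk_monomial_eq_of_toricExp_eq (r := r) (c := c) (ρ := ρ)
        (fun e => by cases h : blk e.1 <;> simp [blockRow, ρ, r, h])
        (fun e => by cases h : blk e.1 <;> simp [blockCol, ρ, c, h])
        (fun e f he hf => by
          have h1 := hr e f he
          refine Prod.ext h1 (Fin.ext ?_)
          simpa [c, h1] using hf)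
        (fun e f he hf => ⟨(e.1, f.2), (f.1, e.2), by simp [r], by simp [c, hb e f he hf],
          by simp [r], by simp [c, hb e f he hf], minor_mem_blockIdeal (hb e f he hf) _ _⟩))
    rw [← Ideal.Quotient.eq_zero_iff_mem, ← h1, hg]
    exact blockMap_section_blockForm_mul blk h1 h2 g

instance : (blockIdeal blk).IsPrime := by
  rw [blockIdeal_eq_orbitIdeal]
  refine orbitIdeal_isPrime (killVars_blockForm_eq_zero_or_prime ?_)
  simp

theorem orbitIdeal_block_step {D D' : Finset (BlockParams m)}
    (hD : (Finset.univ.filter fun j : Fin 3 =>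
      Sum.inl (Sum.inl j) ∉ D ∧ Sum.inr (Sum.inl j) ∉ D).card ≠ 1)
    (hD' : (Finset.univ.filter fun j : Fin 3 =>
      Sum.inl (Sum.inl j) ∉ D' ∧ Sum.inr (Sum.inl j) ∉ D').card ≠ 1)
    (h : D ⊆ D') (e : Fin m × Fin 3) (h1 : blockRow blk e ∉ D) (h2 : blockCol blk e ∉ D)
    (h3 : blockRow blk e ∈ D' ∨ blockCol blk e ∈ D') {n : ℕ}
    (hn : (n : ℕ∞) ≤ (originOf (orbitIdeal (blockMap blk) (blockForm m) D')).height) :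
    ((n + 1 : ℕ) : ℕ∞) ≤ (originOf (orbitIdeal (blockMap blk) (blockForm m) D)).height := by
  have := orbitIdeal_isPrime (φ := blockMap blk) (killVars_blockForm_eq_zero_or_prime hD)
  have := orbitIdeal_isPrime (φ := blockMap blk) (killVars_blockForm_eq_zero_or_prime hD')
  refine add_one_le_height_originOf (orbitIdeal_toric_lt h e h1 h2 h3 ?_)
    (orbitIdeal_le (fun e => by simp) (by simp [blockForm]) _) hn
  rw [killVars_blockForm, map_sum]
  refine Finset.sum_eq_zero fun j _ => ?_
  -- The test point has only one nonzero column parameter, so every product in the pairing of the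
  -- two blocks vanishes there.
  rw [map_mul, eval_X, eval_X]
  cases hb : blk e.1 <;> simp [blockRow, blockCol, hb]

variable {blk}

theorem HasChart.blockIdeal_permute {D : ℕ} {i : Fin m} {j : Fin 3}
    (h : HasChart (blockIdeal blk) D (i, j)) (π : Fin m → Fin m) (hπ : Function.Involutive π)
    (hb : ∀ i i', blk (π i) = blk (π i') ↔ blk i = blk i') (k : Fin 3) :
    HasChart (blockIdeal blk) D (π i, Equiv.swap j k j) := by
  refine h.of_involutive (fun e => (π e.1, Equiv.swap j k e.2))
    (fun e => Prod.ext (hπ _) (Equiv.swap_apply_self _ _ _)) (rename_mem_span ?_)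
  change ∀ f ∈ _, _ ∈ blockIdeal blk
  rintro _ (⟨i, i', j, j', h, rfl⟩ | ⟨i, i', h, h', rfl⟩)
  · simp only [map_sub, map_mul, rename_X]
    exact minor_mem_blockIdeal ((hb _ _).2 h) _ _
  · simp only [map_sum, map_mul, rename_X]
    rw [Equiv.sum_comp (Equiv.swap j k) (fun l => X (π i, l) * X (π i', l))]
    exact orthogonal_mem_blockIdeal (by simp [hb, h, h'])

end Block

end SchubertLCI

end

/-! ### The models of G and H. -/

noncomputable section

namespace SchubertLCI

open MvPolynomial

def blockH : Fin 4 → Bool := ![false, false, true, true]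

def blockG : Fin 3 → Bool := ![false, false, true]

theorem Fin.lt_three {j j' : Fin 3} (h : j < j') :
    j = 0 ∧ j' = 1 ∨ j = 0 ∧ j' = 2 ∨ j = 1 ∧ j' = 2 := by
  revert j j'; decide

theorem dependentOrthogonalIdealH_eq : dependentOrthogonalIdealH = blockIdeal blockH := by
  apply le_antisymm
  · refine Ideal.span_le.2 ?_
    rintro _ (rfl | rfl | rfl | rfl | rfl | rfl | rfl | rfl | rfl | rfl)
    · exact minor_mem_blockIdeal (blk := blockH) (i := 0) (i' := 1) rfl 0 1
    · exact minor_mem_blockIdeal (blk := blockH) (i := 0) (i' := 1) rfl 0 2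
    · exact minor_mem_blockIdeal (blk := blockH) (i := 0) (i' := 1) rfl 1 2
    · exact minor_mem_blockIdeal (blk := blockH) (i := 2) (i' := 3) rfl 0 1
    · exact minor_mem_blockIdeal (blk := blockH) (i := 2) (i' := 3) rfl 0 2
    · exact minor_mem_blockIdeal (blk := blockH) (i := 2) (i' := 3) rfl 1 2
    · simpa only [SetLike.mem_coe, Fin.sum_univ_three] using
        orthogonal_mem_blockIdeal (blk := blockH) (i := 0) (i' := 2) (by decide)
    · simpa only [SetLike.mem_coe, Fin.sum_univ_three] using
        orthogonal_mem_blockIdeal (blk := blockH) (i := 1) (i' := 2) (by decide)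
    · simpa only [SetLike.mem_coe, Fin.sum_univ_three] using
        orthogonal_mem_blockIdeal (blk := blockH) (i := 0) (i' := 3) (by decide)
    · simpa only [SetLike.mem_coe, Fin.sum_univ_three] using
        orthogonal_mem_blockIdeal (blk := blockH) (i := 1) (i' := 3) (by decide)
  · refine blockIdeal_le ?_ ?_
    · intro i i' hi hb j j' hj
      have key : ∀ i i', i < i' → blockH i = blockH i' → i = 0 ∧ i' = 1 ∨ i = 2 ∧ i' = 3 := by
        decide
      refine Ideal.subset_span ?_
      rcases key i i' hi hb with ⟨rfl, rfl⟩ | ⟨rfl, rfl⟩ <;>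
        rcases Fin.lt_three hj with ⟨rfl, rfl⟩ | ⟨rfl, rfl⟩ | ⟨rfl, rfl⟩ <;>
        simp only [Set.mem_insert_iff, true_or, or_true]
    · intro i i' h h'
      have key : ∀ i i', blockH i = false → blockH i' = true →
          (i = 0 ∧ i' = 2 ∨ i = 1 ∧ i' = 2) ∨ (i = 0 ∧ i' = 3 ∨ i = 1 ∧ i' = 3) := by
        decide
      rw [Fin.sum_univ_three]
      refine Ideal.subset_span ?_
      rcases key i i' h h' with (⟨rfl, rfl⟩ | ⟨rfl, rfl⟩) | ⟨rfl, rfl⟩ | ⟨rfl, rfl⟩ <;>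
        simp only [Set.mem_insert_iff, Set.mem_singleton_iff, true_or, or_true]

theorem dependentOrthogonalIdealG_eq : dependentOrthogonalIdealG = blockIdeal blockG := by
  apply le_antisymm
  · refine Ideal.span_le.2 ?_
    rintro _ (rfl | rfl | rfl | rfl | rfl)
    · exact minor_mem_blockIdeal (blk := blockG) (i := 0) (i' := 1) rfl 0 1
    · exact minor_mem_blockIdeal (blk := blockG) (i := 0) (i' := 1) rfl 0 2
    · exact minor_mem_blockIdeal (blk := blockG) (i := 0) (i' := 1) rfl 1 2
    · simpa only [SetLike.mem_coe, Fin.sum_univ_three] using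
        orthogonal_mem_blockIdeal (blk := blockG) (i := 0) (i' := 2) (by decide)
    · simpa only [SetLike.mem_coe, Fin.sum_univ_three] using
        orthogonal_mem_blockIdeal (blk := blockG) (i := 1) (i' := 2) (by decide)
  · refine blockIdeal_le ?_ ?_
    · intro i i' hi hb j j' hj
      have key : ∀ i i', i < i' → blockG i = blockG i' → i = 0 ∧ i' = 1 := by
        decide
      refine Ideal.subset_span ?_
      obtain ⟨rfl, rfl⟩ := key i i' hi hb
      rcases Fin.lt_three hj with ⟨rfl, rfl⟩ | ⟨rfl, rfl⟩ | ⟨rfl, rfl⟩ <;>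
        simp only [Set.mem_insert_iff, true_or, or_true]
    · intro i i' h h'
      have key : ∀ i i', blockG i = false → blockG i' = true →
          i = 0 ∧ i' = 2 ∨ i = 1 ∧ i' = 2 := by
        decide
      rw [Fin.sum_univ_three]
      refine Ideal.subset_span ?_
      rcases key i i' h h' with ⟨rfl, rfl⟩ | ⟨rfl, rfl⟩ <;>
        simp only [Set.mem_insert_iff, Set.mem_singleton_iff, true_or, or_true]

/-- One row parameter of each block is set to zero, then the column parameters of the first block,
then those of the second. The second and third column parameters of the first block have to go in
one step: killing only one of them would leave a single, reducible product in the pairing. -/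
theorem le_height_blockH : ((7 : ℕ) : ℕ∞) ≤ (originOf (blockIdeal blockH)).height := by
  rw [blockIdeal_eq_orbitIdeal]
  refine orbitIdeal_block_step _ (D' := {.inl (.inr 0)}) (by decide) (by decide) (by decide)
    (0, 0) (by decide) (by decide) (by decide) ?_
  refine orbitIdeal_block_step _ (D' := {.inl (.inr 0), .inr (.inr 2)}) (by decide) (by decide)
    (by decide) (2, 0) (by decide) (by decide) (by decide) ?_
  refine orbitIdeal_block_step _ (D' := {.inl (.inr 0), .inr (.inr 2), .inl (.inl 0)}) (by decide)
    (by decide) (by decide) (1, 0) (by decide) (by decide) (by decide) ?_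
  refine orbitIdeal_block_step _ (D' := {.inl (.inr 0), .inr (.inr 2), .inl (.inl 0),
    .inl (.inl 1), .inl (.inl 2)}) (by decide)
    (by decide) (by decide) (1, 1) (by decide) (by decide) (by decide) ?_
  refine orbitIdeal_block_step _ (D' := {.inl (.inr 0), .inr (.inr 2), .inl (.inl 0),
    .inl (.inl 1), .inl (.inl 2), .inr (.inl 0)}) (by decide)
    (by decide) (by decide) (3, 0) (by decide) (by decide) (by decide) ?_
  refine orbitIdeal_block_step _ (D' := {.inl (.inr 0), .inr (.inr 2), .inl (.inl 0),
    .inl (.inl 1), .inl (.inl 2), .inr (.inl 0), .inr (.inl 1)}) (by decide)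
    (by decide) (by decide) (3, 1) (by decide) (by decide) (by decide) ?_
  exact orbitIdeal_block_step _ (D' := {.inl (.inr 0), .inr (.inr 2), .inl (.inl 0),
    .inl (.inl 1), .inl (.inl 2), .inr (.inl 0), .inr (.inl 1), .inr (.inl 2)}) (by decide)
    (by decide) (by decide) (3, 2) (by decide) (by decide) (by decide) (n := 0) (by simp)

/-- The same chain without the step for a row parameter of the second block, which has only one row.
-/
theorem le_height_blockG : ((6 : ℕ) : ℕ∞) ≤ (originOf (blockIdeal blockG)).height := by
  rw [blockIdeal_eq_orbitIdeal]
  refine orbitIdeal_block_step _ (D' := {.inl (.inr 0)}) (by decide) (by decide) (by decide)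
    (0, 0) (by decide) (by decide) (by decide) ?_
  refine orbitIdeal_block_step _ (D' := {.inl (.inr 0), .inl (.inl 0)}) (by decide)
    (by decide) (by decide) (1, 0) (by decide) (by decide) (by decide) ?_
  refine orbitIdeal_block_step _ (D' := {.inl (.inr 0), .inl (.inl 0),
    .inl (.inl 1), .inl (.inl 2)}) (by decide)
    (by decide) (by decide) (1, 1) (by decide) (by decide) (by decide) ?_
  refine orbitIdeal_block_step _ (D' := {.inl (.inr 0), .inl (.inl 0),
    .inl (.inl 1), .inl (.inl 2), .inr (.inl 0)}) (by decide)
    (by decide) (by decide) (2, 0) (by decide) (by decide) (by decide) ?_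
  refine orbitIdeal_block_step _ (D' := {.inl (.inr 0), .inl (.inl 0),
    .inl (.inl 1), .inl (.inl 2), .inr (.inl 0), .inr (.inl 1)}) (by decide)
    (by decide) (by decide) (2, 1) (by decide) (by decide) (by decide) ?_
  exact orbitIdeal_block_step _ (D' := {.inl (.inr 0), .inl (.inl 0),
    .inl (.inl 1), .inl (.inl 2), .inr (.inl 0), .inr (.inl 1), .inr (.inl 2)}) (by decide)
    (by decide) (by decide) (2, 2) (by decide) (by decide) (by decide) (n := 0) (by simp)

theorem orthogonal_mem_quadrics {m : ℕ} (i i' : Fin m) :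
    (X (i, 0) * X (i', 0) + X (i, 1) * X (i', 1) + X (i, 2) * X (i', 2) :
      MvPolynomial (Fin m × Fin 3) ℂ) ∈ quadrics (Fin m × Fin 3) :=
  add_mem (add_mem (X_mul_X_mem_quadrics _ _) (X_mul_X_mem_quadrics _ _))
    (X_mul_X_mem_quadrics _ _)

/-- Where the entry `(0, 0)` is invertible, row `1` is a multiple of row `0`, and the first entries
of rows `2` and `3` are found from orthogonality to row `0`. The dependence of rows `2` and `3` is
left as one minor in their last two columns. -/
theorem hasChart_blockH_zero : HasChart (blockIdeal blockH) 7 (0, 0) := by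
  have hm : ∀ {i i' : Fin 4} (_ : blockH i = blockH i') (j j' : Fin 3), _ :=
    minor_mem_blockIdeal (blk := blockH)
  have ho : ∀ {i i' : Fin 4} (_ : blockH i ≠ blockH i'), _ :=
    orthogonal_mem_blockIdeal (blk := blockH)
  rw [← dependentOrthogonalIdealH_eq] at hm ho ⊢
  simp only [Fin.sum_univ_three] at ho
  refine HasChart.of_subst ?_ (τ := Fin 8)
    ![(0, 0), (0, 1), (0, 2), (1, 0), (2, 1), (2, 2), (3, 1), (3, 2)] 0
    (q := X 4 * X 7 - X 5 * X 6)
    (Or.inr ⟨prime_X_mul_X_sub (by decide) (by decide) (by decide) (by decide) (by decide),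
      rfl⟩) ?_ ?_ (fun e => ![![X 0 * X 0, X 1 * X 0, X 2 * X 0],
      ![X 3 * X 0, X 1 * X 3, X 2 * X 3], ![-(X 1 * X 4 + X 2 * X 5), X 4 * X 0, X 5 * X 0],
      ![-(X 1 * X 6 + X 2 * X 7), X 6 * X 0, X 7 * X 0]] e.1 e.2) ?_ ?_ ?_
  · rintro _ (rfl | rfl | rfl | rfl | rfl | rfl | rfl | rfl | rfl | rfl)
    iterate 6 exact sub_mem (X_mul_X_mem_quadrics _ _) (X_mul_X_mem_quadrics _ _)
    all_goals exact orthogonal_mem_quadrics _ _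
  · rintro ⟨f, hf⟩
    simpa using congrArg (eval (fun i : Fin 8 => if i = 0 then (1 : ℂ) else 0)) hf
  · change _ ∈ dependentOrthogonalIdealH
    simpa using hm (i := 2) (i' := 3) rfl 1 2
  · intro t; fin_cases t <;> rfl
  · rintro ⟨i, j⟩
    change _ ∈ dependentOrthogonalIdealH
    fin_cases i <;> fin_cases j <;> simp
    · rw [mul_comm, sub_self]; exact zero_mem _
    · rw [mul_comm, sub_self]; exact zero_mem _
    · rw [mul_comm, sub_self]; exact zero_mem _
    · exact hm (i := 0) (i' := 1) rfl 0 1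
    · exact hm (i := 0) (i' := 1) rfl 0 2
    · exact mem_of_eq_neg (neg_mem (ho (i := 0) (i' := 2) (by decide))) (by ring)
    · rw [mul_comm, sub_self]; exact zero_mem _
    · rw [mul_comm, sub_self]; exact zero_mem _
    · exact mem_of_eq_neg (neg_mem (ho (i := 0) (i' := 3) (by decide))) (by ring)
    · rw [mul_comm, sub_self]; exact zero_mem _
    · rw [mul_comm, sub_self]; exact zero_mem _
  · rintro _ (rfl | rfl | rfl | rfl | rfl | rfl | rfl | rfl | rfl | rfl) <;>
      simp only [map_sub, map_add, map_mul, aeval_X, Matrix.cons_val]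
    · exact ⟨0, by ring⟩
    · exact ⟨0, by ring⟩
    · exact ⟨0, by ring⟩
    · exact ⟨X 0 * X 2, by ring⟩
    · exact ⟨-(X 0 * X 1), by ring⟩
    · exact ⟨X 0 * X 0, by ring⟩
    all_goals exact ⟨0, by ring⟩

theorem hasChart_blockG_zero : HasChart (blockIdeal blockG) 6 (0, 0) := by
  have hm : ∀ {i i' : Fin 3} (_ : blockG i = blockG i') (j j' : Fin 3), _ :=
    minor_mem_blockIdeal (blk := blockG)
  have ho : ∀ {i i' : Fin 3} (_ : blockG i ≠ blockG i'), _ :=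
    orthogonal_mem_blockIdeal (blk := blockG)
  rw [← dependentOrthogonalIdealG_eq] at hm ho ⊢
  simp only [Fin.sum_univ_three] at ho
  refine HasChart.of_subst ?_ (τ := Fin 6)
    ![(0, 0), (0, 1), (0, 2), (1, 0), (2, 1), (2, 2)] 0
    (q := 0) (Or.inl ⟨rfl, rfl⟩) ?_ ?_ (fun e => ![![X 0 * X 0, X 1 * X 0, X 2 * X 0],
      ![X 3 * X 0, X 1 * X 3, X 2 * X 3], ![-(X 1 * X 4 + X 2 * X 5), X 4 * X 0, X 5 * X 0]]
      e.1 e.2) ?_ ?_ ?_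
  · rintro _ (rfl | rfl | rfl | rfl | rfl)
    iterate 3 exact sub_mem (X_mul_X_mem_quadrics _ _) (X_mul_X_mem_quadrics _ _)
    all_goals exact orthogonal_mem_quadrics _ _
  · rw [zero_dvd_iff]; exact X_ne_zero _
  · rw [map_zero]; exact Ideal.zero_mem _
  · intro t; fin_cases t <;> rfl
  · rintro ⟨i, j⟩
    change _ ∈ dependentOrthogonalIdealG
    fin_cases i <;> fin_cases j <;> simp
    · rw [mul_comm, sub_self]; exact zero_mem _
    · rw [mul_comm, sub_self]; exact zero_mem _
    · rw [mul_comm, sub_self]; exact zero_mem _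
    · exact hm (i := 0) (i' := 1) rfl 0 1
    · exact hm (i := 0) (i' := 1) rfl 0 2
    · exact mem_of_eq_neg (neg_mem (ho (i := 0) (i' := 2) (by decide))) (by ring)
    · rw [mul_comm, sub_self]; exact zero_mem _
    · rw [mul_comm, sub_self]; exact zero_mem _
  · rintro _ (rfl | rfl | rfl | rfl | rfl) <;>
      simp only [map_sub, map_add, map_mul, aeval_X, Matrix.cons_val]
    all_goals exact ⟨0, by ring⟩

/-- Orthogonality to row `2` determines the first entries of rows `0` and `1`. Their dependence is
left as one minor in the last two columns. -/
theorem hasChart_blockG_two : HasChart (blockIdeal blockG) 6 (2, 0) := by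
  have hm : ∀ {i i' : Fin 3} (_ : blockG i = blockG i') (j j' : Fin 3), _ :=
    minor_mem_blockIdeal (blk := blockG)
  have ho : ∀ {i i' : Fin 3} (_ : blockG i ≠ blockG i'), _ :=
    orthogonal_mem_blockIdeal (blk := blockG)
  rw [← dependentOrthogonalIdealG_eq] at hm ho ⊢
  simp only [Fin.sum_univ_three] at ho
  refine HasChart.of_subst ?_ (τ := Fin 7)
    ![(0, 1), (0, 2), (1, 1), (1, 2), (2, 0), (2, 1), (2, 2)] 4
    (q := X 0 * X 3 - X 1 * X 2)
    (Or.inr ⟨prime_X_mul_X_sub (by decide) (by decide) (by decide) (by decide) (by decide),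
      rfl⟩) ?_ ?_ (fun e => ![![-(X 0 * X 5 + X 1 * X 6), X 0 * X 4, X 1 * X 4],
      ![-(X 2 * X 5 + X 3 * X 6), X 2 * X 4, X 3 * X 4], ![X 4 * X 4, X 5 * X 4, X 6 * X 4]]
      e.1 e.2) ?_ ?_ ?_
  · rintro _ (rfl | rfl | rfl | rfl | rfl)
    iterate 3 exact sub_mem (X_mul_X_mem_quadrics _ _) (X_mul_X_mem_quadrics _ _)
    all_goals exact orthogonal_mem_quadrics _ _
  · rintro ⟨f, hf⟩
    simpa using congrArg (eval (fun i : Fin 7 => if i = 4 then (1 : ℂ) else 0)) hf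
  · change _ ∈ dependentOrthogonalIdealG
    simpa using hm (i := 0) (i' := 1) rfl 1 2
  · intro t; fin_cases t <;> rfl
  · rintro ⟨i, j⟩
    change _ ∈ dependentOrthogonalIdealG
    fin_cases i <;> fin_cases j <;> simp
    · exact mem_of_eq_neg (neg_mem (ho (i := 0) (i' := 2) (by decide))) (by ring)
    · rw [mul_comm, sub_self]; exact zero_mem _
    · rw [mul_comm, sub_self]; exact zero_mem _
    · exact mem_of_eq_neg (neg_mem (ho (i := 1) (i' := 2) (by decide))) (by ring)
    · rw [mul_comm, sub_self]; exact zero_mem _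
    · rw [mul_comm, sub_self]; exact zero_mem _
    · rw [mul_comm, sub_self]; exact zero_mem _
    · rw [mul_comm, sub_self]; exact zero_mem _
  · rintro _ (rfl | rfl | rfl | rfl | rfl) <;>
      simp only [map_sub, map_add, map_mul, aeval_X, Matrix.cons_val]
    · exact ⟨X 4 * X 6, by ring⟩
    · exact ⟨-(X 4 * X 5), by ring⟩
    · exact ⟨X 4 * X 4, by ring⟩
    all_goals exact ⟨0, by ring⟩

theorem hasChart_blockH (e : Fin 4 × Fin 3) : HasChart (blockIdeal blockH) 7 e := by
  obtain ⟨i, k⟩ := e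
  have h : ∀ π : Fin 4 → Fin 4, Function.Involutive π →
      (∀ i i', blockH (π i) = blockH (π i') ↔ blockH i = blockH i') →
      HasChart (blockIdeal blockH) 7 (π 0, k) := by
    intro π hπ hb
    simpa using hasChart_blockH_zero.blockIdeal_permute π hπ hb k
  fin_cases i
  · exact h id (fun _ => rfl) (fun _ _ => Iff.rfl)
  · exact h ![1, 0, 2, 3] (fun i => by fin_cases i <;> rfl) (by decide)
  · exact h ![2, 3, 0, 1] (fun i => by fin_cases i <;> rfl) (by decide)
  · exact h ![3, 2, 1, 0] (fun i => by fin_cases i <;> rfl) (by decide)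

theorem hasChart_blockG (e : Fin 3 × Fin 3) : HasChart (blockIdeal blockG) 6 e := by
  obtain ⟨i, k⟩ := e
  fin_cases i
  · simpa using hasChart_blockG_zero.blockIdeal_permute id (fun _ => rfl) (fun _ _ => Iff.rfl) k
  · simpa using hasChart_blockG_zero.blockIdeal_permute ![1, 0, 2]
      (fun i => by fin_cases i <;> rfl) (by decide) k
  · simpa using hasChart_blockG_two.blockIdeal_permute id (fun _ => rfl) (fun _ _ => Iff.rfl) k

/-- The diagonal monomials of the minors and the first-column monomials of the pairings occur in one
equation each. -/
def generatorsH : QuadricGenerators dependentOrthogonalIdealH (Fin 10) := by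
  refine .ofLeading ![s((0, 0), (1, 1)), s((0, 0), (1, 2)), s((0, 1), (1, 2)),
    s((2, 0), (3, 1)), s((2, 0), (3, 2)), s((2, 1), (3, 2)),
    s((0, 0), (2, 0)), s((1, 0), (2, 0)), s((0, 0), (3, 0)), s((1, 0), (3, 0))] (by decide)
    ![-(X (0, 1) * X (1, 0)), -(X (0, 2) * X (1, 0)), -(X (0, 2) * X (1, 1)),
      -(X (2, 1) * X (3, 0)), -(X (2, 2) * X (3, 0)), -(X (2, 2) * X (3, 1)),
      X (0, 1) * X (2, 1) + X (0, 2) * X (2, 2), X (1, 1) * X (2, 1) + X (1, 2) * X (2, 2),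
      X (0, 1) * X (3, 1) + X (0, 2) * X (3, 2), X (1, 1) * X (3, 1) + X (1, 2) * X (3, 2)] ?_ ?_
  · intro l
    fin_cases l
    iterate 6 exact neg_mem (X_mul_X_mem_span (by decide))
    all_goals exact add_mem (X_mul_X_mem_span (by decide)) (X_mul_X_mem_span (by decide))
  · apply le_antisymm
    · refine Ideal.span_le.2 ?_
      rintro _ (rfl | rfl | rfl | rfl | rfl | rfl | rfl | rfl | rfl | rfl)
      · exact Ideal.subset_span ⟨0, (sub_eq_add_neg _ _).symm⟩
      · exact Ideal.subset_span ⟨1, (sub_eq_add_neg _ _).symm⟩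
      · exact Ideal.subset_span ⟨2, (sub_eq_add_neg _ _).symm⟩
      · exact Ideal.subset_span ⟨3, (sub_eq_add_neg _ _).symm⟩
      · exact Ideal.subset_span ⟨4, (sub_eq_add_neg _ _).symm⟩
      · exact Ideal.subset_span ⟨5, (sub_eq_add_neg _ _).symm⟩
      · exact Ideal.subset_span ⟨6, (add_assoc _ _ _).symm⟩
      · exact Ideal.subset_span ⟨7, (add_assoc _ _ _).symm⟩
      · exact Ideal.subset_span ⟨8, (add_assoc _ _ _).symm⟩
      · exact Ideal.subset_span ⟨9, (add_assoc _ _ _).symm⟩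
    · refine Ideal.span_le.2 ?_
      rintro _ ⟨l, rfl⟩
      refine Ideal.subset_span ?_
      fin_cases l
      · exact Or.inl ((sub_eq_add_neg _ _).symm)
      · exact Or.inr (Or.inl ((sub_eq_add_neg _ _).symm))
      · exact Or.inr (Or.inr (Or.inl ((sub_eq_add_neg _ _).symm)))
      · exact Or.inr (Or.inr (Or.inr (Or.inl ((sub_eq_add_neg _ _).symm))))
      · exact Or.inr (Or.inr (Or.inr (Or.inr (Or.inl ((sub_eq_add_neg _ _).symm)))))
      · exact Or.inr (Or.inr (Or.inr (Or.inr (Or.inr (Or.inl ((sub_eq_add_neg _ _).symm))))))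
      · exact Or.inr (Or.inr (Or.inr (Or.inr (Or.inr (Or.inr (Or.inl ((add_assoc _ _ _).symm)))))))
      · exact Or.inr (Or.inr (Or.inr (Or.inr (Or.inr (Or.inr (Or.inr (Or.inl ((add_assoc _ _ _).symm))))))))
      · exact Or.inr (Or.inr (Or.inr (Or.inr (Or.inr (Or.inr (Or.inr (Or.inr (Or.inl ((add_assoc _ _ _).symm)))))))))
      · exact Or.inr (Or.inr (Or.inr (Or.inr (Or.inr (Or.inr (Or.inr (Or.inr (Or.inr (add_assoc _ _ _).symm))))))))

def generatorsG : QuadricGenerators dependentOrthogonalIdealG (Fin 5) := by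
  refine .ofLeading ![s((0, 0), (1, 1)), s((0, 0), (1, 2)), s((0, 1), (1, 2)),
    s((0, 0), (2, 0)), s((1, 0), (2, 0))] (by decide)
    ![-(X (0, 1) * X (1, 0)), -(X (0, 2) * X (1, 0)), -(X (0, 2) * X (1, 1)),
      X (0, 1) * X (2, 1) + X (0, 2) * X (2, 2), X (1, 1) * X (2, 1) + X (1, 2) * X (2, 2)] ?_ ?_
  · intro l
    fin_cases l
    iterate 3 exact neg_mem (X_mul_X_mem_span (by decide))
    all_goals exact add_mem (X_mul_X_mem_span (by decide)) (X_mul_X_mem_span (by decide))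
  · apply le_antisymm
    · refine Ideal.span_le.2 ?_
      rintro _ (rfl | rfl | rfl | rfl | rfl)
      · exact Ideal.subset_span ⟨0, (sub_eq_add_neg _ _).symm⟩
      · exact Ideal.subset_span ⟨1, (sub_eq_add_neg _ _).symm⟩
      · exact Ideal.subset_span ⟨2, (sub_eq_add_neg _ _).symm⟩
      · exact Ideal.subset_span ⟨3, (add_assoc _ _ _).symm⟩
      · exact Ideal.subset_span ⟨4, (add_assoc _ _ _).symm⟩
    · refine Ideal.span_le.2 ?_
      rintro _ ⟨l, rfl⟩
      refine Ideal.subset_span ?_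
      fin_cases l
      · exact Or.inl ((sub_eq_add_neg _ _).symm)
      · exact Or.inr (Or.inl ((sub_eq_add_neg _ _).symm))
      · exact Or.inr (Or.inr (Or.inl ((sub_eq_add_neg _ _).symm)))
      · exact Or.inr (Or.inr (Or.inr (Or.inl ((add_assoc _ _ _).symm))))
      · exact Or.inr (Or.inr (Or.inr (Or.inr (add_assoc _ _ _).symm)))

theorem isQuadricCone_dependentOrthogonalIdealH :
    IsQuadricCone dependentOrthogonalIdealH 7 10 where
  isPrime := by rw [dependentOrthogonalIdealH_eq]; infer_instance
  generators := ⟨_, _, rfl, ⟨generatorsH⟩⟩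
  le_height := by rw [dependentOrthogonalIdealH_eq]; exact le_height_blockH
  chart := by rw [dependentOrthogonalIdealH_eq]; exact hasChart_blockH

theorem isQuadricCone_dependentOrthogonalIdealG :
    IsQuadricCone dependentOrthogonalIdealG 6 5 where
  isPrime := by rw [dependentOrthogonalIdealG_eq]; infer_instance
  generators := ⟨_, _, rfl, ⟨generatorsG⟩⟩
  le_height := by rw [dependentOrthogonalIdealG_eq]; exact le_height_blockG
  chart := by rw [dependentOrthogonalIdealG_eq]; exact hasChart_blockG

end SchubertLCI

end

/-! ### Schubert varieties: rank conditions, and recognition of the coordinate ring. -/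

noncomputable section

namespace SchubertLCI

open Matrix MvPolynomial

section Schubert

variable {n : ℕ} {u v : Equiv.Perm (Fin n)}

theorem coe_cellPoint (z : diagram u → ℂ) :
    (cellPoint u z : Matrix (Fin n) (Fin n) ℂ) = cellMatrix u z := rfl

theorem coe_permMatrixGL : (permMatrixGL v : Matrix (Fin n) (Fin n) ℂ) =
    Matrix.of fun p q => if p = v q then (1 : ℂ) else 0 := rfl

theorem mul_permMatrixGL_apply (A : Matrix (Fin n) (Fin n) ℂ) (p q : Fin n) :
    (A * (permMatrixGL v : Matrix (Fin n) (Fin n) ℂ)) p q = A p (v q) := by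
  rw [coe_permMatrixGL, Matrix.mul_apply]
  simp

/-- The rank conditions on Schubert varieties: the submatrix with the rows from `p` on and the
columns up to `q` has at most the rank that it has for the permutation matrix of `v`. -/
theorem det_submatrix_eq_zero_of_mem_schubertVariety {g : GL (Fin n) ℂ}
    (hg : (QuotientGroup.mk g : FlagVariety n) ∈ schubertVariety v) {k : ℕ}
    (R C : Fin k → Fin n) (p q : Fin n) (hR : ∀ i, p ≤ R i) (hC : ∀ j, C j ≤ q)
    (h : (Finset.univ.filter fun j => j ≤ q ∧ p ≤ v j).card < k) :
    ((g : Matrix (Fin n) (Fin n) ℂ).submatrix R C).det = 0 := by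
  -- The minor is required to vanish for all representatives of the coset; the equations in `G` are
  -- therefore indexed by the elements of `B`.
  let Z : Set (FlagVariety n) := {x | ∀ g : GL (Fin n) ℂ, QuotientGroup.mk g = x →
    ((g : Matrix (Fin n) (Fin n) ℂ).submatrix R C).det = 0}
  have hZ : IsZariskiClosed Z := by
    refine ⟨{f | ∃ b ∈ upperBorel n, f = ((Matrix.of fun i j =>
      ∑ l, X (i, l) * MvPolynomial.C ((b : Matrix (Fin n) (Fin n) ℂ) l j) :
        Matrix (Fin n) (Fin n) (MvPolynomial (Fin n × Fin n) ℂ)).submatrix R C).det}, fun g => ?_⟩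
    have key : ∀ b : GL (Fin n) ℂ, eval (fun p => (g : Matrix (Fin n) (Fin n) ℂ) p.1 p.2)
        (((Matrix.of fun i j => ∑ l, X (i, l) * MvPolynomial.C ((b : Matrix (Fin n) (Fin n) ℂ) l j) :
          Matrix (Fin n) (Fin n) (MvPolynomial (Fin n × Fin n) ℂ)).submatrix R C).det) =
        (((g * b : GL (Fin n) ℂ) : Matrix (Fin n) (Fin n) ℂ).submatrix R C).det := by
      intro b
      rw [RingHom.map_det]
      congr 1
      ext i j
      simp [Matrix.mul_apply]
    constructor
    · rintro hg _ ⟨b, hb, rfl⟩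
      rw [key]
      refine hg _ ?_
      rw [QuotientGroup.eq]
      simpa using inv_mem hb
    · rintro hg g' hg'
      rw [eq_comm, QuotientGroup.eq] at hg'
      have := hg _ ⟨_, hg', rfl⟩
      rwa [key, mul_inv_cancel_left] at this
  have hcell : schubertCell v ⊆ Z := by
    rintro _ ⟨b, rfl⟩ g' hg'
    have hg'' : (QuotientGroup.mk g' : FlagVariety n) = QuotientGroup.mk (b.1 * permMatrixGL v) :=
      hg'
    rw [eq_comm, QuotientGroup.eq] at hg''
    obtain ⟨b', hb', rfl⟩ : ∃ b' ∈ upperBorel n, g' = b.1 * permMatrixGL v * b' :=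
      ⟨_, hg'', by group⟩
    -- By triangularity of `b` and `b'` this submatrix of the product factors through the indices in
    -- `S`, of which there are fewer than `k`.
    let S := Finset.univ.filter fun j => j ≤ q ∧ p ≤ v j
    let A : Matrix (Fin k) S ℂ := Matrix.of fun i j => (b.1 : Matrix (Fin n) (Fin n) ℂ) (R i) (v j)
    let B : Matrix S (Fin k) ℂ := Matrix.of fun j l => (b' : Matrix (Fin n) (Fin n) ℂ) j (C l)
    have hAB : ((b.1 * permMatrixGL v * b' : GL (Fin n) ℂ) : Matrix (Fin n) (Fin n) ℂ).submatrix
        R C = A * B := by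
      ext i l
      rw [submatrix_apply, Matrix.mul_apply, Units.val_mul, Units.val_mul, Matrix.mul_apply]
      simp only [mul_permMatrixGL_apply]
      rw [← Finset.sum_subset (Finset.subset_univ S)]
      · exact (Finset.sum_coe_sort S fun j => (b.1 : Matrix (Fin n) (Fin n) ℂ) (R i) (v j) *
          (b' : Matrix (Fin n) (Fin n) ℂ) j (C l)).symm
      · intro j _ hj
        simp only [S, Finset.mem_filter, Finset.mem_univ, true_and, not_and_or, not_le] at hj
        rcases hj with hj | hj
        · rw [show (b' : Matrix (Fin n) (Fin n) ℂ) j (C l) = 0 from hb' ((hC l).trans_lt hj),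
            mul_zero]
        · rw [show (b.1 : Matrix (Fin n) (Fin n) ℂ) (R i) (v j) = 0 from
            b.2 (hj.trans_le (hR i)), zero_mul]
    rw [hAB]
    by_contra hdet
    have h1 : (A * B).rank = k := by
      rw [rank_of_isUnit _ ((isUnit_iff_isUnit_det _).2 (Ne.isUnit hdet)), Fintype.card_fin]
    have h2 := (rank_mul_le_left A B).trans (rank_le_card_width A)
    rw [h1, Fintype.card_coe] at h2
    exact absurd h2 (not_le.2 h)
  exact hg Z ⟨hZ, hcell⟩ g rfl

/-- Permuting the columns of the cell matrix by `u` makes it lower triangular. -/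
theorem cellPoint_mem_oppositeCell (z : diagram u → ℂ) :
    (QuotientGroup.mk (cellPoint u z) : FlagVariety n) ∈ oppositeCell u := by
  have hdet : ((cellMatrix u z).submatrix id u.symm).det ≠ 0 := by
    rw [det_permute']
    exact mul_ne_zero (by simp) (det_cellMatrix_ne_zero u z)
  let L : GL (Fin n) ℂ := GeneralLinearGroup.mkOfDetNeZero _ hdet
  have hL : L ∈ lowerBorel n := by
    intro i j hij
    have hij' : i < j := hij
    change cellMatrix u z i (u.symm j) = 0
    have : ¬ j < i := not_lt.2 hij'.le
    simp [cellMatrix, diagram, this, hij'.ne]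
  refine ⟨⟨L, hL⟩, ?_⟩
  change (QuotientGroup.mk (L * permMatrixGL u) : FlagVariety n) = _
  congr 1
  ext p q
  rw [Units.val_mul, mul_permMatrixGL_apply]
  change cellMatrix u z p (u.symm (u q)) = cellMatrix u z p q
  rw [Equiv.symm_apply_apply]

/-- A certificate for `g ∈ BvB`: upper triangular column operations `C` after which column `q`
vanishes below row `v q`, so that `g C` is an upper triangular matrix times the permutation matrix
of `v`. -/
theorem mk_mem_schubertCell_of_mul {g : GL (Fin n) ℂ} (C : Matrix (Fin n) (Fin n) ℂ)
    (hC : ∀ k q, q < k → C k q = 0) (hC' : ∀ q, C q q ≠ 0)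
    (h : ∀ q p, v q < p → ((g : Matrix (Fin n) (Fin n) ℂ) * C) p q = 0) :
    (QuotientGroup.mk g : FlagVariety n) ∈ schubertCell v := by
  have hdet : C.det ≠ 0 := by
    rw [det_of_isUpperTriangular (fun k q hkq => hC k q hkq)]
    exact Finset.prod_ne_zero_iff.2 fun q _ => hC' q
  let c : GL (Fin n) ℂ := GeneralLinearGroup.mkOfDetNeZero C hdet
  have hc : c ∈ upperBorel n := fun k q hkq => hC k q hkq
  have hb : g * c * (permMatrixGL v)⁻¹ ∈ upperBorel n := by
    set b := g * c * (permMatrixGL v)⁻¹ with hb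
    intro p r hpr
    have h1 := h (v.symm r) p (by simpa using hpr)
    have h2 : g * c = b * permMatrixGL v := by rw [hb]; group
    have h3 : ((g : Matrix (Fin n) (Fin n) ℂ) * C) = ((g * c : GL (Fin n) ℂ) : Matrix _ _ ℂ) := rfl
    rwa [h3, h2, Units.val_mul, mul_permMatrixGL_apply, Equiv.apply_symm_apply] at h1
  refine ⟨⟨_, hb⟩, ?_⟩
  change (QuotientGroup.mk (g * c * (permMatrixGL v)⁻¹ * permMatrixGL v) : FlagVariety n) = _
  rw [inv_mul_cancel_right, eq_comm, QuotientGroup.eq, inv_mul_cancel_left]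
  exact hc

theorem schubertCell_subset_schubertVariety : schubertCell v ⊆ schubertVariety v :=
  Set.subset_sInter fun _ hZ => hZ.2

/-- Kazhdan-Lusztig varieties that are given in some of the coordinates, up to signs, by a prime
ideal. It is enough that a dense open set of points lies on the Schubert cell. -/
theorem exists_klRing_equiv {σ : Type} [Fintype σ] {J : Ideal (MvPolynomial σ ℂ)} [J.IsPrime]
    {w₀ : MvPolynomial σ ℂ} (hw₀ : w₀ ∉ J) (ι : σ → diagram u) (hι : Function.Injective ι) (s : σ → ℂ)
    (hs : ∀ i, s i * s i = 1)
    (hzero : ∀ z, (QuotientGroup.mk (cellPoint u z) : FlagVariety n) ∈ schubertVariety v →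
      ∀ b, (∀ i, ι i ≠ b) → z b = 0)
    (hJ : ∀ z, (QuotientGroup.mk (cellPoint u z) : FlagVariety n) ∈ schubertVariety v →
      (fun i => s i * z (ι i)) ∈ zeroLocus ℂ J)
    (hgen : ∀ z, (∀ b, (∀ i, ι i ≠ b) → z b = 0) → (fun i => s i * z (ι i)) ∈ zeroLocus ℂ J →
      eval (fun i => s i * z (ι i)) w₀ ≠ 0 →
      (QuotientGroup.mk (cellPoint u z) : FlagVariety n) ∈ schubertCell v) :
    ∃ e : KLRing u v ≃ₐ[ℂ] MvPolynomial σ ℂ ⧸ J, (originIdeal u v).map e = originOf J := by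
  classical
  let F : diagram u → MvPolynomial σ ℂ := fun b =>
    if h : ∃ i, ι i = b then C (s h.choose) * X h.choose else 0
  have hF : ∀ i, F (ι i) = C (s i) * X i := by
    intro i
    have h : ∃ j, ι j = ι i := ⟨i, rfl⟩
    simp only [F, dif_pos h, hι h.choose_spec]
  have hF0 : ∀ b, (∀ i, ι i ≠ b) → F b = 0 := by
    intro b hb
    exact dif_neg (by simpa using hb)
  let Ψ : MvPolynomial (diagram u) ℂ →ₐ[ℂ] MvPolynomial σ ℂ := aeval F
  have hΨX : ∀ b, Ψ (X b) = F b := fun b => aeval_X _ b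
  have hΨ : Function.Surjective Ψ := by
    rw [← AlgHom.range_eq_top, eq_top_iff, ← MvPolynomial.adjoin_range_X, Algebra.adjoin_le_iff]
    rintro _ ⟨i, rfl⟩
    refine ⟨C (s i) * X (ι i), ?_⟩
    change Ψ _ = _
    rw [map_mul, hΨX, hF, algHom_C, ← mul_assoc]
    change C (s i) * C (s i) * X i = X i
    rw [← C_mul, hs, C_1, one_mul]
  have hker : klIdeal u v = RingHom.ker ((Ideal.Quotient.mkₐ ℂ J).comp Ψ) := by
    ext f
    rw [RingHom.mem_ker, AlgHom.comp_apply, Ideal.Quotient.mkₐ_eq_mk, Ideal.Quotient.eq_zero_iff_mem]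
    have heval : ∀ (w : σ → ℂ), aeval w (Ψ f) = aeval (fun b => aeval w (F b)) f := by
      intro w
      have : (aeval w).comp Ψ = aeval (fun b => aeval w (F b)) := by
        ext b
        rw [AlgHom.comp_apply, hΨX, aeval_X]
      exact DFunLike.congr_fun this f
    constructor
    · intro hf
      -- At a zero of `J` either `w₀` vanishes, or the point lies on the Schubert cell and `f`
      -- vanishes there. By the Nullstellensatz the product lies in the prime ideal `J`, which does
      -- not contain `w₀`.
      have hprod : Ψ f * w₀ ∈ J := by
        have hrad := vanishingIdeal_zeroLocus_eq_radical (K := ℂ) J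
        rw [Ideal.IsPrime.radical ‹_›] at hrad
        rw [← hrad, mem_vanishingIdeal_iff]
        intro w hw
        rw [map_mul]
        by_cases h0 : aeval w w₀ = 0
        · rw [h0, mul_zero]
        · have hz : (fun i => s i * aeval w (F (ι i))) = w := by
            funext i
            rw [hF, map_mul, aeval_X, algHom_C, ← mul_assoc]
            change s i * s i * w i = w i
            rw [hs, one_mul]
          rw [heval, (mem_vanishingIdeal_iff.1 hf) _ ?_, zero_mul]
          refine ⟨schubertCell_subset_schubertVariety (hgen _ (fun b hb => ?_) ?_ ?_),
            cellPoint_mem_oppositeCell _⟩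
          · rw [hF0 b hb, map_zero]
          · rw [hz]
            exact hw
          · rw [hz]
            exact h0
      exact (Ideal.IsPrime.mem_or_mem ‹_› hprod).resolve_right hw₀
    · intro hf
      rw [klIdeal, mem_vanishingIdeal_iff]
      rintro z ⟨hz, -⟩
      have h1 := hJ z hz _ hf
      rw [heval] at h1
      have hzF : z = fun b => aeval (fun i => s i * z (ι i)) (F b) := by
        funext b
        by_cases hb : ∃ i, ι i = b
        · obtain ⟨i, rfl⟩ := hb
          rw [hF, map_mul, aeval_X, algHom_C, ← mul_assoc]
          change _ = s i * s i * z (ι i)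
          rw [hs, one_mul]
        · push Not at hb
          rw [hF0 b hb, map_zero, hzero z hz b hb]
      rw [hzF]
      exact h1
  have hsurj : Function.Surjective ((Ideal.Quotient.mkₐ ℂ J).comp Ψ) :=
    (Ideal.Quotient.mkₐ_surjective ℂ J).comp hΨ
  let e : KLRing u v ≃ₐ[ℂ] MvPolynomial σ ℂ ⧸ J :=
    (Ideal.quotientEquivAlgOfEq ℂ hker).trans (Ideal.quotientKerAlgEquivOfSurjective hsurj)
  have he : ∀ b, e (Ideal.Quotient.mk _ (X b)) = Ideal.Quotient.mk J (F b) := by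
    intro b
    rw [← hΨX]
    rfl
  refine ⟨e, ?_⟩
  rw [originIdeal, Ideal.map_span, originOf_eq_span]
  apply le_antisymm
  · refine Ideal.span_le.2 ?_
    rintro _ ⟨_, ⟨b, rfl⟩, rfl⟩
    rw [he]
    by_cases hb : ∃ i, ι i = b
    · obtain ⟨i, rfl⟩ := hb
      rw [hF, map_mul]
      exact Ideal.mul_mem_left _ _ (Ideal.subset_span ⟨i, rfl⟩)
    · push Not at hb
      rw [hF0 b hb, map_zero]
      exact zero_mem _
  · refine Ideal.span_le.2 ?_
    rintro _ ⟨i, rfl⟩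
    have h1 : Ideal.Quotient.mk J (X i) =
        Ideal.Quotient.mk J (C (s i)) * e (Ideal.Quotient.mk _ (X (ι i))) := by
      rw [he, hF, ← map_mul, ← mul_assoc, ← C_mul, hs, C_1, one_mul]
    change Ideal.Quotient.mk J (X i) ∈ _
    rw [h1]
    exact Ideal.mul_mem_left _ _ (Ideal.subset_span ⟨_, ⟨_, rfl⟩, rfl⟩)

end Schubert

theorem IsQuadricCone.X_notMem {σ : Type} {J : Ideal (MvPolynomial σ ℂ)} {D g : ℕ}
    (h : IsQuadricCone J D g) (i : σ) : X i ∉ J := by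
  intro hi
  have := h.le_sq hi
  rw [X, monomial_mem_pow_idealOfVars_iff _ _ one_ne_zero] at this
  simp at this

/-- The rank conditions that hold on the Schubert variety of `v`. -/
def RankConditions {n : ℕ} (v : Equiv.Perm (Fin n)) (M : Matrix (Fin n) (Fin n) ℂ) : Prop :=
  ∀ (k : ℕ) (R C : Fin k → Fin n) (p q : Fin n), (∀ i, p ≤ R i) → (∀ j, C j ≤ q) →
    (Finset.univ.filter fun j => j ≤ q ∧ p ≤ v j).card < k → (M.submatrix R C).det = 0

namespace RankConditions

variable {n : ℕ} {v : Equiv.Perm (Fin n)} {M : Matrix (Fin n) (Fin n) ℂ}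

theorem apply_eq_zero (h : RankConditions v M) (p q : Fin n)
    (hv : (Finset.univ.filter fun j => j ≤ q ∧ p ≤ v j).card < 1) : M p q = 0 := by
  have := h 1 (fun _ => p) (fun _ => q) p q (fun _ => le_rfl) (fun _ => le_rfl) hv
  rwa [det_fin_one] at this

theorem two (h : RankConditions v M) {r r' c c' : Fin n} (p q : Fin n) (hr : p ≤ r) (hr' : p ≤ r')
    (hc : c ≤ q) (hc' : c' ≤ q)
    (hv : (Finset.univ.filter fun j => j ≤ q ∧ p ≤ v j).card < 2) :
    M r c * M r' c' - M r c' * M r' c = 0 := by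
  have := h 2 ![r, r'] ![c, c'] p q (by intro i; fin_cases i <;> assumption)
    (by intro i; fin_cases i <;> assumption) hv
  rwa [det_fin_two] at this

theorem three (h : RankConditions v M) {r r' r'' c c' c'' : Fin n} (p q : Fin n) (hr : p ≤ r)
    (hr' : p ≤ r') (hr'' : p ≤ r'') (hc : c ≤ q) (hc' : c' ≤ q) (hc'' : c'' ≤ q)
    (hv : (Finset.univ.filter fun j => j ≤ q ∧ p ≤ v j).card < 3) :
    M r c * M r' c' * M r'' c'' - M r c * M r' c'' * M r'' c' - M r c' * M r' c * M r'' c'' +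
      M r c' * M r' c'' * M r'' c + M r c'' * M r' c * M r'' c' - M r c'' * M r' c' * M r'' c
      = 0 := by
  have := h 3 ![r, r', r''] ![c, c', c''] p q (by intro i; fin_cases i <;> assumption)
    (by intro i; fin_cases i <;> assumption) hv
  rwa [det_fin_three] at this

/-- Up to sign this four by four minor is a sum of three products. It is the source of the
orthogonality relations, and of two-term relations when one of the entries is zero. -/
theorem four (h : RankConditions v M) {R C : Fin 4 → Fin n} (p q : Fin n) (hR : ∀ i, p ≤ R i)
    (hC : ∀ j, C j ≤ q) (hv : (Finset.univ.filter fun j => j ≤ q ∧ p ≤ v j).card < 4)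
    {a0 a1 a2 a3 a4 a5 : ℂ} (hM : M.submatrix R C =
      !![a0, 0, 0, 1; a1, 0, 1, 0; a2, 1, 0, 0; 0, a3, a4, a5]) :
    a0 * a5 + a1 * a4 + a2 * a3 = 0 := by
  have := h 4 R C p q hR hC hv
  rw [hM, det_succ_column_zero] at this
  simp [Fin.sum_univ_succ, det_fin_three, submatrix, Fin.succAbove] at this
  linear_combination -this

end RankConditions

theorem eq_neg_neg_one_mul (a : ℂ) : a = -(-1 * a) := by ring

/-- The checklist for a single interval. `N x` is the cell matrix in model coordinates, with signs
`s`, once the superfluous coordinates are known to vanish. Rank conditions on it have to imply the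
equations. `T x` holds the column operations which clear `N x` below the positions of `v` whenever
the coordinates and `w` do not vanish. -/
theorem conclusion_of_parametrization {n : ℕ} {u v : Equiv.Perm (Fin n)} {σ : Type} [Fintype σ]
    {S : Set (MvPolynomial σ ℂ)} {D g c : ℕ} (h : IsQuadricCone (Ideal.span S) D g)
    (hc : D + c = Fintype.card σ) (hcg : c < g)
    (ι : σ → Fin n × Fin n) (hιu : ∀ i, ι i ∈ diagram u) (hι : Function.Injective ι)
    (s : σ → ℂ) (hs : ∀ i, s i * s i = 1)
    (hzero : ∀ M, M = cellMatrix u (fun b => M b.1.1 b.1.2) → RankConditions v M →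
      ∀ p q, (p, q) ∈ diagram u → (∀ i, ι i ≠ (p, q)) → M p q = 0)
    (N : (σ → ℂ) → Matrix (Fin n) (Fin n) ℂ)
    (hN : ∀ z : Fin n × Fin n → ℂ, (∀ b ∈ diagram u, (∀ i, ι i ≠ b) → z b = 0) →
      cellMatrix u (fun b => z b) = N fun i => s i * z (ι i))
    (hJ : ∀ x, RankConditions v (N x) → ∀ f ∈ S, eval x f = 0)
    {w : MvPolynomial σ ℂ} (hw : w ∉ Ideal.span S)
    (T : (σ → ℂ) → Matrix (Fin n) (Fin n) ℂ) (hT : ∀ x k q, q < k → T x k q = 0)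
    (hT' : ∀ x, (∀ i, x i ≠ 0) → eval x w ≠ 0 → ∀ q, T x q q ≠ 0)
    (hNT : ∀ x, (∀ f ∈ S, eval x f = 0) → (∀ i, x i ≠ 0) → ∀ p q, v q < p →
      (N x * T x) p q = 0) :
    (⟨n, u, v⟩ : PermInterval).NotLCIExactlyAtOrigin ∧
      (⟨n, u, v⟩ : PermInterval).IsoTo (Ideal.span S) := by
  classical
  have := h.isPrime
  let ι' : σ → diagram u := fun i => ⟨ι i, hιu i⟩
  let ext : (diagram u → ℂ) → Fin n × Fin n → ℂ := fun z b =>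
    if hb : b ∈ diagram u then z ⟨b, hb⟩ else 0
  have hext : ∀ z, (fun b : diagram u => ext z b) = z := by
    intro z
    funext b
    exact dif_pos b.2
  have hι' : ∀ z i, ext z (ι i) = z (ι' i) := fun z i => dif_pos (hιu i)
  have hcell : ∀ z, (∀ b, (∀ i, ι' i ≠ b) → z b = 0) →
      cellMatrix u z = N fun i => s i * z (ι' i) := by
    intro z hz
    have := hN (ext z) (fun b hb hb' => by
      rw [show ext z b = z ⟨b, hb⟩ from dif_pos hb]
      exact hz _ fun i hi => hb' i (congrArg Subtype.val hi))
    rwa [hext, funext fun i => congrArg (s i * ·) (hι' z i)] at this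
  have hrank : ∀ z, (QuotientGroup.mk (cellPoint u z) : FlagVariety n) ∈ schubertVariety v →
      RankConditions v (cellMatrix u z) := fun z hz k R C p q hR hC hv =>
    det_submatrix_eq_zero_of_mem_schubertVariety hz R C p q hR hC hv
  have happly : ∀ z (b : diagram u), cellMatrix u z b.1.1 b.1.2 = z b := by
    rintro z ⟨⟨p, q⟩, hb⟩
    have hb' := hb.1
    simp only [cellMatrix, of_apply, dif_pos hb]
    exact if_neg hb'.ne'
  have hzero' : ∀ z, (QuotientGroup.mk (cellPoint u z) : FlagVariety n) ∈ schubertVariety v →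
      ∀ b, (∀ i, ι' i ≠ b) → z b = 0 := by
    intro z hz b hb
    have := hzero (cellMatrix u z) (by congr 1; funext b; exact (happly z b).symm) (hrank z hz)
      b.1.1 b.1.2 b.2 (fun i hi => hb i (Subtype.ext hi))
    rwa [happly] at this
  -- The open set where `w` and all coordinates are nonzero is dense, as `J` is prime and contains
  -- neither `w` nor any variable.
  have hprod : w * ∏ i, X i ∉ Ideal.span S := by
    intro hmem
    rcases Ideal.IsPrime.mem_or_mem ‹_› hmem with hm | hm
    · exact hw hm
    · obtain ⟨i, -, hi⟩ := (Ideal.IsPrime.prod_mem_iff).1 hm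
      exact h.X_notMem i hi
  obtain ⟨e, he⟩ := exists_klRing_equiv (v := v) hprod ι'
    (fun i j hij => hι (congrArg Subtype.val hij)) s hs hzero'
    (fun z hz => by
      rw [zeroLocus_span]
      refine hJ _ ?_
      rw [← hcell z (hzero' z hz)]
      exact hrank z hz)
    (fun z hz hzJ hzw => by
      rw [zeroLocus_span] at hzJ
      rw [map_mul, map_prod] at hzw
      have hx : ∀ i, s i * z (ι' i) ≠ 0 := by
        intro i hi
        exact right_ne_zero_of_mul hzw (Finset.prod_eq_zero (Finset.mem_univ i) (by simpa using hi))
      refine mk_mem_schubertCell_of_mul _ (hT _) (hT' _ hx (left_ne_zero_of_mul hzw))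
        fun q p hqp => ?_
      rw [coe_cellPoint, hcell z hz]
      exact hNT _ hzJ hx p q hqp)
  exact ⟨PermInterval.notLCIExactlyAtOrigin h hc hcg e.toRingEquiv he, ⟨e⟩⟩

end SchubertLCI

end

/-! ### The exceptional intervals. -/

noncomputable section

namespace SchubertLCI

open Matrix MvPolynomial

/-- Every equation is a two by two minor of the cell matrix. The last diagonal entry of the column
operations is `x 3 - x 4 * x 1`, which is not a monomial, hence the additional factor `w`. -/
theorem intervalC_spec : intervalC.NotLCIExactlyAtOrigin ∧ intervalC.IsoTo cutCornerIdeal := by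
  refine conclusion_of_parametrization isQuadricCone_cutCornerIdeal (c := 3) rfl (by decide)
    (![(2, 0), (2, 1), (3, 0), (3, 1), (3, 2), (4, 0), (4, 1), (4, 2)]) (by decide) (by decide)
    (![1, 1, 1, 1, 1, 1, 1, 1]) (fun i => by fin_cases i <;> simp) ?_
    (fun x => !![0, 1, 0, 0, 0;
      1, 0, 0, 0, 0;
      x 0, x 1, 1, 0, 0;
      x 2, x 3, x 4, 0, 1;
      x 5, x 6, x 7, 1, 0]) ?_ ?_ (w := X 3 - X 4 * X 1) ?_
    (fun x => !![1, -x 1, -x 4, -1, 0;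
      0, x 0, 0, 0, -1;
      0, 0, x 2, 0, x 1;
      0, 0, 0, x 5, x 6 - x 7 * x 1;
      0, 0, 0, 0, x 3 - x 4 * x 1]) ?_ ?_ ?_
  · intro M hM hr p q hpq hb
    refine hr.apply_eq_zero p q ?_
    revert p q
    decide
  · intro z hz
    ext p q
    fin_cases p <;> fin_cases q <;> first
      | rfl | exact (one_mul _).symm
  · rintro x hr _ (rfl | rfl | rfl | rfl | rfl)
    · have h := hr.two (r := 2) (r' := 3) (c := 0) (c' := 1) 2 1
        (by decide) (by decide) (by decide) (by decide) (by decide)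
      simp at h ⊢
      linear_combination h
    · have h := hr.two (r := 2) (r' := 4) (c := 0) (c' := 1) 2 1
        (by decide) (by decide) (by decide) (by decide) (by decide)
      simp at h ⊢
      linear_combination h
    · have h := hr.two (r := 3) (r' := 4) (c := 0) (c' := 1) 2 1
        (by decide) (by decide) (by decide) (by decide) (by decide)
      simp at h ⊢
      linear_combination h
    · have h := hr.two (r := 3) (r' := 4) (c := 0) (c' := 2) 3 2
        (by decide) (by decide) (by decide) (by decide) (by decide)
      simp at h ⊢
      linear_combination h
    · have h := hr.two (r := 3) (r' := 4) (c := 1) (c' := 2) 3 2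
        (by decide) (by decide) (by decide) (by decide) (by decide)
      simp at h ⊢
      linear_combination h
  · intro hmem
    -- `w` has a linear term, which no element of the ideal has.
    have h1 := (mem_pow_idealOfVars_iff' 2 _).1 (isQuadricCone_cutCornerIdeal.le_sq hmem) (Finsupp.single 3 1) (by simp)
    revert h1
    rw [coeff_sub, coeff_X_mul', coeff_X, coeff_X]
    simp
  · intro x k q h
    fin_cases q <;> fin_cases k <;> first | rfl | exact absurd h (by decide)
  · intro x hx hw q
    fin_cases q <;> simp [hx]
    simpa using hw
  · intro x hx _ p q h
    simp only [Set.mem_insert_iff, Set.mem_singleton_iff, forall_eq_or_imp, forall_eq,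
      map_sub, map_mul, eval_X] at hx
    obtain ⟨h1, h2, h3, h4, h5⟩ := hx
    fin_cases q <;> fin_cases p <;> first
      | exact absurd h (by decide)
      | (simp [Matrix.mul_apply, Fin.sum_univ_succ] <;> grind)

theorem intervalD_spec : intervalD.NotLCIExactlyAtOrigin ∧ intervalD.IsoTo cutCornerIdeal := by
  refine conclusion_of_parametrization isQuadricCone_cutCornerIdeal (c := 3) rfl (by decide)
    (![(1, 0), (2, 0), (3, 1), (3, 2), (5, 3), (4, 1), (4, 2), (5, 4)]) (by decide) (by decide)
    (![1, 1, 1, -1, 1, -1, 1, 1]) (fun i => by fin_cases i <;> simp) ?_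
    (fun x => !![1, 0, 0, 0, 0, 0;
      x 0, 0, 1, 0, 0, 0;
      x 1, 1, 0, 0, 0, 0;
      0, x 2, -x 3, 0, 1, 0;
      0, -x 5, x 6, 1, 0, 0;
      0, 0, 0, x 4, x 7, 1]) ?_ ?_ (w := 1) ?_
    (fun x => !![1, 0, -1, 0, 0, 0;
      0, 1, x 1, 0, 0, 0;
      0, 0, x 0, 0, x 2, 0;
      0, 0, 0, 1, -(x 3 * x 5), 0;
      0, 0, 0, 0, x 2 * x 3, -1;
      0, 0, 0, 0, 0, x 7]) ?_ ?_ ?_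
  · intro M hM hr p q hpq hb
    refine hr.apply_eq_zero p q ?_
    revert p q
    decide
  · intro z hz
    ext p q
    fin_cases p <;> fin_cases q <;> first
      | rfl | exact (one_mul _).symm | exact hz _ (by decide) (by decide) | exact eq_neg_neg_one_mul _
  · rintro x hr _ (rfl | rfl | rfl | rfl | rfl)
    -- The unit entries of the cell matrix reduce this minor to two terms. The signs of the
    -- coordinates are chosen to turn these into a binomial of the model.
    · have h := hr.three (r := 1) (r' := 2) (r'' := 3) (c := 0) (c' := 1) (c'' := 2) 1 2
        (by decide) (by decide) (by decide) (by decide) (by decide) (by decide) (by decide)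
      simp at h ⊢
      linear_combination -h
    · have h := hr.three (r := 1) (r' := 2) (r'' := 4) (c := 0) (c' := 1) (c'' := 2) 1 2
        (by decide) (by decide) (by decide) (by decide) (by decide) (by decide) (by decide)
      simp at h ⊢
      linear_combination h
    · have h := hr.two (r := 3) (r' := 4) (c := 1) (c' := 2) 3 2
        (by decide) (by decide) (by decide) (by decide) (by decide)
      simp at h ⊢
      linear_combination h
    · have h := hr.three (r := 3) (r' := 4) (r'' := 5) (c := 1) (c' := 3) (c'' := 4) 3 4
        (by decide) (by decide) (by decide) (by decide) (by decide) (by decide) (by decide)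
      simp at h ⊢
      linear_combination h
    · have h := hr.three (r := 3) (r' := 4) (r'' := 5) (c := 2) (c' := 3) (c'' := 4) 3 4
        (by decide) (by decide) (by decide) (by decide) (by decide) (by decide) (by decide)
      simp at h ⊢
      linear_combination -h
  · exact (Ideal.ne_top_iff_one _).1 isQuadricCone_cutCornerIdeal.isPrime.ne_top
  · intro x k q h
    fin_cases q <;> fin_cases k <;> first | rfl | exact absurd h (by decide)
  · intro x hx hw q
    fin_cases q <;> simp [hx]
  · intro x hx _ p q h
    simp only [Set.mem_insert_iff, Set.mem_singleton_iff, forall_eq_or_imp, forall_eq,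
      map_sub, map_mul, eval_X] at hx
    obtain ⟨h1, h2, h3, h4, h5⟩ := hx
    fin_cases q <;> fin_cases p <;> first
      | exact absurd h (by decide)
      | (simp [Matrix.mul_apply, Fin.sum_univ_succ] <;> grind)

theorem intervalE_spec : intervalE.NotLCIExactlyAtOrigin ∧ intervalE.IsoTo cutCornerIdeal := by
  refine conclusion_of_parametrization isQuadricCone_cutCornerIdeal (c := 3) rfl (by decide)
    (![(2, 1), (2, 2), (4, 1), (4, 2), (4, 0), (5, 1), (5, 2), (5, 0)]) (by decide) (by decide)
    (![1, 1, 1, 1, 1, 1, 1, 1]) (fun i => by fin_cases i <;> simp) ?_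
    (fun x => !![0, 0, 1, 0, 0, 0;
      0, 1, 0, 0, 0, 0;
      0, x 0, x 1, 0, 0, 1;
      1, 0, 0, 0, 0, 0;
      x 4, x 2, x 3, 0, 1, 0;
      x 7, x 5, x 6, 1, 0, 0]) ?_ ?_ (w := 1) ?_
    (fun x => !![1, -x 2, 0, -1, 0, 0;
      0, x 4, -x 1, 0, -1, 0;
      0, 0, x 0, 0, 0, -x 0;
      0, 0, 0, x 7, x 5, x 1 * x 5;
      0, 0, 0, 0, x 2, x 1 * x 2;
      0, 0, 0, 0, 0, x 0 * x 1]) ?_ ?_ ?_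
  · intro M hM hr p q hpq hb
    refine hr.apply_eq_zero p q ?_
    revert p q
    decide
  · intro z hz
    ext p q
    fin_cases p <;> fin_cases q <;> first
      | rfl | exact (one_mul _).symm
  · rintro x hr _ (rfl | rfl | rfl | rfl | rfl)
    -- Row `3` is a unit vector, so the minor collapses to a two by two minor of rows `2` and `4`.
    · have h := hr.three (r := 2) (r' := 3) (r'' := 4) (c := 0) (c' := 1) (c'' := 2) 2 2
        (by decide) (by decide) (by decide) (by decide) (by decide) (by decide) (by decide)
      simp at h ⊢
      linear_combination -h
    · have h := hr.three (r := 2) (r' := 3) (r'' := 5) (c := 0) (c' := 1) (c'' := 2) 2 2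
        (by decide) (by decide) (by decide) (by decide) (by decide) (by decide) (by decide)
      simp at h ⊢
      linear_combination -h
    · have h := hr.two (r := 4) (r' := 5) (c := 1) (c' := 2) 4 2
        (by decide) (by decide) (by decide) (by decide) (by decide)
      simp at h ⊢
      linear_combination h
    · have h := hr.two (r := 4) (r' := 5) (c := 0) (c' := 1) 4 1
        (by decide) (by decide) (by decide) (by decide) (by decide)
      simp at h ⊢
      linear_combination -h
    · have h := hr.two (r := 4) (r' := 5) (c := 0) (c' := 2) 4 2
        (by decide) (by decide) (by decide) (by decide) (by decide)
      simp at h ⊢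
      linear_combination -h
  · exact (Ideal.ne_top_iff_one _).1 isQuadricCone_cutCornerIdeal.isPrime.ne_top
  · intro x k q h
    fin_cases q <;> fin_cases k <;> first | rfl | exact absurd h (by decide)
  · intro x hx hw q
    fin_cases q <;> simp [hx]
  · intro x hx _ p q h
    simp only [Set.mem_insert_iff, Set.mem_singleton_iff, forall_eq_or_imp, forall_eq,
      map_sub, map_mul, eval_X] at hx
    obtain ⟨h1, h2, h3, h4, h5⟩ := hx
    fin_cases q <;> fin_cases p <;> first
      | exact absurd h (by decide)
      | (simp [Matrix.mul_apply, Fin.sum_univ_succ] <;> grind)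

theorem intervalEi_spec : intervalEi.NotLCIExactlyAtOrigin ∧ intervalEi.IsoTo cutCornerIdeal := by
  refine conclusion_of_parametrization isQuadricCone_cutCornerIdeal (c := 3) rfl (by decide)
    (![(3, 3), (4, 3), (3, 0), (4, 0), (5, 0), (3, 1), (4, 1), (5, 1)]) (by decide) (by decide)
    (![1, 1, 1, 1, 1, 1, 1, 1]) (fun i => by fin_cases i <;> simp) ?_
    (fun x => !![0, 0, 0, 1, 0, 0;
      0, 1, 0, 0, 0, 0;
      1, 0, 0, 0, 0, 0;
      x 2, x 5, 0, x 0, 0, 1;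
      x 3, x 6, 0, x 1, 1, 0;
      x 4, x 7, 1, 0, 0, 0]) ?_ ?_ (w := 1) ?_
    (fun x => !![1, -x 5, -1, 0, 0, 0;
      0, x 2, 0, -(x 0 * x 2), 0, 0;
      0, 0, x 4, x 0 * x 4 * x 5, 0, 0;
      0, 0, 0, x 2 * x 5, -1, -1;
      0, 0, 0, 0, x 1, x 1;
      0, 0, 0, 0, 0, x 0]) ?_ ?_ ?_
  · intro M hM hr p q hpq hb
    refine hr.apply_eq_zero p q ?_
    revert p q
    decide
  · intro z hz
    ext p q
    fin_cases p <;> fin_cases q <;> first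
      | rfl | exact (one_mul _).symm
  · rintro x hr _ (rfl | rfl | rfl | rfl | rfl)
    · have h := hr.three (r := 3) (r' := 4) (r'' := 5) (c := 0) (c' := 2) (c'' := 3) 3 3
        (by decide) (by decide) (by decide) (by decide) (by decide) (by decide) (by decide)
      simp at h ⊢
      linear_combination h
    · have h := hr.three (r := 3) (r' := 4) (r'' := 5) (c := 1) (c' := 2) (c'' := 3) 3 3
        (by decide) (by decide) (by decide) (by decide) (by decide) (by decide) (by decide)
      simp at h ⊢
      linear_combination h
    · have h := hr.two (r := 3) (r' := 4) (c := 0) (c' := 1) 3 1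
        (by decide) (by decide) (by decide) (by decide) (by decide)
      simp at h ⊢
      linear_combination h
    · have h := hr.two (r := 3) (r' := 5) (c := 0) (c' := 1) 3 1
        (by decide) (by decide) (by decide) (by decide) (by decide)
      simp at h ⊢
      linear_combination h
    · have h := hr.two (r := 4) (r' := 5) (c := 0) (c' := 1) 3 1
        (by decide) (by decide) (by decide) (by decide) (by decide)
      simp at h ⊢
      linear_combination h
  · exact (Ideal.ne_top_iff_one _).1 isQuadricCone_cutCornerIdeal.isPrime.ne_top
  · intro x k q h
    fin_cases q <;> fin_cases k <;> first | rfl | exact absurd h (by decide)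
  · intro x hx hw q
    fin_cases q <;> simp [hx]
  · intro x hx _ p q h
    simp only [Set.mem_insert_iff, Set.mem_singleton_iff, forall_eq_or_imp, forall_eq,
      map_sub, map_mul, eval_X] at hx
    obtain ⟨h1, h2, h3, h4, h5⟩ := hx
    fin_cases q <;> fin_cases p <;> first
      | exact absurd h (by decide)
      | (simp [Matrix.mul_apply, Fin.sum_univ_succ] <;> grind)

theorem intervalF_spec : intervalF.NotLCIExactlyAtOrigin ∧ intervalF.IsoTo cutCornerIdeal := by
  refine conclusion_of_parametrization isQuadricCone_cutCornerIdeal (c := 3) rfl (by decide)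
    (![(2, 0), (2, 1), (3, 0), (3, 1), (5, 2), (4, 0), (4, 1), (5, 3)]) (by decide) (by decide)
    (![1, 1, 1, 1, 1, 1, 1, -1]) (fun i => by fin_cases i <;> simp) ?_
    (fun x => !![0, 1, 0, 0, 0, 0;
      1, 0, 0, 0, 0, 0;
      x 0, x 1, 0, 0, 1, 0;
      x 2, x 3, 0, 1, 0, 0;
      x 5, x 6, 1, 0, 0, 0;
      0, 0, x 4, -x 7, 0, 1]) ?_ ?_ (w := 1) ?_
    (fun x => !![1, -x 1, 0, -1, 0, 0;
      0, x 0, 0, 0, -x 0, 0;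
      0, 0, 1, x 5, x 1 * x 5, 0;
      0, 0, 0, x 2, x 1 * x 2, 1;
      0, 0, 0, 0, x 0 * x 1, 0;
      0, 0, 0, 0, 0, x 7]) ?_ ?_ ?_
  · intro M hM hr p q hpq hb
    -- This coordinate is not forced to vanish by a one by one rank condition. It is, up to sign, a
    -- three by three minor whose first two rows are unit vectors.
    by_cases he : (p, q) = (5, 4)
    · obtain ⟨rfl, rfl⟩ := Prod.mk.inj he
      have h := hr.three (r := 3) (r' := 4) (r'' := 5) (c := 2) (c' := 3) (c'' := 4) 3 4
        (by decide) (by decide) (by decide) (by decide) (by decide) (by decide) (by decide)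
      have h32 : M 3 2 = 0 := by rw [hM]; rfl
      have h33 : M 3 3 = 1 := by rw [hM]; rfl
      have h34 : M 3 4 = 0 := by rw [hM]; rfl
      have h42 : M 4 2 = 1 := by rw [hM]; rfl
      have h43 : M 4 3 = 0 := by rw [hM]; rfl
      have h44 : M 4 4 = 0 := by rw [hM]; rfl
      simpa [h32, h33, h34, h42, h43, h44] using h
    · refine hr.apply_eq_zero p q ?_
      clear hM hr
      revert p q
      decide
  · intro z hz
    ext p q
    fin_cases p <;> fin_cases q <;> first
      | rfl | exact (one_mul _).symm | exact hz _ (by decide) (by decide) | exact eq_neg_neg_one_mul _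
  · rintro x hr _ (rfl | rfl | rfl | rfl | rfl)
    · have h := hr.two (r := 2) (r' := 3) (c := 0) (c' := 1) 2 1
        (by decide) (by decide) (by decide) (by decide) (by decide)
      simp at h ⊢
      linear_combination h
    · have h := hr.two (r := 2) (r' := 4) (c := 0) (c' := 1) 2 1
        (by decide) (by decide) (by decide) (by decide) (by decide)
      simp at h ⊢
      linear_combination h
    · have h := hr.two (r := 3) (r' := 4) (c := 0) (c' := 1) 2 1
        (by decide) (by decide) (by decide) (by decide) (by decide)
      simp at h ⊢
      linear_combination h
    · have h := hr.three (r := 3) (r' := 4) (r'' := 5) (c := 0) (c' := 2) (c'' := 3) 3 3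
        (by decide) (by decide) (by decide) (by decide) (by decide) (by decide) (by decide)
      simp at h ⊢
      linear_combination -h
    · have h := hr.three (r := 3) (r' := 4) (r'' := 5) (c := 1) (c' := 2) (c'' := 3) 3 3
        (by decide) (by decide) (by decide) (by decide) (by decide) (by decide) (by decide)
      simp at h ⊢
      linear_combination -h
  · exact (Ideal.ne_top_iff_one _).1 isQuadricCone_cutCornerIdeal.isPrime.ne_top
  · intro x k q h
    fin_cases q <;> fin_cases k <;> first | rfl | exact absurd h (by decide)
  · intro x hx hw q
    fin_cases q <;> simp [hx]
  · intro x hx _ p q h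
    simp only [Set.mem_insert_iff, Set.mem_singleton_iff, forall_eq_or_imp, forall_eq,
      map_sub, map_mul, eval_X] at hx
    obtain ⟨h1, h2, h3, h4, h5⟩ := hx
    fin_cases q <;> fin_cases p <;> first
      | exact absurd h (by decide)
      | (simp [Matrix.mul_apply, Fin.sum_univ_succ] <;> grind)

theorem intervalFi_spec : intervalFi.NotLCIExactlyAtOrigin ∧ intervalFi.IsoTo cutCornerIdeal := by
  refine conclusion_of_parametrization isQuadricCone_cutCornerIdeal (c := 3) rfl (by decide)
    (![(4, 0), (4, 1), (2, 0), (2, 1), (5, 3), (3, 0), (3, 1), (5, 4)]) (by decide) (by decide)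
    (![1, 1, 1, 1, 1, 1, 1, -1]) (fun i => by fin_cases i <;> simp) ?_
    (fun x => !![0, 1, 0, 0, 0, 0;
      1, 0, 0, 0, 0, 0;
      x 2, x 3, 0, 0, 1, 0;
      x 5, x 6, 0, 1, 0, 0;
      x 0, x 1, 1, 0, 0, 0;
      0, 0, 0, x 4, -x 7, 1]) ?_ ?_ (w := 1) ?_
    (fun x => !![1, -x 1, -1, 0, 0, 0;
      0, x 0, 0, 0, -x 2, 0;
      0, 0, x 0, 0, x 0 * x 3, 0;
      0, 0, 0, 1, x 3 * x 5, 0;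
      0, 0, 0, 0, x 2 * x 3, 1;
      0, 0, 0, 0, 0, x 7]) ?_ ?_ ?_
  · intro M hM hr p q hpq hb
    refine hr.apply_eq_zero p q ?_
    revert p q
    decide
  · intro z hz
    ext p q
    fin_cases p <;> fin_cases q <;> first
      | rfl | exact (one_mul _).symm | exact hz _ (by decide) (by decide) | exact eq_neg_neg_one_mul _
  · rintro x hr _ (rfl | rfl | rfl | rfl | rfl)
    · have h := hr.two (r := 2) (r' := 4) (c := 0) (c' := 1) 2 1
        (by decide) (by decide) (by decide) (by decide) (by decide)
      simp at h ⊢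
      linear_combination -h
    · have h := hr.two (r := 3) (r' := 4) (c := 0) (c' := 1) 2 1
        (by decide) (by decide) (by decide) (by decide) (by decide)
      simp at h ⊢
      linear_combination -h
    · have h := hr.two (r := 2) (r' := 3) (c := 0) (c' := 1) 2 1
        (by decide) (by decide) (by decide) (by decide) (by decide)
      simp at h ⊢
      linear_combination h
    -- The entry `(5, 2)` vanishes, so only two of the three products survive.
    · have h := hr.four (R := ![2, 3, 4, 5]) (C := ![0, 2, 3, 4]) 2 4
        (by decide) (by decide) (by decide) (a0 := x 2) (a1 := x 5) (a2 := x 0) (a3 := 0) (a4 := x 4) (a5 := -x 7)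
        (by ext i j; fin_cases i <;> fin_cases j <;> rfl)
      simp
      linear_combination -h
    · have h := hr.four (R := ![2, 3, 4, 5]) (C := ![1, 2, 3, 4]) 2 4
        (by decide) (by decide) (by decide) (a0 := x 3) (a1 := x 6) (a2 := x 1) (a3 := 0) (a4 := x 4) (a5 := -x 7)
        (by ext i j; fin_cases i <;> fin_cases j <;> rfl)
      simp
      linear_combination -h
  · exact (Ideal.ne_top_iff_one _).1 isQuadricCone_cutCornerIdeal.isPrime.ne_top
  · intro x k q h
    fin_cases q <;> fin_cases k <;> first | rfl | exact absurd h (by decide)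
  · intro x hx hw q
    fin_cases q <;> simp [hx]
  · intro x hx _ p q h
    simp only [Set.mem_insert_iff, Set.mem_singleton_iff, forall_eq_or_imp, forall_eq,
      map_sub, map_mul, eval_X] at hx
    obtain ⟨h1, h2, h3, h4, h5⟩ := hx
    fin_cases q <;> fin_cases p <;> first
      | exact absurd h (by decide)
      | (simp [Matrix.mul_apply, Fin.sum_univ_succ] <;> grind)

theorem intervalFrc_spec : intervalFrc.NotLCIExactlyAtOrigin ∧ intervalFrc.IsoTo cutCornerIdeal := by
  refine conclusion_of_parametrization isQuadricCone_cutCornerIdeal (c := 3) rfl (by decide)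
    (![(1, 0), (2, 0), (4, 2), (4, 3), (4, 1), (5, 2), (5, 3), (5, 1)]) (by decide) (by decide)
    (![1, -1, 1, 1, 1, 1, 1, 1]) (fun i => by fin_cases i <;> simp) ?_
    (fun x => !![1, 0, 0, 0, 0, 0;
      x 0, 0, 0, 1, 0, 0;
      -x 1, 0, 1, 0, 0, 0;
      0, 1, 0, 0, 0, 0;
      0, x 4, x 2, x 3, 0, 1;
      0, x 7, x 5, x 6, 1, 0]) ?_ ?_ (w := 1) ?_
    (fun x => !![1, 0, 0, -1, 0, 0;
      0, 1, -x 2, 0, -1, 0;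
      0, 0, x 4, -x 1, 0, 0;
      0, 0, 0, x 0, 0, -x 2;
      0, 0, 0, 0, x 7, x 3 * x 5;
      0, 0, 0, 0, 0, x 2 * x 3]) ?_ ?_ ?_
  · intro M hM hr p q hpq hb
    refine hr.apply_eq_zero p q ?_
    revert p q
    decide
  · intro z hz
    ext p q
    fin_cases p <;> fin_cases q <;> first
      | rfl | exact (one_mul _).symm | exact hz _ (by decide) (by decide) | exact eq_neg_neg_one_mul _
  · rintro x hr _ (rfl | rfl | rfl | rfl | rfl)
    · have h := hr.four (R := ![1, 2, 3, 4]) (C := ![0, 1, 2, 3]) 1 3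
        (by decide) (by decide) (by decide) (a0 := x 0) (a1 := -x 1) (a2 := 0) (a3 := x 4) (a4 := x 2) (a5 := x 3)
        (by ext i j; fin_cases i <;> fin_cases j <;> rfl)
      simp
      linear_combination h
    · have h := hr.four (R := ![1, 2, 3, 5]) (C := ![0, 1, 2, 3]) 1 3
        (by decide) (by decide) (by decide) (a0 := x 0) (a1 := -x 1) (a2 := 0) (a3 := x 7) (a4 := x 5) (a5 := x 6)
        (by ext i j; fin_cases i <;> fin_cases j <;> rfl)
      simp
      linear_combination h
    · have h := hr.two (r := 4) (r' := 5) (c := 2) (c' := 3) 4 3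
        (by decide) (by decide) (by decide) (by decide) (by decide)
      simp at h ⊢
      linear_combination h
    · have h := hr.two (r := 4) (r' := 5) (c := 1) (c' := 2) 4 2
        (by decide) (by decide) (by decide) (by decide) (by decide)
      simp at h ⊢
      linear_combination -h
    · have h := hr.two (r := 4) (r' := 5) (c := 1) (c' := 3) 4 3
        (by decide) (by decide) (by decide) (by decide) (by decide)
      simp at h ⊢
      linear_combination -h
  · exact (Ideal.ne_top_iff_one _).1 isQuadricCone_cutCornerIdeal.isPrime.ne_top
  · intro x k q h
    fin_cases q <;> fin_cases k <;> first | rfl | exact absurd h (by decide)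
  · intro x hx hw q
    fin_cases q <;> simp [hx]
  · intro x hx _ p q h
    simp only [Set.mem_insert_iff, Set.mem_singleton_iff, forall_eq_or_imp, forall_eq,
      map_sub, map_mul, eval_X] at hx
    obtain ⟨h1, h2, h3, h4, h5⟩ := hx
    fin_cases q <;> fin_cases p <;> first
      | exact absurd h (by decide)
      | (simp [Matrix.mul_apply, Fin.sum_univ_succ] <;> grind)

theorem intervalFirc_spec : intervalFirc.NotLCIExactlyAtOrigin ∧ intervalFirc.IsoTo cutCornerIdeal := by
  refine conclusion_of_parametrization isQuadricCone_cutCornerIdeal (c := 3) rfl (by decide)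
    (![(2, 0), (3, 0), (4, 1), (4, 2), (4, 3), (5, 1), (5, 2), (5, 3)]) (by decide) (by decide)
    (![1, -1, 1, 1, 1, 1, 1, 1]) (fun i => by fin_cases i <;> simp) ?_
    (fun x => !![1, 0, 0, 0, 0, 0;
      0, 0, 0, 1, 0, 0;
      x 0, 0, 1, 0, 0, 0;
      -x 1, 1, 0, 0, 0, 0;
      0, x 2, x 3, x 4, 0, 1;
      0, x 5, x 6, x 7, 1, 0]) ?_ ?_ (w := 1) ?_
    (fun x => !![1, 0, -1, 0, 0, 0;
      0, 1, -x 1, 0, -1, 0;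
      0, 0, x 0, -x 4, 0, 0;
      0, 0, 0, x 3, 0, -x 2;
      0, 0, 0, 0, x 5, x 4 * x 5;
      0, 0, 0, 0, 0, x 2 * x 4]) ?_ ?_ ?_
  · intro M hM hr p q hpq hb
    -- Again a coordinate that vanishes only by a three by three minor, here one whose last two
    -- columns are unit vectors.
    by_cases he : (p, q) = (1, 0)
    · obtain ⟨rfl, rfl⟩ := Prod.mk.inj he
      have h := hr.three (r := 1) (r' := 2) (r'' := 3) (c := 0) (c' := 1) (c'' := 2) 1 2
        (by decide) (by decide) (by decide) (by decide) (by decide) (by decide) (by decide)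
      have h11 : M 1 1 = 0 := by rw [hM]; rfl
      have h12 : M 1 2 = 0 := by rw [hM]; rfl
      have h21 : M 2 1 = 0 := by rw [hM]; rfl
      have h22 : M 2 2 = 1 := by rw [hM]; rfl
      have h31 : M 3 1 = 1 := by rw [hM]; rfl
      have h32 : M 3 2 = 0 := by rw [hM]; rfl
      simpa [h11, h12, h21, h22, h31, h32] using h
    · refine hr.apply_eq_zero p q ?_
      clear hM hr
      revert p q
      decide
  · intro z hz
    ext p q
    fin_cases p <;> fin_cases q <;> first
      | rfl | exact (one_mul _).symm | exact hz _ (by decide) (by decide) | exact eq_neg_neg_one_mul _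
  · rintro x hr _ (rfl | rfl | rfl | rfl | rfl)
    · have h := hr.three (r := 2) (r' := 3) (r'' := 4) (c := 0) (c' := 1) (c'' := 2) 1 2
        (by decide) (by decide) (by decide) (by decide) (by decide) (by decide) (by decide)
      simp at h ⊢
      linear_combination h
    · have h := hr.three (r := 2) (r' := 3) (r'' := 5) (c := 0) (c' := 1) (c'' := 2) 1 2
        (by decide) (by decide) (by decide) (by decide) (by decide) (by decide) (by decide)
      simp at h ⊢
      linear_combination h
    · have h := hr.two (r := 4) (r' := 5) (c := 1) (c' := 2) 4 2
        (by decide) (by decide) (by decide) (by decide) (by decide)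
      simp at h ⊢
      linear_combination h
    · have h := hr.two (r := 4) (r' := 5) (c := 1) (c' := 3) 4 3
        (by decide) (by decide) (by decide) (by decide) (by decide)
      simp at h ⊢
      linear_combination h
    · have h := hr.two (r := 4) (r' := 5) (c := 2) (c' := 3) 4 3
        (by decide) (by decide) (by decide) (by decide) (by decide)
      simp at h ⊢
      linear_combination h
  · exact (Ideal.ne_top_iff_one _).1 isQuadricCone_cutCornerIdeal.isPrime.ne_top
  · intro x k q h
    fin_cases q <;> fin_cases k <;> first | rfl | exact absurd h (by decide)
  · intro x hx hw q
    fin_cases q <;> simp [hx]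
  · intro x hx _ p q h
    simp only [Set.mem_insert_iff, Set.mem_singleton_iff, forall_eq_or_imp, forall_eq,
      map_sub, map_mul, eval_X] at hx
    obtain ⟨h1, h2, h3, h4, h5⟩ := hx
    fin_cases q <;> fin_cases p <;> first
      | exact absurd h (by decide)
      | (simp [Matrix.mul_apply, Fin.sum_univ_succ] <;> grind)

/-- The first two columns in rows `2, 3, 4` are the dependent vectors. The third vector is row `5`
in columns `4, 3, 2`, in reverse order because the ones of `u` in rows and columns `2, 3, 4` are on
the antidiagonal. Four by four minors through these ones are the two pairings. -/
theorem intervalG_spec : intervalG.NotLCIExactlyAtOrigin ∧ intervalG.IsoTo dependentOrthogonalIdealG := by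
  refine conclusion_of_parametrization isQuadricCone_dependentOrthogonalIdealG (c := 3) rfl (by decide)
    (fun e => (![![(2, 0), (3, 0), (4, 0)], ![(2, 1), (3, 1), (4, 1)], ![(5, 4), (5, 3), (5, 2)]] : Fin 3 → Fin 3 → Fin 6 × Fin 6) e.1 e.2) (by decide) (by decide)
    (fun _ => 1) (fun _ => one_mul 1) ?_
    (fun x => !![0, 1, 0, 0, 0, 0;
      1, 0, 0, 0, 0, 0;
      x (0, 0), x (1, 0), 0, 0, 1, 0;
      x (0, 1), x (1, 1), 0, 1, 0, 0;
      x (0, 2), x (1, 2), 1, 0, 0, 0;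
      0, 0, x (2, 2), x (2, 1), x (2, 0), 1]) ?_ ?_ (w := 1) ?_
    (fun x => !![1, -x (1, 0), 0, x (2, 1), 0, 0;
      0, x (0, 0), 0, 0, -x (0, 0), 0;
      0, 0, 1, -(x (0, 2) * x (2, 1)), x (0, 2) * x (1, 0), 0;
      0, 0, 0, x (0, 2) * x (2, 2), x (0, 1) * x (1, 0), 0;
      0, 0, 0, 0, x (0, 0) * x (1, 0), -1;
      0, 0, 0, 0, 0, x (2, 0)]) ?_ ?_ ?_
  · intro M hM hr p q hpq hb
    refine hr.apply_eq_zero p q ?_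
    revert p q
    decide
  · intro z hz
    ext p q
    fin_cases p <;> fin_cases q <;> first
      | rfl | exact (one_mul _).symm | exact hz _ (by decide) (by decide)
  · rintro x hr _ (rfl | rfl | rfl | rfl | rfl)
    · have h := hr.two (r := 2) (r' := 3) (c := 0) (c' := 1) 2 1
        (by decide) (by decide) (by decide) (by decide) (by decide)
      simp at h ⊢
      linear_combination h
    · have h := hr.two (r := 2) (r' := 4) (c := 0) (c' := 1) 2 1
        (by decide) (by decide) (by decide) (by decide) (by decide)
      simp at h ⊢
      linear_combination h
    · have h := hr.two (r := 3) (r' := 4) (c := 0) (c' := 1) 2 1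
        (by decide) (by decide) (by decide) (by decide) (by decide)
      simp at h ⊢
      linear_combination h
    · have h := hr.four (R := ![2, 3, 4, 5]) (C := ![0, 2, 3, 4]) 2 4
        (by decide) (by decide) (by decide) (a0 := x (0, 0)) (a1 := x (0, 1)) (a2 := x (0, 2)) (a3 := x (2, 2)) (a4 := x (2, 1)) (a5 := x (2, 0))
        (by ext i j; fin_cases i <;> fin_cases j <;> rfl)
      simp
      linear_combination h
    · have h := hr.four (R := ![2, 3, 4, 5]) (C := ![1, 2, 3, 4]) 2 4
        (by decide) (by decide) (by decide) (a0 := x (1, 0)) (a1 := x (1, 1)) (a2 := x (1, 2)) (a3 := x (2, 2)) (a4 := x (2, 1)) (a5 := x (2, 0))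
        (by ext i j; fin_cases i <;> fin_cases j <;> rfl)
      simp
      linear_combination h
  · exact (Ideal.ne_top_iff_one _).1 isQuadricCone_dependentOrthogonalIdealG.isPrime.ne_top
  · intro x k q h
    fin_cases q <;> fin_cases k <;> first | rfl | exact absurd h (by decide)
  · intro x hx hw q
    fin_cases q <;> simp [hx]
  · intro x hx _ p q h
    simp only [Set.mem_insert_iff, Set.mem_singleton_iff, forall_eq_or_imp, forall_eq,
      map_sub, map_add, map_mul, eval_X] at hx
    obtain ⟨h1, h2, h3, h4, h5⟩ := hx
    fin_cases q <;> fin_cases p <;> first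
      | exact absurd h (by decide)
      | (simp [Matrix.mul_apply, Fin.sum_univ_succ] <;> grind)

theorem intervalGrc_spec : intervalGrc.NotLCIExactlyAtOrigin ∧ intervalGrc.IsoTo dependentOrthogonalIdealG := by
  refine conclusion_of_parametrization isQuadricCone_dependentOrthogonalIdealG (c := 3) rfl (by decide)
    (fun e => (![![(4, 1), (4, 2), (4, 3)], ![(5, 1), (5, 2), (5, 3)], ![(3, 0), (2, 0), (1, 0)]] : Fin 3 → Fin 3 → Fin 6 × Fin 6) e.1 e.2) (by decide) (by decide)
    (fun _ => 1) (fun _ => one_mul 1) ?_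
    (fun x => !![1, 0, 0, 0, 0, 0;
      x (2, 2), 0, 0, 1, 0, 0;
      x (2, 1), 0, 1, 0, 0, 0;
      x (2, 0), 1, 0, 0, 0, 0;
      0, x (0, 0), x (0, 1), x (0, 2), 0, 1;
      0, x (1, 0), x (1, 1), x (1, 2), 1, 0]) ?_ ?_ (w := 1) ?_
    (fun x => !![1, 0, x (0, 1), -1, 0, 0;
      0, 1, -(x (0, 1) * x (2, 0)), x (2, 0), -1, 0;
      0, 0, x (0, 0) * x (2, 0), x (2, 1), 0, 0;
      0, 0, 0, x (2, 2), 0, -x (0, 0);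
      0, 0, 0, 0, x (1, 0), x (0, 2) * x (1, 0);
      0, 0, 0, 0, 0, x (0, 0) * x (0, 2)]) ?_ ?_ ?_
  · intro M hM hr p q hpq hb
    refine hr.apply_eq_zero p q ?_
    revert p q
    decide
  · intro z hz
    ext p q
    fin_cases p <;> fin_cases q <;> first
      | rfl | exact (one_mul _).symm | exact hz _ (by decide) (by decide)
  · rintro x hr _ (rfl | rfl | rfl | rfl | rfl)
    · have h := hr.two (r := 4) (r' := 5) (c := 1) (c' := 2) 4 2
        (by decide) (by decide) (by decide) (by decide) (by decide)
      simp at h ⊢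
      linear_combination h
    · have h := hr.two (r := 4) (r' := 5) (c := 1) (c' := 3) 4 3
        (by decide) (by decide) (by decide) (by decide) (by decide)
      simp at h ⊢
      linear_combination h
    · have h := hr.two (r := 4) (r' := 5) (c := 2) (c' := 3) 4 3
        (by decide) (by decide) (by decide) (by decide) (by decide)
      simp at h ⊢
      linear_combination h
    · have h := hr.four (R := ![1, 2, 3, 4]) (C := ![0, 1, 2, 3]) 1 3
        (by decide) (by decide) (by decide) (a0 := x (2, 2)) (a1 := x (2, 1)) (a2 := x (2, 0)) (a3 := x (0, 0)) (a4 := x (0, 1)) (a5 := x (0, 2))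
        (by ext i j; fin_cases i <;> fin_cases j <;> rfl)
      simp
      linear_combination h
    · have h := hr.four (R := ![1, 2, 3, 5]) (C := ![0, 1, 2, 3]) 1 3
        (by decide) (by decide) (by decide) (a0 := x (2, 2)) (a1 := x (2, 1)) (a2 := x (2, 0)) (a3 := x (1, 0)) (a4 := x (1, 1)) (a5 := x (1, 2))
        (by ext i j; fin_cases i <;> fin_cases j <;> rfl)
      simp
      linear_combination h
  · exact (Ideal.ne_top_iff_one _).1 isQuadricCone_dependentOrthogonalIdealG.isPrime.ne_top
  · intro x k q h
    fin_cases q <;> fin_cases k <;> first | rfl | exact absurd h (by decide)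
  · intro x hx hw q
    fin_cases q <;> simp [hx]
  · intro x hx _ p q h
    simp only [Set.mem_insert_iff, Set.mem_singleton_iff, forall_eq_or_imp, forall_eq,
      map_sub, map_add, map_mul, eval_X] at hx
    obtain ⟨h1, h2, h3, h4, h5⟩ := hx
    fin_cases q <;> fin_cases p <;> first
      | exact absurd h (by decide)
      | (simp [Matrix.mul_apply, Fin.sum_univ_succ] <;> grind)

/-- The pattern of G with two bottom rows instead of one: their dependence is a rank condition on
rows `5` and `6`, and the four pairings come from the four choices of a left column and a bottom
row. -/
theorem intervalH_spec : intervalH.NotLCIExactlyAtOrigin ∧ intervalH.IsoTo dependentOrthogonalIdealH := by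
  refine conclusion_of_parametrization isQuadricCone_dependentOrthogonalIdealH (c := 5) rfl (by decide)
    (fun e => (![![(2, 0), (3, 0), (4, 0)], ![(2, 1), (3, 1), (4, 1)], ![(5, 4), (5, 3), (5, 2)], ![(6, 4), (6, 3), (6, 2)]] : Fin 4 → Fin 3 → Fin 7 × Fin 7) e.1 e.2) (by decide) (by decide)
    (fun _ => 1) (fun _ => one_mul 1) ?_
    (fun x => !![0, 1, 0, 0, 0, 0, 0;
      1, 0, 0, 0, 0, 0, 0;
      x (0, 0), x (1, 0), 0, 0, 1, 0, 0;
      x (0, 1), x (1, 1), 0, 1, 0, 0, 0;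
      x (0, 2), x (1, 2), 1, 0, 0, 0, 0;
      0, 0, x (2, 2), x (2, 1), x (2, 0), 0, 1;
      0, 0, x (3, 2), x (3, 1), x (3, 0), 1, 0]) ?_ ?_ (w := 1) ?_
    (fun x => !![1, -x (1, 0), 0, x (2, 1), 0, 0, 0;
      0, x (0, 0), 0, 0, -x (0, 0), 0, 0;
      0, 0, 1, -(x (0, 2) * x (2, 1)), x (0, 2) * x (1, 0), -1, 0;
      0, 0, 0, x (0, 2) * x (2, 2), x (0, 1) * x (1, 0), 0, 0;
      0, 0, 0, 0, x (0, 0) * x (1, 0), 0, -1;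
      0, 0, 0, 0, 0, x (3, 2), x (3, 0);
      0, 0, 0, 0, 0, 0, x (2, 0)]) ?_ ?_ ?_
  · intro M hM hr p q hpq hb
    refine hr.apply_eq_zero p q ?_
    revert p q
    decide
  · intro z hz
    ext p q
    fin_cases p <;> fin_cases q <;> first
      | rfl | exact (one_mul _).symm | exact hz _ (by decide) (by decide)
  · rintro x hr _ (rfl | rfl | rfl | rfl | rfl | rfl | rfl | rfl | rfl | rfl)
    · have h := hr.two (r := 2) (r' := 3) (c := 0) (c' := 1) 2 1
        (by decide) (by decide) (by decide) (by decide) (by decide)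
      simp at h ⊢
      linear_combination h
    · have h := hr.two (r := 2) (r' := 4) (c := 0) (c' := 1) 2 1
        (by decide) (by decide) (by decide) (by decide) (by decide)
      simp at h ⊢
      linear_combination h
    · have h := hr.two (r := 3) (r' := 4) (c := 0) (c' := 1) 2 1
        (by decide) (by decide) (by decide) (by decide) (by decide)
      simp at h ⊢
      linear_combination h
    · have h := hr.two (r := 5) (r' := 6) (c := 3) (c' := 4) 5 4
        (by decide) (by decide) (by decide) (by decide) (by decide)
      simp at h ⊢
      linear_combination -h
    · have h := hr.two (r := 5) (r' := 6) (c := 2) (c' := 4) 5 4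
        (by decide) (by decide) (by decide) (by decide) (by decide)
      simp at h ⊢
      linear_combination -h
    · have h := hr.two (r := 5) (r' := 6) (c := 2) (c' := 3) 5 3
        (by decide) (by decide) (by decide) (by decide) (by decide)
      simp at h ⊢
      linear_combination -h
    · have h := hr.four (R := ![2, 3, 4, 5]) (C := ![0, 2, 3, 4]) 2 4
        (by decide) (by decide) (by decide) (a0 := x (0, 0)) (a1 := x (0, 1)) (a2 := x (0, 2)) (a3 := x (2, 2)) (a4 := x (2, 1)) (a5 := x (2, 0))
        (by ext i j; fin_cases i <;> fin_cases j <;> rfl)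
      simp
      linear_combination h
    · have h := hr.four (R := ![2, 3, 4, 5]) (C := ![1, 2, 3, 4]) 2 4
        (by decide) (by decide) (by decide) (a0 := x (1, 0)) (a1 := x (1, 1)) (a2 := x (1, 2)) (a3 := x (2, 2)) (a4 := x (2, 1)) (a5 := x (2, 0))
        (by ext i j; fin_cases i <;> fin_cases j <;> rfl)
      simp
      linear_combination h
    · have h := hr.four (R := ![2, 3, 4, 6]) (C := ![0, 2, 3, 4]) 2 4
        (by decide) (by decide) (by decide) (a0 := x (0, 0)) (a1 := x (0, 1)) (a2 := x (0, 2)) (a3 := x (3, 2)) (a4 := x (3, 1)) (a5 := x (3, 0))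
        (by ext i j; fin_cases i <;> fin_cases j <;> rfl)
      simp
      linear_combination h
    · have h := hr.four (R := ![2, 3, 4, 6]) (C := ![1, 2, 3, 4]) 2 4
        (by decide) (by decide) (by decide) (a0 := x (1, 0)) (a1 := x (1, 1)) (a2 := x (1, 2)) (a3 := x (3, 2)) (a4 := x (3, 1)) (a5 := x (3, 0))
        (by ext i j; fin_cases i <;> fin_cases j <;> rfl)
      simp
      linear_combination h
  · exact (Ideal.ne_top_iff_one _).1 isQuadricCone_dependentOrthogonalIdealH.isPrime.ne_top
  · intro x k q h
    fin_cases q <;> fin_cases k <;> first | rfl | exact absurd h (by decide)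
  · intro x hx hw q
    fin_cases q <;> simp [hx]
  · intro x hx _ p q h
    simp only [Set.mem_insert_iff, Set.mem_singleton_iff, forall_eq_or_imp, forall_eq,
      map_sub, map_add, map_mul, eval_X] at hx
    obtain ⟨h1, h2, h3, h4, h5, h6, h7, h8, h9, h10⟩ := hx
    fin_cases q <;> fin_cases p <;> first
      | exact absurd h (by decide)
      | (simp [Matrix.mul_apply, Fin.sum_univ_succ] <;> grind)

end SchubertLCI

end

/-! ### Family A. -/

noncomputable section

namespace SchubertLCI

open Matrix MvPolynomial

theorem length_desc (x y : ℕ) : (desc x y).length = x + 1 - y := by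
  simp [desc]

theorem getElem_desc (x y i : ℕ) (h : i < (desc x y).length) : (desc x y)[i] = x - i := by
  rw [length_desc] at h
  simp only [desc, List.getElem_reverse, List.getElem_range', List.length_range']
  omega

theorem mem_diagram_iff {n : ℕ} {u : Equiv.Perm (Fin n)} (hu : ∀ q, u (u q) = q) (p q : Fin n) :
    (p, q) ∈ diagram u ↔ (u q : ℕ) < p ∧ (q : ℕ) < u p := by
  have : u.symm p = u p := by rw [Equiv.symm_apply_eq, hu]
  change u q < p ∧ q < u.symm p ↔ _
  rw [this]
  rfl

/-- The entries of a matrix, extended by zero. -/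
def zeroExt {m k : ℕ} (x : Fin m × Fin k → ℂ) (i j : ℕ) : ℂ :=
  if h : i < m ∧ j < k then x (⟨i, h.1⟩, ⟨j, h.2⟩) else 0

section ZeroExt

variable {m k : ℕ} {x : Fin m × Fin k → ℂ}

theorem zeroExt_coe (i : Fin m) (j : Fin k) : zeroExt x i j = x (i, j) :=
  dif_pos ⟨i.2, j.2⟩

theorem zeroExt_ne_zero (hx : ∀ e, x e ≠ 0) {i j : ℕ} (hi : i < m) (hj : j < k) :
    zeroExt x i j ≠ 0 := by
  rw [zeroExt, dif_pos ⟨hi, hj⟩]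
  exact hx _

theorem zeroExt_minor (hx : ∀ i i' j j', x (i, j) * x (i', j') = x (i, j') * x (i', j))
    (i i' j j' : ℕ) :
    zeroExt x i j * zeroExt x i' j' = zeroExt x i j' * zeroExt x i' j := by
  by_cases hi : i < m <;> by_cases hi' : i' < m <;> by_cases hj : j < k <;>
    by_cases hj' : j' < k <;> simp [zeroExt, hi, hi', hj, hj']
  exact hx _ _ _ _

end ZeroExt

theorem rankLeOne_eval_eq {m k : ℕ} {x : Fin m × Fin k → ℂ}
    (hx : ∀ f ∈ {f | ∃ (i i' : Fin m) (j j' : Fin k),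
      f = X (i, j) * X (i', j') - X (i, j') * X (i', j)}, eval x f = 0) (i i' : Fin m)
    (j j' : Fin k) : x (i, j) * x (i', j') = x (i, j') * x (i', j) := by
  have := hx _ ⟨i, i', j, j', rfl⟩
  simpa [sub_eq_zero] using this

section FamilyA

variable (a b : ℕ)

def familyALo : Equiv.Perm (Fin (a + b + 2)) := (familyA a b).lo

def familyAHi : Equiv.Perm (Fin (a + b + 2)) := (familyA a b).hi

theorem familyA_lo_apply (q : Fin (a + b + 2)) :
    (familyALo a b q : ℕ) = if (q : ℕ) ≤ a then a - q else 2 * a + b + 2 - q := by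
  have hq := q.2
  change (desc (a + 1) 1 ++ desc (a + b + 2) (a + 2))[(q : ℕ)]'(by
    simp [length_desc]; omega) - 1 = _
  simp only [List.getElem_append, getElem_desc, length_desc]
  split_ifs <;> omega

theorem familyA_hi_apply (q : Fin (a + b + 2)) :
    (familyAHi a b q : ℕ) = if (q : ℕ) = 0 then a + b + 1 else if (q : ℕ) ≤ a then a + 1 - q
      else if (q : ℕ) = a + b + 1 then 0 else 2 * a + b + 1 - q := by
  have hq := q.2
  change ([a + b + 2] ++ desc (a + 1) 2 ++ desc (a + b + 1) (a + 2) ++ [1])[(q : ℕ)]'(by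
    simp [length_desc]; omega) - 1 = _
  simp only [List.getElem_append, getElem_desc, length_desc, List.length_append,
    List.length_singleton, List.getElem_singleton]
  split_ifs <;> omega

theorem familyA_lo_lo (q : Fin (a + b + 2)) : familyALo a b (familyALo a b q) = q := by
  have hq := q.2
  ext
  rw [familyA_lo_apply, familyA_lo_apply]
  split_ifs <;> omega

theorem familyA_mem_diagram (p q : Fin (a + b + 2)) :
    (p, q) ∈ diagram (familyALo a b) ↔ a < p ∧ (q : ℕ) ≤ a := by
  have hq := q.2
  have hp := p.2
  refine (mem_diagram_iff (familyA_lo_lo a b) p q).trans ?_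
  rw [familyA_lo_apply, familyA_lo_apply]
  split_ifs <;> omega

/-- The position of a variable. -/
def familyAPos (e : Fin (a + 1) × Fin (b + 1)) : Fin (a + b + 2) × Fin (a + b + 2) :=
  (⟨a + 1 + e.2, by omega⟩, ⟨e.1, by omega⟩)

def familyAEntry (x : ℕ → ℕ → ℂ) (p q : ℕ) : ℂ :=
  if p = (if q ≤ a then a - q else 2 * a + b + 2 - q) then 1
  else if a < p ∧ q ≤ a then x q (p - a - 1) else 0

/-- Column operations that bring a generic point to the Schubert cell. -/
def familyACol (x : ℕ → ℕ → ℂ) (k q : ℕ) : ℂ :=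
  if q = 0 then if k = 0 then 1 else 0
  else if q ≤ a then if k = q then x (q - 1) 0 else if k + 1 = q then -x q 0 else 0
  else if k = a then 1 else if a < k ∧ k ≤ q then -x a (a + b + 1 - k) else 0

/-- For `0 < q ≤ a` two neighbouring columns are combined so that their parts in the block cancel by
a two by two minor. For `q > a` the unit columns `a + 1, …, q` clear column `a` from the bottom
upwards, and for the last `q` only its `1` in row `0` is left. -/
theorem familyA_sum_eq_zero {x : ℕ → ℕ → ℂ}
    (hx : ∀ i i' j j', x i j * x i' j' = x i j' * x i' j) (p q : Fin (a + b + 2))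
    (h : (familyAHi a b q : ℕ) < p) :
    ∑ k : Fin (a + b + 2), familyAEntry a b x p k * familyACol a b x k q = 0 := by
  have hp := p.2
  have hq := q.2
  rw [familyA_hi_apply] at h
  by_cases hq0 : (q : ℕ) = 0
  · rw [if_pos hq0] at h
    omega
  rw [if_neg hq0] at h
  by_cases hqa : (q : ℕ) ≤ a
  · rw [if_pos hqa] at h
    rw [Fintype.sum_eq_add q ⟨q - 1, by omega⟩ (by simp [Fin.ext_iff]; omega) ?_]
    · simp only [familyAEntry, familyACol]
      split_ifs <;> first | omega | skip
      · rw [hx]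
        ring
      · simp
    · rintro k ⟨h1, h2⟩
      simp only [ne_eq, Fin.ext_iff] at h1 h2
      simp only [familyACol]
      split_ifs <;> first | omega | simp
  · have h : 0 < (p : ℕ) ∧ 2 * a + b + 1 - q < p ∨ 0 < (p : ℕ) ∧ (q : ℕ) = a + b + 1 := by
      split_ifs at h <;> omega
    by_cases hpa : (p : ℕ) ≤ a
    · refine Finset.sum_eq_zero fun k _ => ?_
      simp only [familyAEntry, familyACol]
      split_ifs <;> first | omega | simp
    · rw [Fintype.sum_eq_add ⟨a, by omega⟩ ⟨2 * a + b + 2 - p, by omega⟩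
        (by simp [Fin.ext_iff]; omega) ?_]
      · have h1 : a + b + 1 - (2 * a + b + 2 - (p : ℕ)) = p - a - 1 := by omega
        simp only [familyAEntry, familyACol, h1]
        split_ifs <;> first | omega | simp
      · rintro k ⟨h1, h2⟩
        simp only [ne_eq, Fin.ext_iff] at h1 h2
        simp only [familyAEntry, familyACol]
        split_ifs <;> first | omega | simp

/-- The diagram of `u` is the whole block of rows below `a` and columns up to `a`, so no coordinate
is superfluous. The permutation `v` has a single `1` in this block, in column `0`, so the block has
rank at most one. -/
theorem familyA_spec (hab : a * b < (a + 1).choose 2 * (b + 1).choose 2) :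
    (familyA a b).NotLCIExactlyAtOrigin ∧ (familyA a b).IsoTo (rankLeOneIdeal (a + 1) (b + 1)) := by
  refine conclusion_of_parametrization (u := familyALo a b) (v := familyAHi a b)
    (isQuadricCone_rankLeOneIdeal a b) (c := a * b)
    (by simp; ring) hab (familyAPos a b) ?_ ?_ (fun _ => 1) (fun _ => one_mul 1) ?_
    (fun x => Matrix.of fun p q => familyAEntry a b (zeroExt x) p q) ?_ ?_ (w := 1) ?_
    (fun x => Matrix.of fun p q => familyACol a b (zeroExt x) p q) ?_ ?_ ?_
  · rintro ⟨i, j⟩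
    refine (familyA_mem_diagram a b _ _).2 ?_
    simp only
    omega
  · rintro ⟨i, j⟩ ⟨i', j'⟩ h
    simp only [familyAPos, Prod.mk.injEq, Fin.mk.injEq] at h
    refine Prod.ext (Fin.ext ?_) (Fin.ext ?_) <;> simp only <;> omega
  · intro M _ _ p q hpq hb
    rw [familyA_mem_diagram] at hpq
    refine absurd ?_ (hb (⟨q, by omega⟩, ⟨p - a - 1, by have := p.2; omega⟩))
    exact Prod.ext (Fin.ext (show a + 1 + ((p : ℕ) - a - 1) = p by omega)) rfl
  · intro z _
    ext p q
    simp only [cellMatrix, of_apply, familyAEntry, Fin.ext_iff, familyA_lo_apply]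
    congr 1
    by_cases h : (p, q) ∈ diagram (familyALo a b)
    · have h' := (familyA_mem_diagram a b p q).1 h
      have hp := p.2
      rw [dif_pos h, if_pos h', zeroExt, dif_pos ⟨by omega, by omega⟩, one_mul]
      congr 1
      exact Prod.ext (Fin.ext (show (p : ℕ) = a + 1 + ((p : ℕ) - a - 1) by omega)) rfl
    · rw [dif_neg h, if_neg (fun h' => h ((familyA_mem_diagram a b p q).2 h'))]
  · rintro x hr _ ⟨i, i', j, j', rfl⟩
    have hN : ∀ (i : Fin (a + 1)) (j : Fin (b + 1)), familyAEntry a b (zeroExt x)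
        (familyAPos a b (i, j)).1 (familyAPos a b (i, j)).2 = x (i, j) := by
      intro i j
      rw [← zeroExt_coe (x := x)]
      change familyAEntry a b (zeroExt x) (a + 1 + j) i = _
      have h1 : a + 1 + (j : ℕ) - a - 1 = j := by omega
      have hi := i.2
      rw [familyAEntry, h1, if_pos (by omega : (i : ℕ) ≤ a), if_neg (by omega), if_pos (by omega)]
    have := hr.two (r := (familyAPos a b (i, j)).1) (r' := (familyAPos a b (i', j')).1)
      (c := (familyAPos a b (i, j)).2) (c' := (familyAPos a b (i', j')).2)
      ⟨a + 1, by omega⟩ ⟨a, by omega⟩ (by simp only [familyAPos, Fin.mk_le_mk]; omega)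
      (by simp only [familyAPos, Fin.mk_le_mk]; omega)
      (by simp only [familyAPos, Fin.mk_le_mk]; omega)
      (by simp only [familyAPos, Fin.mk_le_mk]; omega) ?_
    · simp only [of_apply] at this
      have h1 := hN i j
      have h2 := hN i' j'
      have h3 := hN i' j
      have h4 := hN i j'
      simp only [familyAPos] at this h1 h2 h3 h4
      rw [h1, h2, h3, h4] at this
      simp only [map_sub, map_mul, eval_X]
      linear_combination this
    · refine (Finset.card_le_card (t := {0}) fun k hk => ?_).trans_lt (by simp)
      simp only [Finset.mem_filter, Finset.mem_univ, true_and, Fin.le_def] at hk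
      rw [familyA_hi_apply] at hk
      simp only [Finset.mem_singleton, Fin.ext_iff, Fin.val_zero]
      split_ifs at hk <;> omega
  · exact (Ideal.ne_top_iff_one _).1 (isQuadricCone_rankLeOneIdeal a b).isPrime.ne_top
  · intro x k q h
    simp only [of_apply, familyACol]
    have : (q : ℕ) < k := h
    split_ifs <;> first | omega | rfl
  · intro x hx _ q
    have hq := q.2
    simp only [of_apply, familyACol]
    split_ifs <;> first | omega | exact one_ne_zero | skip
    · exact zeroExt_ne_zero hx (by omega) (by omega)
    · exact neg_ne_zero.2 (zeroExt_ne_zero hx (by omega) (by omega))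
  · intro x hx _ p q h
    rw [Matrix.mul_apply]
    exact familyA_sum_eq_zero a b (zeroExt_minor (rankLeOne_eval_eq hx)) p q h

end FamilyA

end SchubertLCI

end

/-! ### Family B. -/

noncomputable section

namespace SchubertLCI

open Matrix MvPolynomial

section FamilyB

variable (a b : ℕ)

def familyBLo : Equiv.Perm (Fin (a + b + 4)) := (familyB a b).lo

def familyBHi : Equiv.Perm (Fin (a + b + 4)) := (familyB a b).hi

theorem familyB_lo_apply (q : Fin (a + b + 4)) :
    (familyBLo a b q : ℕ) = if (q : ℕ) ≤ a then a - q else if (q : ℕ) ≤ a + 2 then 2 * a + 3 - q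
      else 2 * a + b + 6 - q := by
  have hq := q.2
  change (desc (a + 1) 1 ++ [a + 3] ++ [a + 2] ++ desc (a + b + 4) (a + 4))[(q : ℕ)]'(by
    simp [length_desc]; omega) - 1 = _
  simp only [List.getElem_append, getElem_desc, length_desc, List.length_append,
    List.length_singleton, List.getElem_singleton]
  split_ifs <;> omega

theorem familyB_hi_apply (q : Fin (a + b + 4)) :
    (familyBHi a b q : ℕ) = if (q : ℕ) = 0 then a + 2 else if (q : ℕ) ≤ a then a + 1 - q
      else if (q : ℕ) = a + 1 then a + b + 3 else if (q : ℕ) = a + 2 then 0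
      else if (q : ℕ) = a + b + 3 then a + 1 else 2 * a + b + 5 - q := by
  have hq := q.2
  change ([a + 3] ++ desc (a + 1) 2 ++ [a + b + 4] ++ [1] ++ desc (a + b + 3) (a + 4) ++
    [a + 2])[(q : ℕ)]'(by simp [length_desc]; omega) - 1 = _
  simp only [List.getElem_append, getElem_desc, length_desc, List.length_append,
    List.length_singleton, List.getElem_singleton]
  split_ifs <;> omega

theorem familyB_lo_lo (q : Fin (a + b + 4)) : familyBLo a b (familyBLo a b q) = q := by
  have hq := q.2
  ext
  rw [familyB_lo_apply, familyB_lo_apply]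
  split_ifs <;> omega

theorem familyB_mem_diagram (p q : Fin (a + b + 4)) :
    (p, q) ∈ diagram (familyBLo a b) ↔
      a < p ∧ (q : ℕ) ≤ a ∨ a + 3 ≤ (p : ℕ) ∧ (q : ℕ) ≤ a + 2 := by
  have hq := q.2
  have hp := p.2
  refine (mem_diagram_iff (familyB_lo_lo a b) p q).trans ?_
  rw [familyB_lo_apply, familyB_lo_apply]
  split_ifs <;> omega

/-- The position of a variable. -/
def familyBPos (e : Fin (a + b + 2) × Fin 2) : Fin (a + b + 4) × Fin (a + b + 4) :=
  if h : (e.1 : ℕ) ≤ a then (⟨a + 1 + e.2, by omega⟩, ⟨e.1, by omega⟩)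
  else (⟨e.1 + 2, by omega⟩, ⟨a + 1 + e.2, by omega⟩)

/-- The sign of a variable. -/
def familyBSign (e : Fin (a + b + 2) × Fin 2) : ℂ :=
  if a < (e.1 : ℕ) ∧ e.2 = 0 then -1 else 1

def familyBEntry (x : ℕ → ℕ → ℂ) (p q : ℕ) : ℂ :=
  if p = (if q ≤ a then a - q else if q ≤ a + 2 then 2 * a + 3 - q else 2 * a + b + 6 - q) then 1
  else if a < p ∧ p ≤ a + 2 ∧ q ≤ a then x q (p - a - 1)
  else if a + 3 ≤ p ∧ q = a + 1 then -x (p - 2) 0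
  else if a + 3 ≤ p ∧ q = a + 2 then x (p - 2) 1 else 0

/-- Column operations that bring a generic point to the Schubert cell. -/
def familyBCol (x : ℕ → ℕ → ℂ) (k q : ℕ) : ℂ :=
  if q = 0 then if k = 0 then 1 else 0
  else if q ≤ a then if k = q then x (q - 1) 0 else if k + 1 = q then -x q 0 else 0
  else if q = a + 1 then if k = a + 1 then 1 else 0
  else if q = a + 2 then
    if k = a then 1 else if k = a + 1 then -x a 1 else if k = a + 2 then -x a 0 else 0
  else if k = a then if q = a + b + 3 then -1 else 0
  else if k = a + 1 then x a 1
  else if a + 3 ≤ k ∧ k ≤ q then x a 1 * x (2 * a + b + 4 - k) 0 else 0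

theorem familyB_sum_eq_zero_of_le {x : ℕ → ℕ → ℂ}
    (hx : ∀ i i' j j', x i j * x i' j' = x i j' * x i' j) (p q : Fin (a + b + 4))
    (hq0 : (q : ℕ) ≠ 0) (hqa : (q : ℕ) ≤ a) (h : a + 1 - q < (p : ℕ)) :
    ∑ k : Fin (a + b + 4), familyBEntry a b x p k * familyBCol a b x k q = 0 := by
  have hp := p.2
  have hq := q.2
  rw [Fintype.sum_eq_add q ⟨q - 1, by omega⟩ (by simp [Fin.ext_iff]; omega) ?_]
  · simp only [familyBEntry, familyBCol]
    split_ifs <;> first | omega | skip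
    · rw [hx]
      ring
    · simp
  · rintro k ⟨h1, h2⟩
    simp only [ne_eq, Fin.ext_iff] at h1 h2
    simp only [familyBCol]
    split_ifs <;> first | omega | simp

theorem familyBEntry_of_le (x : ℕ → ℕ → ℂ) {p q : ℕ} (hp : a < p) (hp' : p ≤ a + 2) (hq : q ≤ a) :
    familyBEntry a b x p q = x q (p - a - 1) := by
  rw [familyBEntry, if_neg (by rw [if_pos hq]; omega), if_pos ⟨hp, hp', hq⟩]

theorem familyBEntry_add_one (x : ℕ → ℕ → ℂ) {p : ℕ} (hp : a + 3 ≤ p) :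
    familyBEntry a b x p (a + 1) = -x (p - 2) 0 := by
  rw [familyBEntry, if_neg (by split_ifs <;> omega), if_neg (by omega), if_pos ⟨hp, rfl⟩]

theorem familyBEntry_add_two (x : ℕ → ℕ → ℂ) {p : ℕ} (hp : a + 3 ≤ p) :
    familyBEntry a b x p (a + 2) = x (p - 2) 1 := by
  rw [familyBEntry, if_neg (by split_ifs <;> omega), if_neg (by omega), if_neg (by omega),
    if_pos ⟨hp, rfl⟩]

theorem familyBEntry_eq_zero (x : ℕ → ℕ → ℂ) {p q : ℕ}
    (h : p ≠ if q ≤ a then a - q else if q ≤ a + 2 then 2 * a + 3 - q else 2 * a + b + 6 - q)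
    (h' : p ≤ a ∨ p ≤ a + 2 ∧ a < q ∨ q ≤ a ∧ a + 3 ≤ p ∨ a + 3 ≤ q) :
    familyBEntry a b x p q = 0 := by
  rw [familyBEntry, if_neg h, if_neg (by omega), if_neg (by omega), if_neg (by omega)]

theorem familyBEntry_eq_one (x : ℕ → ℕ → ℂ) {p q : ℕ}
    (h : p = if q ≤ a then a - q else if q ≤ a + 2 then 2 * a + 3 - q else 2 * a + b + 6 - q) :
    familyBEntry a b x p q = 1 :=
  if_pos h

theorem familyBCol_add_two (x : ℕ → ℕ → ℂ) (k : ℕ) : familyBCol a b x k (a + 2) =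
    if k = a then 1 else if k = a + 1 then -x a 1 else if k = a + 2 then -x a 0 else 0 := by
  rw [familyBCol, if_neg (by omega), if_neg (by omega), if_neg (by omega), if_pos rfl]

theorem familyBCol_of_lt (x : ℕ → ℕ → ℂ) {k q : ℕ} (hq : a + 2 < q) : familyBCol a b x k q =
    if k = a then if q = a + b + 3 then -1 else 0
    else if k = a + 1 then x a 1
    else if a + 3 ≤ k ∧ k ≤ q then x a 1 * x (2 * a + b + 4 - k) 0 else 0 := by
  rw [familyBCol, if_neg (by omega), if_neg (by omega), if_neg (by omega), if_neg (by omega)]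

/-- The ones of columns `a + 1` and `a + 2` clear column `a` in rows `a + 2` and `a + 1`. What this
introduces further down is a two by two minor of the model, hence zero. -/
theorem familyB_sum_eq_zero_of_eq {x : ℕ → ℕ → ℂ}
    (hx : ∀ i i' j j', x i j * x i' j' = x i j' * x i' j) (p : Fin (a + b + 4))
    (h : 0 < (p : ℕ)) :
    ∑ k : Fin (a + b + 4), familyBEntry a b x p k * familyBCol a b x k (a + 2) = 0 := by
  have hp := p.2
  simp only [familyBCol_add_two]
  have key : familyBEntry a b x p a - familyBEntry a b x p (a + 1) * x a 1 -
      familyBEntry a b x p (a + 2) * x a 0 = 0 := by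
    rcases (by omega : (p : ℕ) ≤ a ∨ (p : ℕ) = a + 1 ∨ (p : ℕ) = a + 2 ∨ a + 3 ≤ (p : ℕ)) with
      hpa | hpa | hpa | hpa
    · rw [familyBEntry_eq_zero a b x (q := a) (by split_ifs <;> omega) (by omega),
        familyBEntry_eq_zero a b x (q := a + 1) (by split_ifs <;> omega) (by omega),
        familyBEntry_eq_zero a b x (q := a + 2) (by split_ifs <;> omega) (by omega)]
      ring
    · rw [familyBEntry_of_le a b x (by omega) (by omega) le_rfl,
        familyBEntry_eq_zero a b x (q := a + 1) (by split_ifs <;> omega) (by omega),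
        familyBEntry_eq_one a b x (q := a + 2) (by split_ifs <;> omega),
        (by omega : (p : ℕ) - a - 1 = 0)]
      ring
    · rw [familyBEntry_of_le a b x (by omega) (by omega) le_rfl,
        familyBEntry_eq_one a b x (q := a + 1) (by split_ifs <;> omega),
        familyBEntry_eq_zero a b x (q := a + 2) (by split_ifs <;> omega) (by omega),
        (by omega : (p : ℕ) - a - 1 = 1)]
      ring
    · rw [familyBEntry_eq_zero a b x (q := a) (by split_ifs <;> omega) (by omega),
        familyBEntry_add_one a b x hpa, familyBEntry_add_two a b x hpa]
      linear_combination hx (p - 2) a 0 1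
  rw [← Finset.sum_subset (Finset.subset_univ
    {⟨a, by omega⟩, ⟨a + 1, by omega⟩, ⟨a + 2, by omega⟩})]
  · rw [Finset.sum_insert (by simp [Fin.ext_iff]), Finset.sum_insert (by simp [Fin.ext_iff]),
      Finset.sum_singleton]
    simp only [if_pos, if_neg (by omega : a + 1 ≠ a), if_neg (by omega : a + 2 ≠ a),
      if_neg (by omega : a + 2 ≠ a + 1)]
    linear_combination key
  · intro k _ hk
    simp only [Finset.mem_insert, Finset.mem_singleton, Fin.ext_iff, not_or] at hk
    rw [if_neg hk.1, if_neg hk.2.1, if_neg hk.2.2, mul_zero]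

/-- A multiple of column `a + 1` is cleared from the bottom upwards by unit columns. For the last
`q` the entry in row `a + 2` has to disappear as well, and subtracting column `a` removes it. -/
theorem familyB_sum_eq_zero_of_lt (x : ℕ → ℕ → ℂ) (p q : Fin (a + b + 4))
    (hqa : a + 2 < (q : ℕ)) (h : a + 3 ≤ (p : ℕ) ∧ 2 * a + b + 5 - q < p ∨
      a + 2 ≤ (p : ℕ) ∧ (q : ℕ) = a + b + 3) :
    ∑ k : Fin (a + b + 4), familyBEntry a b x p k * familyBCol a b x k q = 0 := by
  have hp := p.2
  have hq := q.2
  simp only [familyBCol_of_lt a b x hqa]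
  by_cases hpa : (p : ℕ) = a + 2
  · rw [Fintype.sum_eq_add ⟨a, by omega⟩ ⟨a + 1, by omega⟩ (by simp [Fin.ext_iff]) ?_]
    · simp only
      rw [familyBEntry_of_le a b x (by omega) (by omega) le_rfl,
        familyBEntry_eq_one a b x (by split_ifs <;> omega), if_pos trivial, if_pos (by omega),
        if_neg (by omega), if_pos trivial, (by omega : (p : ℕ) - a - 1 = 1)]
      ring
    · rintro k ⟨h1, h2⟩
      simp only [ne_eq, Fin.ext_iff] at h1 h2
      rw [if_neg h1, if_neg h2]
      split_ifs with h3
      · rw [familyBEntry_eq_zero a b x (by split_ifs <;> omega) (by omega), zero_mul]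
      · rw [mul_zero]
  · rw [Fintype.sum_eq_add ⟨a + 1, by omega⟩ ⟨2 * a + b + 6 - p, by omega⟩
      (by simp only [ne_eq, Fin.ext_iff]; omega) ?_]
    · simp only
      rw [familyBEntry_add_one a b x (by omega), familyBEntry_eq_one a b x (by split_ifs <;> omega),
        if_neg (by omega), if_pos trivial, if_neg (by omega), if_neg (by omega), if_pos (by omega),
        (by omega : 2 * a + b + 4 - (2 * a + b + 6 - (p : ℕ)) = p - 2)]
      ring
    · rintro k ⟨h1, h2⟩
      simp only [ne_eq, Fin.ext_iff] at h1 h2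
      by_cases h3 : (k : ℕ) = a
      · rw [familyBEntry_eq_zero a b x (by split_ifs <;> omega) (by omega), zero_mul]
      rw [if_neg h3, if_neg h1]
      split_ifs with h4
      · rw [familyBEntry_eq_zero a b x (by split_ifs <;> omega) (by omega), zero_mul]
      · rw [mul_zero]

theorem familyB_sum_eq_zero {x : ℕ → ℕ → ℂ}
    (hx : ∀ i i' j j', x i j * x i' j' = x i j' * x i' j) (p q : Fin (a + b + 4))
    (h : (familyBHi a b q : ℕ) < p) :
    ∑ k : Fin (a + b + 4), familyBEntry a b x p k * familyBCol a b x k q = 0 := by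
  have hp := p.2
  have hq := q.2
  rw [familyB_hi_apply] at h
  by_cases hq0 : (q : ℕ) = 0
  · rw [if_pos hq0] at h
    refine Finset.sum_eq_zero fun k _ => ?_
    simp only [familyBEntry, familyBCol]
    split_ifs <;> first | omega | simp
  rw [if_neg hq0] at h
  by_cases hqa : (q : ℕ) ≤ a
  · rw [if_pos hqa] at h
    exact familyB_sum_eq_zero_of_le a b hx p q hq0 hqa h
  rw [if_neg hqa] at h
  by_cases hq1 : (q : ℕ) = a + 1
  · rw [if_pos hq1] at h
    omega
  rw [if_neg hq1] at h
  by_cases hq2 : (q : ℕ) = a + 2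
  · rw [if_pos hq2] at h
    rw [hq2]
    exact familyB_sum_eq_zero_of_eq a b hx p h
  rw [if_neg hq2] at h
  refine familyB_sum_eq_zero_of_lt a b x p q (by omega) ?_
  split_ifs at h <;> omega

theorem familyBPos_of_le {i : Fin (a + b + 2)} (hi : (i : ℕ) ≤ a) (k : Fin 2) :
    familyBPos a b (i, k) = (⟨a + 1 + k, by omega⟩, ⟨i, by omega⟩) :=
  dif_pos hi

theorem familyBPos_of_lt {i : Fin (a + b + 2)} (hi : a < (i : ℕ)) (k : Fin 2) :
    familyBPos a b (i, k) = (⟨i + 2, by omega⟩, ⟨a + 1 + k, by omega⟩) :=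
  dif_neg (by simpa using hi)

theorem familyBPos_mem (e : Fin (a + b + 2) × Fin 2) :
    familyBPos a b e ∈ diagram (familyBLo a b) := by
  obtain ⟨i, k⟩ := e
  rcases le_or_gt (i : ℕ) a with h | h
  · rw [familyBPos_of_le a b h, familyB_mem_diagram]
    simp only
    omega
  · rw [familyBPos_of_lt a b h, familyB_mem_diagram]
    simp only
    omega

theorem familyBPos_injective : Function.Injective (familyBPos a b) := by
  rintro ⟨i, k⟩ ⟨i', k'⟩ h
  rcases le_or_gt (i : ℕ) a with hi | hi <;> rcases le_or_gt (i' : ℕ) a with hi' | hi' <;>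
    simp only [familyBPos_of_le, familyBPos_of_lt, hi, hi', Prod.mk.injEq, Fin.mk.injEq] at h <;>
    first
    | omega
    | obtain rfl : i = i' := Fin.ext (by omega)
      obtain rfl : k = k' := Fin.ext (by omega)
      rfl

/-- The model matrix consists of `a + 1` columns and `b + 1` rows of length two, all regarded as
rows. Two of the same kind give a two by two minor of the cell matrix. A column and a row are
related by the three by three minor through the two ones of `u` between them; the sign of the
coordinates in column `a + 1` makes this a minor of the model. -/
theorem familyBEntry_minor (x : ℕ → ℕ → ℂ)
    (h : RankConditions (familyBHi a b)
      (Matrix.of fun p q : Fin (a + b + 4) => familyBEntry a b x p q))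
    {i i' : ℕ} (hi : i ≤ i') (hi' : i' < a + b + 2) : x i 0 * x i' 1 = x i 1 * x i' 0 := by
  rcases le_or_gt i' a with h1 | h1
  · have := h.two (r := ⟨a + 1, by omega⟩) (r' := ⟨a + 2, by omega⟩) (c := ⟨i, by omega⟩)
      (c' := ⟨i', by omega⟩) ⟨a + 1, by omega⟩ ⟨a, by omega⟩ (by simp) (by simp)
      (by simp only [Fin.mk_le_mk]; omega) (by simp only [Fin.mk_le_mk]; omega) ?_
    · simp only [of_apply] at this
      rw [familyBEntry_of_le a b x (by omega) (by omega) (by omega),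
        familyBEntry_of_le a b x (by omega) (by omega) (by omega),
        familyBEntry_of_le a b x (by omega) (by omega) (by omega),
        familyBEntry_of_le a b x (by omega) (by omega) (by omega),
        (by omega : a + 1 - a - 1 = 0), (by omega : a + 2 - a - 1 = 1)] at this
      linear_combination this
    · refine (Finset.card_le_card (t := {0}) fun k hk => ?_).trans_lt (by simp)
      simp only [Finset.mem_filter, Finset.mem_univ, true_and, Fin.le_def] at hk
      rw [familyB_hi_apply] at hk
      simp only [Finset.mem_singleton, Fin.ext_iff, Fin.val_zero]
      split_ifs at hk <;> omega
  rcases le_or_gt i a with h2 | h2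
  · have := h.three (r := ⟨a + 1, by omega⟩) (r' := ⟨a + 2, by omega⟩) (r'' := ⟨i' + 2, by omega⟩)
      (c := ⟨i, by omega⟩) (c' := ⟨a + 1, by omega⟩) (c'' := ⟨a + 2, by omega⟩)
      ⟨a + 1, by omega⟩ ⟨a + 2, by omega⟩ (by simp) (by simp)
      (by simp only [Fin.mk_le_mk]; omega) (by simp only [Fin.mk_le_mk]; omega) (by simp)
      (by simp) ?_
    · simp only [of_apply] at this
      rw [familyBEntry_of_le a b x (p := a + 1) (q := i) (by omega) (by omega) (by omega),
        familyBEntry_of_le a b x (p := a + 2) (q := i) (by omega) (by omega) (by omega),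
        familyBEntry_eq_zero a b x (p := i' + 2) (q := i) (by split_ifs <;> omega) (by omega),
        familyBEntry_eq_zero a b x (p := a + 1) (q := a + 1) (by split_ifs <;> omega) (by omega),
        familyBEntry_eq_one a b x (p := a + 1) (q := a + 2) (by split_ifs <;> omega),
        familyBEntry_eq_one a b x (p := a + 2) (q := a + 1) (by split_ifs <;> omega),
        familyBEntry_eq_zero a b x (p := a + 2) (q := a + 2) (by split_ifs <;> omega) (by omega),
        familyBEntry_add_one a b x (by omega), familyBEntry_add_two a b x (by omega),
        (by omega : a + 1 - a - 1 = 0), (by omega : a + 2 - a - 1 = 1), Nat.add_sub_cancel] at this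
      linear_combination this
    · refine (Finset.card_le_card (t := {0, ⟨a + 1, by omega⟩}) fun k hk => ?_).trans_lt
        (Finset.card_le_two.trans_lt (by norm_num))
      simp only [Finset.mem_filter, Finset.mem_univ, true_and, Fin.le_def] at hk
      rw [familyB_hi_apply] at hk
      simp only [Finset.mem_insert, Finset.mem_singleton, Fin.ext_iff, Fin.val_zero]
      split_ifs at hk <;> omega
  · have := h.two (r := ⟨i + 2, by omega⟩) (r' := ⟨i' + 2, by omega⟩) (c := ⟨a + 1, by omega⟩)
      (c' := ⟨a + 2, by omega⟩) ⟨a + 3, by omega⟩ ⟨a + 2, by omega⟩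
      (by simp only [Fin.mk_le_mk]; omega) (by simp only [Fin.mk_le_mk]; omega) (by simp)
      (by simp) ?_
    · simp only [of_apply] at this
      rw [familyBEntry_add_one a b x (by omega), familyBEntry_add_two a b x (by omega),
        familyBEntry_add_one a b x (by omega), familyBEntry_add_two a b x (by omega),
        Nat.add_sub_cancel, Nat.add_sub_cancel] at this
      linear_combination -this
    · refine (Finset.card_le_card (t := {⟨a + 1, by omega⟩}) fun k hk => ?_).trans_lt (by simp)
      simp only [Finset.mem_filter, Finset.mem_univ, true_and, Fin.le_def] at hk
      rw [familyB_hi_apply] at hk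
      simp only [Finset.mem_singleton, Fin.ext_iff]
      split_ifs at hk <;> omega

theorem cellMatrix_familyB (z : Fin (a + b + 4) × Fin (a + b + 4) → ℂ)
    (hz : ∀ e ∈ diagram (familyBLo a b), (∀ i, familyBPos a b i ≠ e) → z e = 0) :
    cellMatrix (familyBLo a b) (fun e => z e) = Matrix.of fun p q : Fin (a + b + 4) =>
      familyBEntry a b (zeroExt fun i => familyBSign a b i * z (familyBPos a b i)) p q := by
  ext p q
  have hp := p.2
  simp only [cellMatrix, of_apply, familyBEntry, Fin.ext_iff, familyB_lo_apply]
  congr 1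
  by_cases h : (p, q) ∈ diagram (familyBLo a b)
  · have h' := (familyB_mem_diagram a b p q).1 h
    rw [dif_pos h]
    split_ifs with h1 h2 h3
    · rw [zeroExt, dif_pos ⟨by omega, by omega⟩, familyBPos_of_le a b h1.2.2, familyBSign,
        if_neg (by simp only; omega), one_mul]
      congr 1
      exact Prod.ext (Fin.ext (show (p : ℕ) = a + 1 + ((p : ℕ) - a - 1) by omega)) rfl
    · rw [zeroExt, dif_pos ⟨by omega, by omega⟩, familyBPos_of_lt a b (by simp only; omega),
        familyBSign, if_pos ⟨by simp only; omega, rfl⟩, neg_mul, neg_neg, one_mul]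
      congr 1
      exact Prod.ext (Fin.ext (show (p : ℕ) = p - 2 + 2 by omega)) (Fin.ext h2.2)
    · rw [zeroExt, dif_pos ⟨by omega, by omega⟩, familyBPos_of_lt a b (by simp only; omega),
        familyBSign, if_neg (by simp), one_mul]
      congr 1
      exact Prod.ext (Fin.ext (show (p : ℕ) = p - 2 + 2 by omega)) (Fin.ext h3.2)
    · refine hz _ h fun ⟨i, k⟩ hi => ?_
      rcases le_or_gt (i : ℕ) a with h4 | h4
      · rw [familyBPos_of_le a b h4, Prod.ext_iff, Fin.ext_iff, Fin.ext_iff] at hi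
        simp only at hi
        omega
      · rw [familyBPos_of_lt a b h4, Prod.ext_iff, Fin.ext_iff, Fin.ext_iff] at hi
        simp only at hi
        omega
  · have h' := mt (familyB_mem_diagram a b p q).2 h
    rw [dif_neg h, if_neg (by omega), if_neg (by omega), if_neg (by omega)]

/-- Below row `a + 2` and up to column `a` the permutation `v` has no `1`, so these coordinates
vanish. The others are the entries of the model matrix. -/
theorem familyB_spec (hab : 1 ≤ a + b) :
    (familyB a b).NotLCIExactlyAtOrigin ∧ (familyB a b).IsoTo (rankLeOneIdeal (a + b + 2) 2) := by
  have hc := isQuadricCone_rankLeOneIdeal (a + b + 1) 1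
  refine conclusion_of_parametrization (u := familyBLo a b) (v := familyBHi a b)
    hc (c := a + b + 1)
    (by simp; ring) ?_ (familyBPos a b) (familyBPos_mem a b) (familyBPos_injective a b)
    (familyBSign a b) ?_ ?_ (fun x => Matrix.of fun p q => familyBEntry a b (zeroExt x) p q)
    (cellMatrix_familyB a b) ?_ (w := 1) ?_
    (fun x => Matrix.of fun p q => familyBCol a b (zeroExt x) p q) ?_ ?_ ?_
  · rw [Nat.choose_self, mul_one, Nat.choose_two_right, Nat.add_sub_cancel]
    rw [Nat.lt_iff_add_one_le, Nat.le_div_iff_mul_le two_pos]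
    exact Nat.mul_le_mul_left _ (by omega)
  · intro e
    rw [familyBSign]
    split_ifs <;> ring
  · intro M _ hr p q hpq hb
    have hpq := (familyB_mem_diagram a b p q).1 hpq
    have hp := p.2
    refine hr.apply_eq_zero p q ?_
    rcases le_or_gt (q : ℕ) a with hq | hq
    · rcases le_or_gt (p : ℕ) (a + 2) with hp' | hp'
      · refine absurd ?_ (hb (⟨q, by omega⟩, ⟨p - a - 1, by omega⟩))
        rw [familyBPos_of_le a b hq]
        exact Prod.ext (Fin.ext (show a + 1 + ((p : ℕ) - a - 1) = p by omega)) rfl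
      · rw [Nat.lt_one_iff, Finset.card_eq_zero, Finset.filter_eq_empty_iff]
        intro k _ hk
        simp only [Fin.le_def] at hk
        rw [familyB_hi_apply] at hk
        split_ifs at hk <;> omega
    · refine absurd ?_ (hb (⟨p - 2, by omega⟩, ⟨q - a - 1, by omega⟩))
      rw [familyBPos_of_lt a b (by simp only; omega)]
      exact Prod.ext (Fin.ext (show (p : ℕ) - 2 + 2 = p by omega))
        (Fin.ext (show a + 1 + ((q : ℕ) - a - 1) = q by omega))
  · rintro x hr _ ⟨i, i', j, j', rfl⟩
    have key (i i' : Fin (a + b + 1 + 1)) : x (i, 0) * x (i', 1) = x (i, 1) * x (i', 0) := by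
      rcases le_total (i : ℕ) i' with h | h
      · have := familyBEntry_minor a b (zeroExt x) hr h i'.2
        exact (by simpa [zeroExt] using this)
      · have := familyBEntry_minor a b (zeroExt x) hr h i.2
        have : x (i', 0) * x (i, 1) = x (i', 1) * x (i, 0) := by simpa [zeroExt] using this
        linear_combination -this
    simp only [map_sub, map_mul, eval_X, sub_eq_zero]
    rcases Fin.exists_fin_two.1 ⟨j, rfl⟩ with rfl | rfl <;>
      rcases Fin.exists_fin_two.1 ⟨j', rfl⟩ with rfl | rfl <;>
      first | rfl | exact key i i' | exact (key i i').symm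
  · exact (Ideal.ne_top_iff_one _).1 hc.isPrime.ne_top
  · intro x k q h
    simp only [of_apply, familyBCol]
    have : (q : ℕ) < k := h
    split_ifs <;> first | omega | rfl
  · intro x hx _ q
    have hq := q.2
    have h0 (i : ℕ) (hi : i < a + b + 2) : zeroExt x i 0 ≠ 0 :=
      zeroExt_ne_zero hx hi (by norm_num)
    simp only [of_apply, familyBCol]
    split_ifs <;> first | omega | exact one_ne_zero | skip
    · exact h0 _ (by omega)
    · exact neg_ne_zero.2 (h0 _ (by omega))
    · exact mul_ne_zero (zeroExt_ne_zero hx (by omega) (by norm_num)) (h0 _ (by omega))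
  · intro x hx _ p q h
    rw [Matrix.mul_apply]
    exact familyB_sum_eq_zero a b (zeroExt_minor (rankLeOne_eval_eq hx)) p q h

end FamilyB

end SchubertLCI

end

/-! ### Comparison of codimension and number of minors, and the conclusion. -/

noncomputable section

namespace SchubertLCI

theorem self_le_choose_two (a : ℕ) : a ≤ (a + 1).choose 2 := by
  rw [Nat.choose_succ_succ, Nat.choose_one_right]
  exact Nat.le_add_right _ _

theorem self_lt_choose_two {a : ℕ} (ha : 1 < a) : a < (a + 1).choose 2 := by
  rw [Nat.choose_succ_succ, Nat.choose_one_right]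
  exact Nat.lt_add_of_pos_right (Nat.choose_pos ha)

/-- Strictness fails for `a = b = 1`, where the model is the hypersurface of one determinant. -/
theorem mul_lt_choose_two_mul {a b : ℕ} (ha : 0 < a) (hb : 0 < b) (h : 1 < a ∨ 1 < b) :
    a * b < (a + 1).choose 2 * (b + 1).choose 2 := by
  rcases h with h | h
  · exact Nat.mul_lt_mul_of_lt_of_le (self_lt_choose_two h) (self_le_choose_two b)
      (Nat.choose_pos (by omega))
  · exact Nat.mul_lt_mul_of_le_of_lt (self_le_choose_two a) (self_lt_choose_two h)
      (Nat.choose_pos (by omega))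

end SchubertLCI

end

theorem proposition5p1 :
    -- Family A
    (∀ a b : ℕ, 0 < a → 0 < b → (1 < a ∨ 1 < b) →
      (familyA a b).NotLCIExactlyAtOrigin ∧
      (familyA a b).IsoTo (rankLeOneIdeal (a + 1) (b + 1)) ∧
      MoreGeneratorsThanCodim (rankLeOneIdeal (a + 1) (b + 1))
        (a * b) ((a + 1).choose 2 * (b + 1).choose 2)) ∧
    -- Family B
    (∀ a b : ℕ, 1 ≤ a + b →
      (familyB a b).NotLCIExactlyAtOrigin ∧
      (familyB a b).IsoTo (rankLeOneIdeal (a + b + 2) 2) ∧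
      MoreGeneratorsThanCodim (rankLeOneIdeal (a + b + 2) 2)
        (a + b + 1) ((a + b + 2).choose 2)) ∧
    -- the exceptional intervals C, D, E, F and their symmetric images
    (∀ I ∈ [intervalC, intervalD, intervalE, intervalEi,
        intervalF, intervalFi, intervalFrc, intervalFirc],
      I.NotLCIExactlyAtOrigin ∧ I.IsoTo cutCornerIdeal) ∧
    MoreGeneratorsThanCodim cutCornerIdeal 3 5 ∧
    -- the exceptional intervals G
    (∀ I ∈ [intervalG, intervalGrc],
      I.NotLCIExactlyAtOrigin ∧ I.IsoTo dependentOrthogonalIdealG) ∧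
    MoreGeneratorsThanCodim dependentOrthogonalIdealG 3 5 ∧
    -- the exceptional interval H
    (intervalH.NotLCIExactlyAtOrigin ∧ intervalH.IsoTo dependentOrthogonalIdealH) ∧
    MoreGeneratorsThanCodim dependentOrthogonalIdealH 5 10 := by
  refine ⟨fun a b ha hb hab => ?_, fun a b hab => ?_, ?_,
    isQuadricCone_cutCornerIdeal.moreGeneratorsThanCodim (by simp) (by norm_num), ?_,
    isQuadricCone_dependentOrthogonalIdealG.moreGeneratorsThanCodim (by simp) (by norm_num),
    intervalH_spec,
    isQuadricCone_dependentOrthogonalIdealH.moreGeneratorsThanCodim (by simp) (by norm_num)⟩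
  · have h := mul_lt_choose_two_mul ha hb hab
    obtain ⟨h1, h2⟩ := familyA_spec a b h
    exact ⟨h1, h2, (isQuadricCone_rankLeOneIdeal a b).moreGeneratorsThanCodim (by simp; ring) h⟩
  · obtain ⟨h1, h2⟩ := familyB_spec a b hab
    have h := isQuadricCone_rankLeOneIdeal (a + b + 1) 1
    rw [Nat.choose_self, mul_one] at h
    exact ⟨h1, h2, h.moreGeneratorsThanCodim (by simp; ring) (self_lt_choose_two (by omega))⟩
  · simp only [List.mem_cons, List.not_mem_nil, or_false]
    rintro I (rfl | rfl | rfl | rfl | rfl | rfl | rfl | rfl)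
    exacts [intervalC_spec, intervalD_spec, intervalE_spec, intervalEi_spec, intervalF_spec,
      intervalFi_spec, intervalFrc_spec, intervalFirc_spec]
  · simp only [List.mem_cons, List.not_mem_nil, or_false]
    rintro I (rfl | rfl)
    exacts [intervalG_spec, intervalGrc_spec]
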